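/- Let $E$ be an elliptic curve over $\mathbb{Q}$, given by a Weierstrass equation, and let $Q=(x_0,y_0)\in E(\mathbb{Q})$ be an affine rational point (a rational point other than the point at infinity). Then $E$ has a Weierstrass equation with integer coefficients $$Y^2+a_1XY+a_3Y=X^3+a_2X^2+a_4X \qquad (*)$$ in which $Q$ is the origin $(0,0)$, and even one with $a_1=0$. Fix any such equation $(*)$, let $\Delta$ be its discriminant, and call a prime $p$ good if $p$ divides neither $\Delta$ nor any nonzero coefficient $a_i$; all but finitely many primes are good. For a good prime $p$ let $E(\mathbb{F}_p)$ be the set of points of the reduction of $(*)$ in $\mathbb{P}^2(\mathbb{F}_p)$, including the point at infinity. There exist an infinite torsion-free nilpotent group $G$ of class exactly $2$ and a Lie ring $L$, associated to each other as follows: $G$ is generated by nine elements $x_1,\dots,x_9$, every element of $G$ is $x_1^{n_1}\cdots x_9^{n_9}$ for unique integers $n_k$, and there are integers $c_{ij}^k$ with $[x_i,x_j]=\prod_k x_k^{c_{ij}^k}$, where $x_k$ is central whenever some $c_{ij}^k\neq 0$; and $L$ is free as a $\mathbb{Z}$-module on $e_1,\dots,e_9$ with $(e_i,e_j)=\sum_k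 c_{ij}^k e_k$. There exist moreover two distinct lines $M_1,M_2$ in $\mathbb{P}^2$ over $\mathbb{Q}$, each given by a linear form with coprime integer coefficients, and rational functions $P_1,\dots,P_5\in\mathbb{Q}(X,Y)$ with $P_2\neq 0$, such that for every good prime $p$ (hence for almost all primes) and every $s\in\mathbb{C}$ with $\operatorname{Re}(s)>9$ the series $$\zeta^{\triangleleft}_{G,p}(s)=\sum_{H\triangleleft G,\ |G:H|\text{ a power of }p}|G:H|^{-s},\qquad \zeta^{\triangleleft}_{L,p}(s)=\sum_{I\text{ ideal of }L,\ |L:I|\text{ a power of }p}|L:I|^{-s}$$ converge absolutely, the functions $P_1,\dots,P_5$ are defined at $(p,p^{-s})$, and $$\zeta^{\triangleleft}_{G,p}(s)=\zeta^{\triangleleft}_{L,p}(s)=P_1(p,p^{-s})+|E(\mathbb{F}_p)|\,P_2(p,p^{-s})+|M_1\cap E(\mathbb{F}_p)|\,P_3(p,p^{-s})+|M_2\cap E(\mathbb{F}_p)|\,P_4(p,p^{-s})+|M_1\cap M_2\cap E(\mathbb{F}_p)|\,P_5(p,p^{-s}),$$ where $M_1,M_2$ are reduced modulo $p$. -/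

import Mathlib

open scoped LinearAlgebra.Projectivization

/-! ### Integral Weierstrass equations centred at a rational point -/

/-- `W₀` is a Weierstrass equation with integer coefficients for the curve `W` over `ℚ`, in
coordinates in which the point `(x, y)` is the origin. The substitution attached to
`C = (u, r, s, t)` is `(X, Y) ↦ (u² X + r, u³ Y + u² s X + t)`, which maps the origin to `(r, t)`. -/
def IsIntegralModelAt (W : WeierstrassCurve ℚ) (x y : ℚ) (W₀ : WeierstrassCurve ℤ) : Prop :=
  ∃ C : WeierstrassCurve.VariableChange ℚ,
    C • W = W₀.map (Int.castRingHom ℚ) ∧ C.r = x ∧ C.t = y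

/-- `p` divides neither the discriminant nor any of the nonzero coefficients of `W₀`. -/
def IsGoodPrime (W₀ : WeierstrassCurve ℤ) (p : ℕ) : Prop :=
  ¬ (p : ℤ) ∣ W₀.Δ ∧
    ∀ c ∈ ({W₀.a₁, W₀.a₂, W₀.a₃, W₀.a₄, W₀.a₆} : Set ℤ), c ≠ 0 → ¬ (p : ℤ) ∣ c

/-! ### Points over finite fields -/

/-- The points in the projective plane over `F` of the projective closure of a Weierstrass curve
(the point at infinity included). -/
def curvePoints {F : Type*} [Field F] (W : WeierstrassCurve F) : Set (ℙ F (Fin 3 → F)) :=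
  {P | W.toProjective.Equation P.rep}

/-- The points of the projective line `m₀ X + m₁ Y + m₂ Z = 0`. -/
def linePoints {F : Type*} [Field F] (m : Fin 3 → F) : Set (ℙ F (Fin 3 → F)) :=
  {P | m ⬝ᵥ P.rep = 0}

/-- The `𝔽_p`-points of the reduction of an integral Weierstrass equation. -/
def redCurve (p : ℕ) [Fact p.Prime] (W₀ : WeierstrassCurve ℤ) :
    Set (ℙ (ZMod p) (Fin 3 → ZMod p)) :=
  curvePoints (W₀.map (Int.castRingHom (ZMod p)))

/-- The `𝔽_p`-points of the reduction of a line with integer coefficients. -/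
def redLine (p : ℕ) [Fact p.Prime] (m : Fin 3 → ℤ) : Set (ℙ (ZMod p) (Fin 3 → ZMod p)) :=
  linePoints fun i => (m i : ZMod p)

/-- The coefficient vector of a line in the projective plane over `ℚ`, normalised to have coprime
integer entries (so that it also defines a line modulo every prime). -/
def IsPrimitiveVec (m : Fin 3 → ℤ) : Prop :=
  Finset.univ.gcd m = 1

/-! ### Rational functions in two variables -/

/-- The field `ℚ(X, Y)`. -/
abbrev RatFunc₂ : Type := FractionRing (MvPolynomial (Fin 2) ℚ)

/-- The rational function `P` is defined at `(u, v)` and takes the value `z` there. -/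
def HasValueAt (P : RatFunc₂) (u v z : ℂ) : Prop :=
  ∃ f g : MvPolynomial (Fin 2) ℚ,
    P * algebraMap (MvPolynomial (Fin 2) ℚ) RatFunc₂ g =
        algebraMap (MvPolynomial (Fin 2) ℚ) RatFunc₂ f ∧
      MvPolynomial.aeval ![u, v] g ≠ 0 ∧
      z = MvPolynomial.aeval ![u, v] f / MvPolynomial.aeval ![u, v] g

/-! ### Nilpotent groups, Lie rings and their normal zeta functions -/

/-- `G` is an infinite torsion-free nilpotent group of nilpotency class exactly two. -/
def IsTorsionFreeClassTwo (G : Type*) [Group G] : Prop :=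
  Infinite G ∧ (∀ g : G, g ≠ 1 → ¬ IsOfFinOrder g) ∧
    ∃ _ : Group.IsNilpotent G, Group.nilpotencyClass G = 2

/-- `L` is the Lie ring associated to the class-two group `G` through Mal'cev bases of length `d`:
`G` is generated by `x₁, …, x_d`, every element is `x₁ ^ n₁ ⋯ x_d ^ n_d` for unique integers `n_k`,
the commutators are `[x_i, x_j] = ∏ x_k ^ a_{ijk}` with only central `x_k` occurring, and `L` is
free over `ℤ` on `e₁, …, e_d` with `(e_i, e_j) = ∑ a_{ijk} e_k`. -/
def IsAssociatedLieRing (d : ℕ) (G L : Type*) [Group G] [LieRing L] : Prop :=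
  ∃ (x : Fin d → G) (e : Module.Basis (Fin d) ℤ L) (a : Fin d → Fin d → Fin d → ℤ),
    Subgroup.closure (Set.range x) = ⊤ ∧
    Function.Bijective (fun n : Fin d → ℤ => (List.ofFn fun k => x k ^ n k).prod) ∧
    (∀ i j, x i * x j * (x i)⁻¹ * (x j)⁻¹ = (List.ofFn fun k => x k ^ a i j k).prod) ∧
    (∀ i j k, a i j k ≠ 0 → x k ∈ Subgroup.center G) ∧
    (∀ i j, ⁅e i, e j⁆ = ∑ k, a i j k • e k)

/-- The local normal zeta function of `G` at `p`, the sum of `|G : H| ^ (-s)` over the normal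
subgroups `H` of `p`-power index, converges absolutely at `s` to `z`. -/
def HasGroupZeta (p : ℕ) (G : Type*) [Group G] (s z : ℂ) : Prop :=
  HasSum (fun H : {H : Subgroup G // H.Normal ∧ ∃ n : ℕ, H.index = p ^ n} =>
    (H.1.index : ℂ) ^ (-s)) z

/-- The local ideal zeta function of `L` at `p`, the sum of `|L : I| ^ (-s)` over the ideals `I` of
`p`-power index, converges absolutely at `s` to `z`. -/
def HasLieZeta (p : ℕ) (L : Type*) [LieRing L] (s z : ℂ) : Prop :=
  HasSum (fun I : {I : LieIdeal ℤ L // ∃ n : ℕ, I.toSubmodule.toAddSubgroup.index = p ^ n} =>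
    (I.1.toSubmodule.toAddSubgroup.index : ℂ) ^ (-s)) z

/-!
Let `U = V = Z = ℤ³` and let `B : U × V → Z` be the bilinear map whose matrix of linear forms
`U × V → ℤ`, indexed by the dual of `Z`, has as determinant the cubic form defining the curve. Take
for `G` and `L` the group and the Lie ring on `U × V × Z` in which `Z` is central and `u`, `v` have
bracket `B u v`. The normal subgroups of `G` and the ideals of `L` are the same lattices, and they
fibre over their trace `Λ` on `Z`: the rest is a lattice in `U × V` annihilated by `B` modulo `Λ`
together with a homomorphism to `Z / Λ`. So everything is determined by the index of the annihilator
of `B` modulo each lattice `Λ` of `p`-power index in `ℤ³`.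

Dividing by `p` reduces the sum over all `Λ` to those with cyclic quotient, which correspond to
primitive vectors modulo `p ^ a` up to units. There the index of the annihilator depends only on the
`p`-adic valuation of the cubic at the vector: where the cubic is smooth modulo `p` the matrix has
corank at most one everywhere. Hensel's lemma then counts the vectors with a given valuation in
terms of `|E(𝔽_p)|` alone, and for the same reason no line terms arise: `P₃ = P₄ = P₅ = 0`.
-/

/-! ### Weighted generating functions -/

/-- The family `X`, with multiplicities `c` and weights `w`, has generating function `g` on the disc
of radius `r`: the series `∑ c x * T ^ w x` converges absolutely to `g T` for `‖T‖ < r`. -/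
def HasGF (r : ℝ) {X : Type*} (c w : X → ℕ) (g : ℂ → ℂ) : Prop :=
  ∀ T : ℂ, ‖T‖ < r → HasSum (fun x => (c x : ℂ) * T ^ w x) (g T)

namespace HasGF

variable {r : ℝ} {X : Type*} {c w : X → ℕ} {g : ℂ → ℂ}

theorem hasSum_norm (h : HasGF r c w g) {T : ℂ} (hT : ‖T‖ < r) :
    HasSum (fun x => ‖(c x : ℂ) * T ^ w x‖) (g ‖T‖).re := by
  have hsum := Complex.hasSum_re (h (‖T‖ : ℝ) (by simpa using hT))
  refine hsum.congr_fun fun x => ?_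
  rw [norm_mul, norm_pow, Complex.norm_natCast, ← Complex.ofReal_natCast, ← Complex.ofReal_pow,
    ← Complex.ofReal_mul, Complex.ofReal_re]

/-- Absolute convergence of the whole double series is not assumed: applying the two hypotheses to
the real point `‖T‖`, where all terms are nonnegative, supplies it. -/
theorem sigma {ι : Type*} {κ : ι → Type*} {c w : (Σ i, κ i) → ℕ} {g : ι → ℂ → ℂ} {G : ℂ → ℂ}
    (h : ∀ i, HasGF r (fun k => c ⟨i, k⟩) (fun k => w ⟨i, k⟩) (g i))
    (hG : ∀ T : ℂ, ‖T‖ < r → HasSum (fun i => g i T) (G T)) : HasGF r c w G := by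
  intro T hT
  have hT' : ‖((‖T‖ : ℝ) : ℂ)‖ < r := by simpa using hT
  have hs : Summable fun x : Σ i, κ i => ‖(c x : ℂ) * T ^ w x‖ := by
    rw [summable_sigma_of_nonneg fun _ => norm_nonneg _]
    refine ⟨fun i => ((h i).hasSum_norm hT).summable, ?_⟩
    simpa only [((h _).hasSum_norm hT).tsum_eq] using (Complex.hasSum_re (hG _ hT')).summable
  have hsum := hs.of_norm.hasSum
  rwa [(hsum.sigma fun i => h i T hT).unique (hG T hT)] at hsum

theorem equiv {Y : Type*} (e : Y ≃ X) (h : HasGF r c w g) : HasGF r (c ∘ e) (w ∘ e) g :=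
  fun T hT => (e.hasSum_iff (f := fun x => (c x : ℂ) * T ^ w x)).2 (h T hT)

theorem congr {c' w' : X → ℕ} {g' : ℂ → ℂ} (h : HasGF r c w g) (hc : ∀ x, c' x = c x)
    (hw : ∀ x, w' x = w x) (hg : ∀ T, g' T = g T) : HasGF r c' w' g' := by
  obtain rfl := funext hc
  obtain rfl := funext hw
  obtain rfl := funext hg
  exact h

theorem mono {r' : ℝ} (h : HasGF r c w g) (hr : r' ≤ r) : HasGF r' c w g :=
  fun T hT => h T (hT.trans_le hr)

end HasGF

/-! ### Subgroups of a product of two abelian groups -/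

section Gluing

variable {A C : Type*} [AddCommGroup A] [AddCommGroup C]

/-- The subgroup of `A × C` glued from its projection `J` to `A`, its trace `Λ` on `C` and the map
`φ : J → C ⧸ Λ`; every subgroup arises in exactly one way from such data. -/
def gluedSubgroup (J : AddSubgroup A) (Λ : AddSubgroup C) (φ : J →+ C ⧸ Λ) :
    AddSubgroup (A × C) :=
  (φ.coprod (-QuotientAddGroup.mk' Λ)).ker.map (J.subtype.prodMap (AddMonoidHom.id C))

theorem mem_gluedSubgroup {J : AddSubgroup A} {Λ : AddSubgroup C} {φ : J →+ C ⧸ Λ} {x : A × C} :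
    x ∈ gluedSubgroup J Λ φ ↔ ∃ h : x.1 ∈ J, φ ⟨x.1, h⟩ = (x.2 : C ⧸ Λ) := by
  constructor
  · rintro ⟨⟨a, c⟩, h, rfl⟩
    exact ⟨a.2, sub_eq_zero.1 ((sub_eq_add_neg _ _).trans h)⟩
  · rintro ⟨h, hx⟩
    exact ⟨(⟨x.1, h⟩, x.2), (sub_eq_add_neg _ _).symm.trans (sub_eq_zero.2 hx), rfl⟩

theorem gluedSubgroup_map_fst (J : AddSubgroup A) (Λ : AddSubgroup C) (φ : J →+ C ⧸ Λ) :
    (gluedSubgroup J Λ φ).map (AddMonoidHom.fst A C) = J := by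
  ext a
  constructor
  · rintro ⟨x, hx, rfl⟩
    exact (mem_gluedSubgroup.1 hx).1
  · intro h
    obtain ⟨c, hc⟩ := QuotientAddGroup.mk_surjective (φ ⟨a, h⟩)
    exact ⟨(a, c), mem_gluedSubgroup.2 ⟨h, hc.symm⟩, rfl⟩

theorem gluedSubgroup_comap_inr (J : AddSubgroup A) (Λ : AddSubgroup C) (φ : J →+ C ⧸ Λ) :
    (gluedSubgroup J Λ φ).comap (AddMonoidHom.inr A C) = Λ := by
  ext c
  have hφ : φ ⟨0, J.zero_mem⟩ = 0 := map_zero φ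
  simp only [AddSubgroup.mem_comap, mem_gluedSubgroup, AddMonoidHom.inr_apply, hφ, J.zero_mem,
    exists_true_left]
  rw [eq_comm, QuotientAddGroup.eq_zero_iff]

theorem gluedSubgroup_injective (J : AddSubgroup A) (Λ : AddSubgroup C) :
    Function.Injective (gluedSubgroup J Λ) := by
  intro φ φ' h
  ext ⟨a, ha⟩
  obtain ⟨c, hc⟩ := QuotientAddGroup.mk_surjective (φ ⟨a, ha⟩)
  have hmem : (a, c) ∈ gluedSubgroup J Λ φ := mem_gluedSubgroup.2 ⟨ha, hc.symm⟩
  rw [h] at hmem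
  exact hc.symm.trans (mem_gluedSubgroup.1 hmem).2.symm

theorem exists_gluingMap (I : AddSubgroup (A × C)) :
    ∃ φ : I.map (AddMonoidHom.fst A C) →+ C ⧸ I.comap (AddMonoidHom.inr A C),
      gluedSubgroup _ _ φ = I := by
  let π := (AddMonoidHom.fst A C).addSubgroupMap I
  let ψ := (QuotientAddGroup.mk' (I.comap (AddMonoidHom.inr A C))).comp
    ((AddMonoidHom.snd A C).comp I.subtype)
  have hψ : π.ker ≤ ψ.ker := by
    rintro ⟨⟨a, c⟩, hx⟩ h
    obtain rfl : a = 0 := congrArg Subtype.val h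
    exact (QuotientAddGroup.eq_zero_iff c).2 hx
  let φ := π.liftOfSurjective (AddMonoidHom.addSubgroupMap_surjective _ I) ⟨ψ, hψ⟩
  have hφ : ∀ x : I, φ (π x) = (x.1.2 : C ⧸ I.comap (AddMonoidHom.inr A C)) :=
    π.liftOfRightInverse_comp_apply _ _ ⟨ψ, hψ⟩
  refine ⟨φ, ?_⟩
  ext ⟨a, d⟩
  rw [mem_gluedSubgroup]
  constructor
  · rintro ⟨⟨⟨a', c⟩, hx, ha⟩, h⟩
    obtain rfl : a' = a := ha
    have hcd : (0, -c + d) ∈ I := QuotientAddGroup.eq.1 ((hφ ⟨_, hx⟩).symm.trans h)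
    simpa using I.add_mem hx hcd
  · exact fun h => ⟨⟨_, h, rfl⟩, hφ ⟨_, h⟩⟩

theorem gluedSubgroup_bijective : Function.Bijective
    (fun t : Σ Λ : AddSubgroup C, Σ J : AddSubgroup A, J →+ C ⧸ Λ =>
      gluedSubgroup t.2.1 t.1 t.2.2) := by
  constructor
  · rintro ⟨Λ, J, φ⟩ ⟨Λ', J', φ'⟩ h
    dsimp only at h
    obtain rfl : Λ = Λ' := by
      rw [← gluedSubgroup_comap_inr J Λ φ, h, gluedSubgroup_comap_inr]
    obtain rfl : J = J' := by
      rw [← gluedSubgroup_map_fst J Λ φ, h, gluedSubgroup_map_fst]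
    rw [gluedSubgroup_injective J Λ h]
  · intro I
    obtain ⟨φ, hφ⟩ := exists_gluingMap I
    exact ⟨⟨_, _, φ⟩, hφ⟩

theorem index_eq_map_fst_mul_comap_inr (I : AddSubgroup (A × C)) :
    I.index = (I.map (AddMonoidHom.fst A C)).index * (I.comap (AddMonoidHom.inr A C)).index := by
  have hr : (AddMonoidHom.inr A C).range = (AddMonoidHom.fst A C).ker := by
    ext x
    simp only [AddMonoidHom.mem_range, AddMonoidHom.mem_ker, AddMonoidHom.inr_apply]
    exact ⟨by rintro ⟨y, rfl⟩; rfl, fun h => ⟨x.2, Prod.ext h.symm rfl⟩⟩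
  rw [AddSubgroup.index_map, AddSubgroup.index_comap, hr,
    AddMonoidHom.range_eq_top.2 Prod.fst_surjective, AddSubgroup.index_top, mul_one, mul_comm,
    ← AddSubgroup.relIndex_mul_index (le_sup_left : I ≤ I ⊔ (AddMonoidHom.fst A C).ker),
    AddSubgroup.relIndex_sup_left]

theorem gluedSubgroup_index (J : AddSubgroup A) (Λ : AddSubgroup C) (φ : J →+ C ⧸ Λ) :
    (gluedSubgroup J Λ φ).index = J.index * Λ.index := by
  rw [index_eq_map_fst_mul_comap_inr, gluedSubgroup_map_fst, gluedSubgroup_comap_inr]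

end Gluing

/-! ### Counting subgroups of `p`-power index -/

/-- `H` has `p`-power index. -/
def HasPIndex (p : ℕ) {A : Type*} [AddGroup A] (H : AddSubgroup A) : Prop :=
  ∃ n : ℕ, H.index = p ^ n

/-- The exponent of `p` in the index of `H`; its junk value for a subgroup of infinite index
is `0`. -/
noncomputable def indexExp (p : ℕ) {A : Type*} [AddGroup A] (H : AddSubgroup A) : ℕ :=
  padicValNat p H.index

/-- `g` is the generating function of the subgroups of `p`-power index of `A`. -/
def HasSubgroupGF (p : ℕ) (r : ℝ) (A : Type*) [AddGroup A] (g : ℂ → ℂ) : Prop :=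
  HasGF r (fun _ : {H : AddSubgroup A // HasPIndex p H} => 1) (fun H => indexExp p H.1) g

theorem hasPIndex_top (p : ℕ) {A : Type*} [AddGroup A] : HasPIndex p (⊤ : AddSubgroup A) :=
  ⟨0, by rw [AddSubgroup.index_top, pow_zero]⟩

theorem indexExp_top (p : ℕ) {A : Type*} [AddGroup A] : indexExp p (⊤ : AddSubgroup A) = 0 := by
  rw [indexExp, AddSubgroup.index_top, padicValNat_one_right]

theorem HasSubgroupGF.of_addEquiv {p : ℕ} {A B : Type*} [AddGroup A] [AddGroup B] {r : ℝ}
    {g : ℂ → ℂ} (e : A ≃+ B) (h : HasSubgroupGF p r B g) : HasSubgroupGF p r A g := by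
  have hindex (H : AddSubgroup A) : (e.mapAddSubgroup H).index = H.index :=
    AddSubgroup.index_map_of_bijective e.bijective H
  let E : {H : AddSubgroup A // HasPIndex p H} ≃ {H : AddSubgroup B // HasPIndex p H} :=
    e.mapAddSubgroup.toEquiv.subtypeEquiv fun H => by
      rw [HasPIndex, HasPIndex, RelIso.coe_fn_toEquiv, hindex]
  exact (h.equiv E).congr (fun _ => rfl) (fun H => congrArg (padicValNat p) (hindex H.1).symm)
    fun _ => rfl

theorem hasSubgroupGF_of_subsingleton (p : ℕ) (A : Type*) [AddGroup A] [Subsingleton A]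
    (r : ℝ) :
    HasSubgroupGF p r A fun _ => 1 := by
  intro T _
  have hdefault (H : {H : AddSubgroup A // HasPIndex p H}) : H = ⟨⊤, hasPIndex_top p⟩ :=
    Subtype.ext (Subsingleton.elim _ _)
  have : Unique {H : AddSubgroup A // HasPIndex p H} := ⟨⟨⟨⊤, hasPIndex_top p⟩⟩, hdefault⟩
  convert hasSum_unique fun H : {H : AddSubgroup A // HasPIndex p H} =>
    ((1 : ℕ) : ℂ) * T ^ indexExp p H.1
  rw [hdefault default, indexExp_top, Nat.cast_one, one_mul, pow_zero]

section FreeAbelianGroup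

variable {A : Type*} [AddCommGroup A] [Module.Free ℤ A] [Module.Finite ℤ A]

theorem natCard_addMonoidHom (Q : Type*) [AddCommGroup Q] :
    Nat.card (A →+ Q) = Nat.card Q ^ Module.finrank ℤ A := by
  rw [← Nat.card_congr (addMonoidHomLequivInt (A := A) (B := Q) ℤ).symm.toEquiv,
    ← Nat.card_congr ((Module.finBasis ℤ A).constr ℤ (M' := Q)).toEquiv, Nat.card_fun,
    Nat.card_fin]

theorem nonempty_addEquiv_of_index_ne_zero {H : AddSubgroup A} (h : H.index ≠ 0) :
    Nonempty (H ≃+ A) := by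
  let e := (Module.finBasis ℤ A).equivFun.toAddEquiv
  obtain ⟨f⟩ := Int.addSubgroup_index_ne_zero_iff.1
    ((AddSubgroup.index_map_of_bijective (f := e.toAddMonoidHom) e.bijective H).trans_ne h)
  exact ⟨((e.addSubgroupMap H).trans f).trans e.symm⟩

end FreeAbelianGroup

section PIndex

variable {p : ℕ} [hp : Fact p.Prime] {A B C : Type*} [AddCommGroup A] [AddCommGroup B]
  [AddCommGroup C]

theorem indexExp_eq {H : AddSubgroup A} {n : ℕ} (h : H.index = p ^ n) : indexExp p H = n := by
  rw [indexExp, h, padicValNat.prime_pow]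

theorem HasPIndex.index_eq {H : AddSubgroup A} (h : HasPIndex p H) :
    H.index = p ^ indexExp p H := by
  obtain ⟨n, hn⟩ := h
  rw [indexExp_eq hn, hn]

theorem HasPIndex.index_ne_zero {H : AddSubgroup A} (h : HasPIndex p H) : H.index ≠ 0 := by
  rw [h.index_eq]
  exact pow_ne_zero _ hp.out.ne_zero

theorem HasPIndex.of_dvd {H : AddSubgroup A} {n : ℕ} (h : H.index ∣ p ^ n) : HasPIndex p H := by
  obtain ⟨k, -, hk⟩ := (Nat.dvd_prime_pow hp.out).1 h
  exact ⟨k, hk⟩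

theorem indexExp_eq_add {H : AddSubgroup A} {K : AddSubgroup B} {D : AddSubgroup C}
    (hK : HasPIndex p K) (hD : HasPIndex p D) (h : H.index = K.index * D.index) :
    indexExp p H = indexExp p K + indexExp p D := by
  apply indexExp_eq
  rw [h, hK.index_eq, hD.index_eq, pow_add]

theorem hasPIndex_iff_and_of_index_eq_mul {H : AddSubgroup A} {K : AddSubgroup B}
    {D : AddSubgroup C} (h : H.index = K.index * D.index) :
    HasPIndex p H ↔ HasPIndex p K ∧ HasPIndex p D := by
  constructor
  · rintro ⟨n, hn⟩
    rw [h] at hn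
    exact ⟨.of_dvd (Dvd.intro _ hn), .of_dvd (Dvd.intro_left _ hn)⟩
  · rintro ⟨⟨n, hn⟩, ⟨m, hm⟩⟩
    exact ⟨n + m, by rw [h, hn, hm, pow_add]⟩

theorem index_map_subtype (X : AddSubgroup A) (H : AddSubgroup X) :
    (H.map X.subtype).index = H.index * X.index := by
  rw [AddSubgroup.index_map_of_injective H X.subtype_injective, X.range_subtype]

/-- The subgroups of `p`-power index of `X` are those of `A` contained in `X`. -/
noncomputable def subgroupsLEEquiv {X : AddSubgroup A} (hX : HasPIndex p X) :
    {H : AddSubgroup X // HasPIndex p H} ≃ {H : AddSubgroup A // HasPIndex p H ∧ H ≤ X} :=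
  Equiv.ofBijective (fun H => ⟨H.1.map X.subtype,
    (hasPIndex_iff_and_of_index_eq_mul (index_map_subtype X H.1)).2 ⟨H.2, hX⟩,
      AddSubgroup.map_subtype_le _⟩) <| by
    constructor
    · intro H K hHK
      exact Subtype.ext (AddSubgroup.map_injective X.subtype_injective (Subtype.ext_iff.1 hHK))
    · rintro ⟨H, hH, hle⟩
      have hmap : (H.addSubgroupOf X).map X.subtype = H := by
        rw [AddSubgroup.addSubgroupOf_map_subtype, inf_eq_left.2 hle]
      have hindex := index_map_subtype X (H.addSubgroupOf X)
      rw [hmap] at hindex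
      exact ⟨⟨H.addSubgroupOf X, ((hasPIndex_iff_and_of_index_eq_mul hindex).1 hH).1⟩,
        Subtype.ext hmap⟩

theorem HasSubgroupGF.hasGF_le {r : ℝ} {g : ℂ → ℂ} {X : AddSubgroup A}
    (h : HasSubgroupGF p r X g) (hX : HasPIndex p X) :
    HasGF r (fun _ : {H : AddSubgroup A // HasPIndex p H ∧ H ≤ X} => 1)
      (fun H => indexExp p H.1) (fun T => T ^ indexExp p X * g T) := by
  intro T hT
  rw [← (subgroupsLEEquiv hX).hasSum_iff]
  refine ((h T hT).mul_left (T ^ indexExp p X)).congr_fun fun H => ?_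
  have hexp : indexExp p (subgroupsLEEquiv hX H).1 = indexExp p H.1 + indexExp p X :=
    indexExp_eq_add H.2 hX (index_map_subtype X H.1)
  simp only [Function.comp_apply, hexp, pow_add]
  ring

theorem hasPIndex_gluedSubgroup_iff {J : AddSubgroup A} {Λ : AddSubgroup C} (φ : J →+ C ⧸ Λ) :
    HasPIndex p (gluedSubgroup J Λ φ) ↔ HasPIndex p J ∧ HasPIndex p Λ :=
  hasPIndex_iff_and_of_index_eq_mul (gluedSubgroup_index J Λ φ)

/-- The subgroups of `A × C` of `p`-power index whose image in `A` is bounded in terms of their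
trace on `C`, described by gluing data. -/
noncomputable def gluedEquiv (p : ℕ) [Fact p.Prime] (X : AddSubgroup C → AddSubgroup A) :
    (Σ Λ : {Λ : AddSubgroup C // HasPIndex p Λ},
      Σ J : {J : AddSubgroup A // HasPIndex p J ∧ J ≤ X Λ.1}, J.1 →+ C ⧸ Λ.1) ≃
      {I : AddSubgroup (A × C) // HasPIndex p I ∧
        I.map (AddMonoidHom.fst A C) ≤ X (I.comap (AddMonoidHom.inr A C))} :=
  Equiv.ofBijective (fun t => ⟨gluedSubgroup t.2.1.1 t.1.1 t.2.2,
        (hasPIndex_gluedSubgroup_iff _).2 ⟨t.2.1.2.1, t.1.2⟩, by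
          rw [gluedSubgroup_map_fst, gluedSubgroup_comap_inr]; exact t.2.1.2.2⟩) <| by
    constructor
    · rintro ⟨⟨Λ, hΛ⟩, ⟨J, hJ⟩, φ⟩ ⟨⟨Λ', hΛ'⟩, ⟨J', hJ'⟩, φ'⟩ h
      cases gluedSubgroup_bijective.1 (a₁ := ⟨Λ, J, φ⟩) (a₂ := ⟨Λ', J', φ'⟩)
        (congrArg Subtype.val h)
      rfl
    · rintro ⟨I, hI, hle⟩
      obtain ⟨⟨Λ, J, φ⟩, rfl⟩ := gluedSubgroup_bijective.2 I
      dsimp only at hI hle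
      rw [gluedSubgroup_map_fst, gluedSubgroup_comap_inr] at hle
      rw [hasPIndex_gluedSubgroup_iff] at hI
      exact ⟨⟨⟨Λ, hI.2⟩, ⟨J, hI.1, hle⟩, φ⟩, rfl⟩

section Fibration

variable [Module.Free ℤ A] [Module.Finite ℤ A] {r : ℝ} {z g : ℂ → ℂ}

theorem hasSum_addMonoidHom_of_index_ne_zero {J : AddSubgroup A} (hJ : J.index ≠ 0) (Q : Type*)
    [AddCommGroup Q] [Finite Q] (c : ℂ) :
    HasSum (fun _ : J →+ Q => c) ((Nat.card Q : ℂ) ^ Module.finrank ℤ A * c) := by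
  obtain ⟨e⟩ := nonempty_addEquiv_of_index_ne_zero hJ
  have hcard : Nat.card (J →+ Q) = Nat.card Q ^ Module.finrank ℤ A := by
    rw [Nat.card_congr (e.addMonoidHomCongrLeft (N := Q)).toEquiv, natCard_addMonoidHom]
  have : Finite (J →+ Q) := Nat.finite_of_card_ne_zero (by
    rw [hcard]; exact pow_ne_zero _ Nat.card_pos.ne')
  have : Fintype (J →+ Q) := Fintype.ofFinite _
  have hsum := hasSum_fintype fun _ : J →+ Q => c
  rwa [Finset.sum_const, Finset.card_univ, ← Nat.card_eq_fintype_card, hcard, nsmul_eq_mul,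
    Nat.cast_pow] at hsum

theorem HasSubgroupGF.hasGF_le_addMonoidHom (hz : HasSubgroupGF p r A z) {X : AddSubgroup A}
    (hX : HasPIndex p X) (Q : Type*) [AddCommGroup Q] [Finite Q] (m : ℕ) :
    HasGF r (fun _ : Σ J : {J : AddSubgroup A // HasPIndex p J ∧ J ≤ X}, J.1 →+ Q => 1)
      (fun t => m + indexExp p t.1.1) (fun T => (Nat.card Q : ℂ) ^ Module.finrank ℤ A *
        T ^ m * (T ^ indexExp p X * z T)) := by
  obtain ⟨e⟩ := nonempty_addEquiv_of_index_ne_zero hX.index_ne_zero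
  refine HasGF.sigma (g := fun J T => (Nat.card Q : ℂ) ^ Module.finrank ℤ A * T ^ m *
    T ^ indexExp p J.1) (fun J T _ => ?_) fun T hT => ?_
  · simpa only [Nat.cast_one, one_mul, pow_add, mul_assoc] using
      hasSum_addMonoidHom_of_index_ne_zero J.2.1.index_ne_zero Q (T ^ m * T ^ indexExp p J.1)
  · simpa only [Nat.cast_one, one_mul] using
      ((hz.of_addEquiv e).hasGF_le hX T hT).mul_left ((Nat.card Q : ℂ) ^ Module.finrank ℤ A * T ^ m)

theorem HasSubgroupGF.hasGF_fibration (hz : HasSubgroupGF p r A z)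
    (X : AddSubgroup C → AddSubgroup A) (hX : ∀ Λ, HasPIndex p Λ → HasPIndex p (X Λ))
    (hg : HasGF r (fun Λ : {Λ : AddSubgroup C // HasPIndex p Λ} =>
      Λ.1.index ^ Module.finrank ℤ A) (fun Λ => indexExp p Λ.1 + indexExp p (X Λ.1)) g) :
    HasGF r (fun _ : {I : AddSubgroup (A × C) // HasPIndex p I ∧
        I.map (AddMonoidHom.fst A C) ≤ X (I.comap (AddMonoidHom.inr A C))} => 1)
      (fun I => indexExp p I.1) (fun T => g T * z T) := by
  let E := gluedEquiv p X
  have hdata : HasGF r (fun _ : (Σ Λ : {Λ : AddSubgroup C // HasPIndex p Λ},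
      Σ J : {J : AddSubgroup A // HasPIndex p J ∧ J ≤ X Λ.1}, J.1 →+ C ⧸ Λ.1) => 1)
      (fun t => indexExp p t.1.1 + indexExp p t.2.1.1) (fun T => g T * z T) := by
    have hfin (Λ : {Λ : AddSubgroup C // HasPIndex p Λ}) : Finite (C ⧸ Λ.1) :=
      have : Λ.1.FiniteIndex := ⟨Λ.2.index_ne_zero⟩
      inferInstance
    refine HasGF.sigma
      (fun Λ => hz.hasGF_le_addMonoidHom (hX _ Λ.2) (C ⧸ Λ.1) (indexExp p Λ.1)) fun T hT => ?_
    refine ((hg T hT).mul_right (z T)).congr_fun fun Λ => ?_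
    simp only [AddSubgroup.index_eq_card, pow_add, Nat.cast_pow]
    ring
  refine (hdata.equiv E.symm).congr (fun _ => rfl) (fun I => ?_) (fun _ => rfl)
  obtain ⟨t, rfl⟩ := E.surjective I
  have ht : indexExp p (E t).1 = indexExp p t.2.1.1 + indexExp p t.1.1 :=
    indexExp_eq_add t.2.1.2.1 t.1.2 (gluedSubgroup_index _ _ _)
  rw [ht, Function.comp_apply, E.symm_apply_apply, add_comm]

end Fibration

theorem index_zmultiples_pow (m k : ℕ) :
    (AddSubgroup.zmultiples ((m : ℤ) ^ k)).index = m ^ k := by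
  rw [Int.index_zmultiples, Int.natAbs_pow, Int.natAbs_natCast]

/-- The subgroups of `ℤ` of `p`-power index, parametrised by the exponent. -/
noncomputable def intSubgroupsEquiv (p : ℕ) [hp : Fact p.Prime] :
    ℕ ≃ {Λ : AddSubgroup ℤ // HasPIndex p Λ} :=
  .ofBijective (fun k => ⟨AddSubgroup.zmultiples ((p : ℤ) ^ k), k, index_zmultiples_pow p k⟩) <| by
    constructor
    · intro k l hkl
      have hpow := congrArg (fun H => H.1.index) hkl
      simp only [index_zmultiples_pow] at hpow
      exact Nat.pow_right_injective hp.out.two_le hpow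
    · rintro ⟨Λ, k, hk⟩
      obtain ⟨a, rfl⟩ := Int.subgroup_cyclic Λ
      rw [← AddSubgroup.zmultiples_eq_closure, Int.index_zmultiples] at hk
      refine ⟨k, Subtype.ext ?_⟩
      change AddSubgroup.zmultiples ((p : ℤ) ^ k) = AddSubgroup.closure {a}
      rw [← AddSubgroup.zmultiples_eq_closure, ← Int.zmultiples_natAbs a, hk, Nat.cast_pow]

theorem index_intSubgroupsEquiv (k : ℕ) : (intSubgroupsEquiv p k).1.index = p ^ k :=
  index_zmultiples_pow p k

theorem hasGF_int_subgroups (n : ℕ) :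
    HasGF (((p : ℝ) ^ n)⁻¹) (fun Λ : {Λ : AddSubgroup ℤ // HasPIndex p Λ} => Λ.1.index ^ n)
      (fun Λ => indexExp p Λ.1) (fun T => (1 - (p : ℂ) ^ n * T)⁻¹) := by
  intro T hT
  have hlt : ‖(p : ℂ) ^ n * T‖ < 1 := by
    have hpos : (0 : ℝ) < (p : ℝ) ^ n := pow_pos (by exact_mod_cast hp.out.pos) _
    rw [norm_mul, norm_pow, Complex.norm_natCast]
    rwa [mul_comm, ← lt_div_iff₀ hpos, one_div]
  rw [← (intSubgroupsEquiv p).hasSum_iff]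
  refine (hasSum_geometric_of_norm_lt_one hlt).congr_fun fun k => ?_
  simp only [Function.comp_apply, indexExp_eq (index_intSubgroupsEquiv k),
    index_intSubgroupsEquiv, mul_pow]
  push_cast
  ring

theorem HasSubgroupGF.prod_int [Module.Free ℤ A] [Module.Finite ℤ A] {z : ℂ → ℂ}
    (hz : HasSubgroupGF p (((p : ℝ) ^ Module.finrank ℤ A)⁻¹) A z) :
    HasSubgroupGF p (((p : ℝ) ^ Module.finrank ℤ A)⁻¹) (A × ℤ)
      fun T => (1 - (p : ℂ) ^ Module.finrank ℤ A * T)⁻¹ * z T := by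
  have hfib := hz.hasGF_fibration (C := ℤ) (fun _ => ⊤) (fun _ _ => hasPIndex_top p)
    ((hasGF_int_subgroups _).congr (fun _ => rfl) (fun _ => by rw [indexExp_top, add_zero])
      fun _ => rfl)
  let E : {I : AddSubgroup (A × ℤ) // HasPIndex p I} ≃
      {I : AddSubgroup (A × ℤ) // HasPIndex p I ∧ I.map (AddMonoidHom.fst A ℤ) ≤ ⊤} :=
    Equiv.subtypeEquivRight fun I => by simp only [le_top, and_true]
  exact hfib.equiv E

theorem hasSubgroupGF_fin_int (n : ℕ) : HasSubgroupGF p (((p : ℝ) ^ n)⁻¹) (Fin n → ℤ)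
    fun T => ∏ i ∈ Finset.range n, (1 - (p : ℂ) ^ i * T)⁻¹ := by
  induction n with
  | zero => simpa using hasSubgroupGF_of_subsingleton p (Fin 0 → ℤ) 1
  | succ n ih =>
    have hle : ((p : ℝ) ^ (n + 1))⁻¹ ≤ ((p : ℝ) ^ n)⁻¹ := by
      have hp1 : (1 : ℝ) ≤ p := by exact_mod_cast hp.out.one_le
      gcongr
      exact n.le_succ
    let e : (Fin (n + 1) → ℤ) ≃+ (Fin n → ℤ) × ℤ :=
      { (Fin.snocEquiv (n := n) fun _ => ℤ).symm.trans (Equiv.prodComm _ _) with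
        map_add' := fun _ _ => rfl }
    have hprod := HasSubgroupGF.prod_int (A := Fin n → ℤ) (by rwa [Module.finrank_fin_fun])
    rw [Module.finrank_fin_fun] at hprod
    refine ((hprod.of_addEquiv e).mono hle).congr (fun _ => rfl) (fun _ => rfl) fun T => ?_
    rw [Finset.prod_range_succ, mul_comm]

theorem hasSubgroupGF_of_free (p : ℕ) [Fact p.Prime] (A : Type*) [AddCommGroup A]
    [Module.Free ℤ A] [Module.Finite ℤ A] :
    HasSubgroupGF p (((p : ℝ) ^ Module.finrank ℤ A)⁻¹) A
      fun T => ∏ i ∈ Finset.range (Module.finrank ℤ A), (1 - (p : ℂ) ^ i * T)⁻¹ :=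
  (hasSubgroupGF_fin_int _).of_addEquiv (Module.finBasis ℤ A).equivFun.toAddEquiv

end PIndex

/-! ### Division of lattices by `p` -/

section Lattice

variable {A : Type*} [AddCommGroup A]

/-- The elements `z` with `p • z ∈ Φ`. -/
def pDiv (p : ℕ) (Φ : AddSubgroup A) : AddSubgroup A := Φ.comap (nsmulAddMonoidHom p)

/-- The multiples `p • z` with `z ∈ Λ`. -/
def pMul (p : ℕ) (Λ : AddSubgroup A) : AddSubgroup A := Λ.map (nsmulAddMonoidHom p)

/-- The index of `Φ + p A` in `A`, that is, the index of the reduction of `Φ` modulo `p`. -/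
noncomputable def residueIndex (p : ℕ) (Φ : AddSubgroup A) : ℕ := (Φ ⊔ pMul p ⊤).index

theorem mem_pDiv {p : ℕ} {Φ : AddSubgroup A} {z : A} : z ∈ pDiv p Φ ↔ p • z ∈ Φ := Iff.rfl

theorem le_pDiv (p : ℕ) (Φ : AddSubgroup A) : Φ ≤ pDiv p Φ := fun _ hz => Φ.nsmul_mem hz p

theorem pMul_mono {p : ℕ} {Φ Λ : AddSubgroup A} (h : Φ ≤ Λ) : pMul p Φ ≤ pMul p Λ :=
  AddSubgroup.map_mono h

theorem pMul_le (p : ℕ) (Λ : AddSubgroup A) : pMul p Λ ≤ Λ := by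
  rintro _ ⟨z, hz, rfl⟩
  exact Λ.nsmul_mem hz p

theorem pMul_pDiv (p : ℕ) (Φ : AddSubgroup A) : pMul p (pDiv p Φ) = Φ ⊓ pMul p ⊤ := by
  rw [pMul, pDiv, AddSubgroup.map_comap_eq, pMul, ← AddMonoidHom.range_eq_map, inf_comm]

theorem index_eq_residueIndex_mul (p : ℕ) (Φ : AddSubgroup A) :
    Φ.index = residueIndex p Φ * (pDiv p Φ).index := by
  rw [pDiv, AddSubgroup.index_comap, residueIndex,
    ← AddSubgroup.relIndex_mul_index (le_sup_left : Φ ≤ Φ ⊔ pMul p ⊤),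
    AddSubgroup.relIndex_sup_left, mul_comm, pMul, AddMonoidHom.range_eq_map]

theorem mem_of_pow_nsmul_mem {p : ℕ} {Φ : AddSubgroup A} (hle : pDiv p Φ ≤ Φ) (n : ℕ) {z : A}
    (hz : p ^ n • z ∈ Φ) : z ∈ Φ := by
  induction n generalizing z with
  | zero => simpa using hz
  | succ n ih =>
    rw [pow_succ, mul_smul] at hz
    exact hle (ih hz)

section TorsionFree

variable [IsAddTorsionFree A] {p : ℕ} (hp : p ≠ 0)
include hp

theorem pDiv_pMul (Λ : AddSubgroup A) : pDiv p (pMul p Λ) = Λ :=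
  AddSubgroup.comap_map_eq_self_of_injective (nsmul_right_injective hp) Λ

theorem pDiv_eq_iff {Φ Λ : AddSubgroup A} : pDiv p Φ = Λ ↔ Φ ⊓ pMul p ⊤ = pMul p Λ := by
  rw [← pMul_pDiv]
  have hinj : Function.Injective (nsmulAddMonoidHom p : A →+ A) := nsmul_right_injective hp
  exact (AddSubgroup.map_injective hinj).eq_iff.symm

theorem index_pMul (Λ : AddSubgroup A) :
    (pMul p Λ).index = (pMul p (⊤ : AddSubgroup A)).index * Λ.index := by
  rw [index_eq_residueIndex_mul p, pDiv_pMul hp, residueIndex, sup_eq_right.2 (pMul_mono le_top)]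

theorem relIndex_pMul (Φ Λ : AddSubgroup A) :
    (pMul p Φ).relIndex (pMul p Λ) = Φ.relIndex Λ :=
  AddSubgroup.relIndex_map_map_of_injective _ _ (nsmul_right_injective hp)

end TorsionFree

theorem index_pMul_top [Module.Free ℤ A] [Module.Finite ℤ A] (p : ℕ) [NeZero p] :
    (pMul p (⊤ : AddSubgroup A)).index = p ^ Module.finrank ℤ A := by
  rw [← ModN.natCard_eq A p, AddSubgroup.index_eq_card]
  refine Nat.card_congr (QuotientAddGroup.quotientAddEquivOfEq ?_).toEquiv
  ext z
  simp [pMul]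

section Prime

variable {p : ℕ} [hp : Fact p.Prime]

theorem HasPIndex.pow_nsmul_mem {Λ : AddSubgroup A} (h : HasPIndex p Λ) (z : A) :
    p ^ indexExp p Λ • z ∈ Λ := by
  rw [← h.index_eq]
  exact AddSubgroup.nsmul_index_mem Λ z

theorem HasPIndex.pDiv {Φ : AddSubgroup A} (h : HasPIndex p Φ) : HasPIndex p (pDiv p Φ) := by
  obtain ⟨n, hn⟩ := h
  exact .of_dvd (n := n) (hn ▸ Dvd.intro_left _ (index_eq_residueIndex_mul p Φ).symm)

theorem eq_top_of_residueIndex_eq_one {Φ : AddSubgroup A} (h : HasPIndex p Φ)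
    (h1 : residueIndex p Φ = 1) : Φ = ⊤ := by
  have hindex : Φ.index = (_root_.pDiv p Φ).index := by
    rw [index_eq_residueIndex_mul p Φ, h1, one_mul]
  have hrel := AddSubgroup.relIndex_mul_index (le_pDiv p Φ)
  rw [← hindex, Nat.mul_eq_right h.index_ne_zero] at hrel
  exact top_unique fun z _ =>
    mem_of_pow_nsmul_mem (AddSubgroup.relIndex_eq_one.1 hrel) _ (h.pow_nsmul_mem z)

theorem indexExp_of_residueIndex {Φ : AddSubgroup A} (h : HasPIndex p (pDiv p Φ)) {k : ℕ}
    (hk : residueIndex p Φ = p ^ k) : indexExp p Φ = k + indexExp p (pDiv p Φ) := by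
  apply indexExp_eq
  rw [index_eq_residueIndex_mul p Φ, hk, h.index_eq, pow_add]

section Free

variable [Module.Free ℤ A] [Module.Finite ℤ A]

theorem exists_residueIndex_eq_pow (p : ℕ) [hp : Fact p.Prime] (Φ : AddSubgroup A) :
    ∃ k ≤ Module.finrank ℤ A, residueIndex p Φ = p ^ k :=
  (Nat.dvd_prime_pow hp.out).1
    (index_pMul_top (A := A) p ▸ AddSubgroup.index_dvd_of_le le_sup_right)

theorem hasPIndex_of_pDiv {Φ : AddSubgroup A} (h : HasPIndex p (pDiv p Φ)) : HasPIndex p Φ := by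
  obtain ⟨k, -, hk⟩ := exists_residueIndex_eq_pow p Φ
  obtain ⟨m, hm⟩ := h
  exact ⟨k + m, by rw [index_eq_residueIndex_mul p Φ, hk, hm, pow_add]⟩

theorem hasPIndex_of_pow_nsmul_mem {n : ℕ} {Λ : AddSubgroup A} (h : ∀ z, p ^ n • z ∈ Λ) :
    HasPIndex p Λ := by
  induction n generalizing Λ with
  | zero =>
    have htop : Λ = ⊤ := top_unique fun z _ => by simpa using h z
    exact htop ▸ hasPIndex_top p
  | succ n ih =>
    exact hasPIndex_of_pDiv (ih fun z => by rw [mem_pDiv, ← mul_smul, ← pow_succ']; exact h z)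

theorem le_pMul_top_iff {Φ : AddSubgroup A} :
    Φ ≤ pMul p ⊤ ↔ residueIndex p Φ = p ^ Module.finrank ℤ A := by
  rw [residueIndex, ← index_pMul_top p]
  refine ⟨fun h => by rw [sup_eq_right.2 h], fun h => ?_⟩
  have hne : (pMul p (⊤ : AddSubgroup A)).index ≠ 0 := by
    rw [index_pMul_top p]
    exact pow_ne_zero _ hp.out.ne_zero
  have hrel := AddSubgroup.relIndex_mul_index (le_sup_right : pMul p ⊤ ≤ Φ ⊔ pMul p ⊤)
  rw [h, Nat.mul_eq_right hne] at hrel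
  exact le_sup_left.trans (AddSubgroup.relIndex_eq_one.1 hrel)

theorem exists_forall_sub_zsmul_mem_pMul_top {Φ : AddSubgroup A} {k : ℕ}
    (hk : Module.finrank ℤ A ≤ k + 1) (h : residueIndex p Φ = p ^ k) :
    ∃ w, ∀ z ∈ Φ, ∃ c : ℤ, z - c • w ∈ pMul p (⊤ : AddSubgroup A) := by
  let N : AddSubgroup A := pMul p ⊤
  have hcard : Nat.card (Φ.map (QuotientAddGroup.mk' N)) ∣ p := by
    have hmul : N.relIndex Φ * p ^ k = p ^ Module.finrank ℤ A := by
      rw [← h, residueIndex, ← AddSubgroup.relIndex_sup_right,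
        AddSubgroup.relIndex_mul_index le_sup_right, index_pMul_top]
    rw [← AddSubgroup.relIndex_ker, QuotientAddGroup.ker_mk']
    refine Nat.dvd_of_mul_dvd_mul_right (pow_pos hp.out.pos k) ?_
    rw [hmul, ← pow_succ']
    exact pow_dvd_pow p hk
  obtain ⟨⟨_, w, _, rfl⟩, hgen⟩ := (isAddCyclic_of_card_dvd_prime hcard).exists_generator
  refine ⟨w, fun z hz => ?_⟩
  obtain ⟨c, hc⟩ := AddSubgroup.mem_zmultiples_iff.1
    (hgen ⟨QuotientAddGroup.mk' N z, z, hz, rfl⟩)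
  refine ⟨c, (QuotientAddGroup.eq_zero_iff (N := N) _).1 ?_⟩
  exact sub_eq_zero.2 (congrArg Subtype.val hc).symm

end Free

end Prime

/-! ### The level of a lattice -/

/-- `A ⧸ Λ` has exponent exactly `p ^ n`: dividing `Λ` by `p` first gives everything after `n`
steps. -/
def IsLevel (p : ℕ) : ℕ → AddSubgroup A → Prop
  | 0, Λ => Λ = ⊤
  | n + 1, Λ => IsLevel p n (pDiv p Λ) ∧ Λ ≠ ⊤

namespace IsLevel

variable {p m n : ℕ} {Λ : AddSubgroup A}

theorem unique (hm : IsLevel p m Λ) (hn : IsLevel p n Λ) : m = n := by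
  induction m generalizing n Λ with
  | zero =>
    cases n with
    | zero => rfl
    | succ n => exact absurd hm hn.2
  | succ m ih =>
    cases n with
    | zero => exact absurd hn hm.2
    | succ n => rw [ih hm.1 hn.1]

theorem pow_nsmul_mem (h : IsLevel p n Λ) (z : A) : p ^ n • z ∈ Λ := by
  induction n generalizing Λ with
  | zero =>
    rw [show Λ = ⊤ from h]
    exact AddSubgroup.mem_top _
  | succ n ih =>
    rw [pow_succ', mul_smul]
    exact ih h.1

theorem hasPIndex [Module.Free ℤ A] [Module.Finite ℤ A] [Fact p.Prime] (h : IsLevel p n Λ) :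
    HasPIndex p Λ :=
  hasPIndex_of_pow_nsmul_mem h.pow_nsmul_mem

theorem exists_of_pow_nsmul_mem (h : ∀ z, p ^ m • z ∈ Λ) : ∃ n, IsLevel p n Λ := by
  induction m generalizing Λ with
  | zero => exact ⟨0, top_unique fun z _ => by simpa using h z⟩
  | succ m ih =>
    by_cases hΛ : Λ = ⊤
    · exact ⟨0, hΛ⟩
    · obtain ⟨n, hn⟩ := ih (Λ := pDiv p Λ) fun z => by
        rw [mem_pDiv, ← mul_smul, ← pow_succ']
        exact h z
      exact ⟨n + 1, hn, hΛ⟩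

theorem exists_of_hasPIndex [Fact p.Prime] (h : HasPIndex p Λ) : ∃ n, IsLevel p n Λ :=
  exists_of_pow_nsmul_mem h.pow_nsmul_mem

end IsLevel

theorem finite_setOf_isLevel [Module.Free ℤ A] [Module.Finite ℤ A] (p : ℕ) [Fact p.Prime]
    (n : ℕ) : {Λ : AddSubgroup A | IsLevel p n Λ}.Finite := by
  let N : AddSubgroup A := (nsmulAddMonoidHom (p ^ n) : A →+ A).range
  have hN : HasPIndex p N := hasPIndex_of_pow_nsmul_mem fun z => ⟨z, rfl⟩
  have : N.FiniteIndex := ⟨hN.index_ne_zero⟩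
  have hfin : Finite {Λ : AddSubgroup A // N ≤ Λ} :=
    Finite.of_equiv _ (QuotientAddGroup.comapMk'OrderIso N).toEquiv
  refine Set.Finite.subset (s := {Λ | N ≤ Λ}) hfin fun Λ hΛ => ?_
  rintro _ ⟨z, rfl⟩
  exact IsLevel.pow_nsmul_mem hΛ z

end Lattice

/-! ### Lattices whose reduction is a line -/

section Lines

variable {p : ℕ} [hp : Fact p.Prime]

theorem eq_zmultiples_of_card_eq_prime {Q : Type*} [AddGroup Q] {C : AddSubgroup Q}
    (hC : Nat.card C = p) {w : Q} (hw : w ∈ C) (hw0 : w ≠ 0) : C = AddSubgroup.zmultiples w := by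
  refine le_antisymm (fun v hv => ?_) (AddSubgroup.zmultiples_le.2 hw)
  obtain ⟨k, hk⟩ := AddSubgroup.mem_zmultiples_iff.1 (mem_zmultiples_of_prime_card hC
    (g := ⟨w, hw⟩) (g' := ⟨v, hv⟩) (by simpa [Subtype.ext_iff] using hw0))
  exact ⟨k, congrArg Subtype.val hk⟩

theorem inf_eq_bot_of_card_eq_prime {Q : Type*} [AddGroup Q] {C P : AddSubgroup Q}
    (hC : Nat.card C = p) {w : Q} (hw : w ∈ C) (hwP : w ∉ P) : C ⊓ P = ⊥ := by
  refine (AddSubgroup.eq_bot_iff_forall _).2 fun v hv => ?_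
  by_contra hv0
  exact hwP ((eq_zmultiples_of_card_eq_prime hC hv.1 hv0).le.trans
    (AddSubgroup.zmultiples_le.2 hv.2) hw)

theorem zmultiples_eq_iff_of_card_eq_prime {Q : Type*} [AddCommGroup Q] {C P : AddSubgroup Q}
    (hC : Nat.card C = p) (hCP : C ⊓ P = ⊥) {w : Q} :
    (w ∈ pDiv p ⊥ ∧ w ∉ P) ∧ AddSubgroup.zmultiples w = C ↔ w ≠ 0 ∧ w ∈ C := by
  refine ⟨fun ⟨⟨_, hwP⟩, h⟩ => ⟨(ne_of_mem_of_not_mem P.zero_mem hwP).symm,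
    h ▸ AddSubgroup.mem_zmultiples w⟩, fun ⟨hw0, hw⟩ => ⟨⟨?_, fun hwP => hw0 ?_⟩,
      (eq_zmultiples_of_card_eq_prime hC hw hw0).symm⟩⟩
  · rw [← hC]
    exact congrArg Subtype.val (card_nsmul_eq_zero' : Nat.card C • (⟨w, hw⟩ : C) = 0)
  · exact AddSubgroup.mem_bot.1 (hCP ▸ ⟨hw, hwP⟩)

/-- Each element of order `p` outside `P` generates one such subgroup, and each such subgroup has
`p - 1` generators. -/
theorem ncard_subgroups_card_eq_prime_mul {Q : Type*} [AddCommGroup Q] [Finite Q]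
    (P : AddSubgroup Q) :
    {C : AddSubgroup Q | Nat.card C = p ∧ C ⊓ P = ⊥}.ncard * (p - 1) =
      Nat.card (pDiv p (⊥ : AddSubgroup Q)) - Nat.card (pDiv p ⊥ ⊓ P : AddSubgroup Q) := by
  classical
  have := Fintype.ofFinite Q
  have := Fintype.ofFinite (AddSubgroup Q)
  let S := Finset.univ.filter fun C : AddSubgroup Q => Nat.card C = p ∧ C ⊓ P = ⊥
  let V := Finset.univ.filter fun w : Q => w ∈ pDiv p ⊥ ∧ w ∉ P
  have hV : V.card =
      Nat.card (pDiv p (⊥ : AddSubgroup Q)) - Nat.card (pDiv p ⊥ ⊓ P : AddSubgroup Q) := by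
    rw [← SetLike.coe_sort_coe, Nat.card_coe_set_eq, ← SetLike.coe_sort_coe, Nat.card_coe_set_eq,
      ← Set.ncard_sdiff (fun _ h => h.1), ← Set.ncard_coe_finset]
    congr 1
    ext w
    simp [V]
  have hmem (w) (hw : w ∈ V) : AddSubgroup.zmultiples w ∈ S := by
    obtain ⟨hwp, hwP⟩ := (Finset.mem_filter.1 hw).2
    have hcard : Nat.card (AddSubgroup.zmultiples w) = p := by
      rw [Nat.card_zmultiples]
      exact addOrderOf_eq_prime hwp (ne_of_mem_of_not_mem P.zero_mem hwP).symm
    exact Finset.mem_filter.2 ⟨Finset.mem_univ _, hcard,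
      inf_eq_bot_of_card_eq_prime hcard (AddSubgroup.mem_zmultiples w) hwP⟩
  have hfib (C) (hC : C ∈ S) : {w ∈ V | AddSubgroup.zmultiples w = C}.card = p - 1 := by
    obtain ⟨hcard, hinf⟩ := (Finset.mem_filter.1 hC).2
    have hgen : {w ∈ V | AddSubgroup.zmultiples w = C} =
        (Finset.univ.filter fun w => w ∈ C).erase 0 := by
      ext w
      simpa [V] using zmultiples_eq_iff_of_card_eq_prime hcard hinf (w := w)
    rw [hgen, Finset.card_erase_of_mem (by simp [C.zero_mem]), ← Fintype.card_subtype,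
      ← Nat.card_eq_fintype_card]
    exact congrArg (· - 1) hcard
  have hcount := Finset.card_eq_sum_card_fiberwise hmem
  rw [Finset.sum_congr rfl hfib, Finset.sum_const, hV, smul_eq_mul] at hcount
  rw [hcount, ← Set.ncard_coe_finset]
  congr 2
  ext C
  simp [S]

end Lines

section LatticesAbove

variable {A : Type*} [AddCommGroup A]

theorem card_eq_relIndex_comap_mk' {N : AddSubgroup A} (C : AddSubgroup (A ⧸ N)) :
    Nat.card C = N.relIndex (C.comap (QuotientAddGroup.mk' N)) := by
  have h := AddSubgroup.relIndex_ker (C.comap (QuotientAddGroup.mk' N)) (QuotientAddGroup.mk' N)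
  rwa [QuotientAddGroup.ker_mk', AddSubgroup.map_comap_eq_self_of_surjective
    (QuotientAddGroup.mk'_surjective _), eq_comm] at h

theorem relIndex_pDiv {p : ℕ} {Φ : AddSubgroup A} (h : (pDiv p Φ).index ≠ 0) :
    Φ.relIndex (pDiv p Φ) = residueIndex p Φ := by
  refine Nat.eq_of_mul_eq_mul_right (Nat.pos_of_ne_zero h) ?_
  rw [← index_eq_residueIndex_mul, AddSubgroup.relIndex_mul_index (le_pDiv p Φ)]

theorem comap_mk'_map_pMul_top (p : ℕ) (Λ : AddSubgroup A) :
    ((pMul p ⊤).map (QuotientAddGroup.mk' (pMul p Λ))).comap (QuotientAddGroup.mk' (pMul p Λ)) =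
      pMul p ⊤ := by
  rw [AddSubgroup.comap_map_eq, QuotientAddGroup.ker_mk', sup_eq_left]
  exact pMul_mono le_top

variable [Module.Free ℤ A] {p : ℕ} [hp : Fact p.Prime] {Φ Λ : AddSubgroup A}

theorem comap_mk'_pDiv_bot (Λ : AddSubgroup A) :
    (pDiv p (⊥ : AddSubgroup (A ⧸ pMul p Λ))).comap (QuotientAddGroup.mk' (pMul p Λ)) = Λ := by
  have : IsAddTorsionFree A := .of_isTorsionFree ℤ A
  conv_rhs => rw [← pDiv_pMul hp.out.ne_zero Λ]
  ext a
  exact QuotientAddGroup.eq_zero_iff (N := pMul p Λ) (p • a)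

theorem pDiv_comap_mk'_eq_iff (C : AddSubgroup (A ⧸ pMul p Λ)) :
    pDiv p (C.comap (QuotientAddGroup.mk' (pMul p Λ))) = Λ ↔
      C ⊓ (pMul p ⊤).map (QuotientAddGroup.mk' (pMul p Λ)) = ⊥ := by
  have : IsAddTorsionFree A := .of_isTorsionFree ℤ A
  rw [pDiv_eq_iff hp.out.ne_zero,
    ← (AddSubgroup.comap_injective (QuotientAddGroup.mk'_surjective (pMul p Λ))).eq_iff,
    AddMonoidHom.comap_bot, QuotientAddGroup.ker_mk', AddSubgroup.comap_inf,
    comap_mk'_map_pMul_top]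

variable [Module.Finite ℤ A]

theorem relIndex_pMul_self (h : Λ.index ≠ 0) :
    (pMul p Λ).relIndex Λ = p ^ Module.finrank ℤ A := by
  have : IsAddTorsionFree A := .of_isTorsionFree ℤ A
  have hmul := AddSubgroup.relIndex_mul_index (pMul_le p Λ)
  rw [index_pMul hp.out.ne_zero, index_pMul_top] at hmul
  exact Nat.eq_of_mul_eq_mul_right (Nat.pos_of_ne_zero h) hmul

theorem relIndex_pMul_pDiv_mul_residueIndex (h : (pDiv p Φ).index ≠ 0) :
    (pMul p (pDiv p Φ)).relIndex Φ * residueIndex p Φ = p ^ Module.finrank ℤ A := by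
  have hle : pMul p (pDiv p Φ) ≤ Φ := pMul_pDiv p Φ ▸ inf_le_left
  rw [← relIndex_pMul_self h,
    ← AddSubgroup.relIndex_mul_relIndex _ _ _ hle (le_pDiv p Φ), relIndex_pDiv h]

variable {n : ℕ}

theorem preimage_comap_setOf_pDiv_eq (hn : Module.finrank ℤ A = n + 1) (h : Λ.index ≠ 0) :
    AddSubgroup.comap (QuotientAddGroup.mk' (pMul p Λ)) ⁻¹'
        {Φ | pDiv p Φ = Λ ∧ residueIndex p Φ = p ^ n} =
      {C : AddSubgroup (A ⧸ pMul p Λ) | Nat.card C = p ∧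
        C ⊓ (pMul p ⊤).map (QuotientAddGroup.mk' (pMul p Λ)) = ⊥} := by
  ext C
  rw [Set.mem_preimage, Set.mem_ofPred, pDiv_comap_mk'_eq_iff, and_comm]
  refine and_congr_left fun hC => ?_
  have hdiv := (pDiv_comap_mk'_eq_iff C).2 hC
  have hmul := relIndex_pMul_pDiv_mul_residueIndex (hdiv.symm ▸ h)
  rw [hdiv, ← card_eq_relIndex_comap_mk', hn, pow_succ'] at hmul
  constructor <;> intro hcard <;> rw [hcard] at hmul
  · exact Nat.eq_of_mul_eq_mul_right (pow_pos hp.out.pos n) hmul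
  · exact Nat.eq_of_mul_eq_mul_left hp.out.pos hmul

theorem ncard_setOf_pDiv_eq_mul (hn : Module.finrank ℤ A = n + 1) (h : HasPIndex p Λ) :
    {Φ | pDiv p Φ = Λ ∧ residueIndex p Φ = p ^ n}.ncard * (p - 1) =
      p ^ (n + 1) - residueIndex p Λ := by
  have : IsAddTorsionFree A := .of_isTorsionFree ℤ A
  have hN : (pMul p Λ).FiniteIndex := ⟨by
    rw [index_pMul hp.out.ne_zero, index_pMul_top]
    exact mul_ne_zero (pow_ne_zero _ hp.out.ne_zero) h.index_ne_zero⟩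
  have hrange : {Φ | pDiv p Φ = Λ ∧ residueIndex p Φ = p ^ n} ⊆
      Set.range (AddSubgroup.comap (QuotientAddGroup.mk' (pMul p Λ))) := by
    rintro Φ ⟨rfl, -⟩
    refine ⟨Φ.map (QuotientAddGroup.mk' _), ?_⟩
    rw [AddSubgroup.comap_map_eq, QuotientAddGroup.ker_mk', sup_eq_left, pMul_pDiv]
    exact inf_le_left
  rw [← Set.ncard_preimage_of_injective_subset_range
    (AddSubgroup.comap_injective (QuotientAddGroup.mk'_surjective (pMul p Λ))) hrange,
    preimage_comap_setOf_pDiv_eq hn h.index_ne_zero, ncard_subgroups_card_eq_prime_mul,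
    card_eq_relIndex_comap_mk', card_eq_relIndex_comap_mk', AddSubgroup.comap_inf,
    comap_mk'_pDiv_bot, comap_mk'_map_pMul_top, ← pMul_pDiv, relIndex_pMul hp.out.ne_zero,
    relIndex_pDiv h.pDiv.index_ne_zero, relIndex_pMul_self h.index_ne_zero, hn]

end LatticesAbove

/-! ### Annihilators of a bilinear map modulo a lattice -/

section Annihilator

variable {U V Z : Type*} [AddCommGroup U] [AddCommGroup V] [AddCommGroup Z]
variable (B : U →ₗ[ℤ] V →ₗ[ℤ] Z)

/-- The elements `u` with `B u v ∈ Λ` for all `v`. -/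
def leftAnnihilator (Λ : AddSubgroup Z) : AddSubgroup U :=
  ⨅ v, Λ.comap (B.flip v).toAddMonoidHom

/-- The pairs `(u, v)` that `B` pairs into `Λ` with everything on the other side. -/
def annihilator (Λ : AddSubgroup Z) : AddSubgroup (U × V) :=
  (leftAnnihilator B Λ).prod (leftAnnihilator B.flip Λ)

variable {B} {Λ : AddSubgroup Z}

theorem mem_leftAnnihilator {u : U} : u ∈ leftAnnihilator B Λ ↔ ∀ v, B u v ∈ Λ :=
  AddSubgroup.mem_iInf

theorem mem_annihilator {x : U × V} :
    x ∈ annihilator B Λ ↔ (∀ v, B x.1 v ∈ Λ) ∧ ∀ u, B u x.2 ∈ Λ :=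
  and_congr mem_leftAnnihilator mem_leftAnnihilator

theorem nsmul_mem_annihilator {n : ℕ} (h : ∀ z, n • z ∈ Λ) (x : U × V) :
    n • x ∈ annihilator B Λ := by
  simp [mem_annihilator, h]

theorem pDiv_annihilator (p : ℕ) : pDiv p (annihilator B Λ) = annihilator B (pDiv p Λ) := by
  ext x
  simp [mem_pDiv, mem_annihilator]

variable [Module.Free ℤ U] [Module.Finite ℤ U] [Module.Free ℤ V] [Module.Finite ℤ V]
variable {p : ℕ} [hp : Fact p.Prime]

theorem HasPIndex.annihilator (h : HasPIndex p Λ) : HasPIndex p (annihilator B Λ) :=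
  hasPIndex_of_pow_nsmul_mem (n := indexExp p Λ) (nsmul_mem_annihilator h.pow_nsmul_mem)

theorem indexExp_annihilator_of_le_pMul_top (h : HasPIndex p Λ)
    (hle : annihilator B Λ ≤ pMul p ⊤) :
    indexExp p (annihilator B Λ) =
      Module.finrank ℤ (U × V) + indexExp p (annihilator B (pDiv p Λ)) := by
  have hann : HasPIndex p (annihilator B Λ) := h.annihilator
  rw [indexExp_of_residueIndex hann.pDiv (le_pMul_top_iff.1 hle), pDiv_annihilator]

end Annihilator

/-! ### The class-two group and the Lie ring of a bilinear map -/

section Heisenberg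

variable {U V Z : Type*} [AddCommGroup U] [AddCommGroup V] [AddCommGroup Z]

/-- The Lie ring on `(U × V) × Z` with bracket `heisenbergBracket B`. -/
def HeisenbergLie (_B : U →ₗ[ℤ] V →ₗ[ℤ] Z) : Type _ := (U × V) × Z

/-- The group on the set `(U × V) × Z` with commutator `heisenbergBracket B`. -/
@[ext]
structure HeisenbergGroup (B : U →ₗ[ℤ] V →ₗ[ℤ] Z) where
  /-- The underlying element of the abelian group `(U × V) × Z`. -/
  toProd : (U × V) × Z

variable (B : U →ₗ[ℤ] V →ₗ[ℤ] Z)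

/-- The alternating form on `(U × V) × Z` that extends `B` and has `Z` in its kernel. -/
def heisenbergBracket (x y : (U × V) × Z) : (U × V) × Z :=
  (0, B x.1.1 y.1.2 - B y.1.1 x.1.2)

instance : AddCommGroup (HeisenbergLie B) := inferInstanceAs (AddCommGroup ((U × V) × Z))

instance : LieRing (HeisenbergLie B) where
  bracket := heisenbergBracket B
  add_lie x y z := Prod.ext (add_zero _).symm (by
    change B (x.1.1 + y.1.1) z.1.2 - B z.1.1 (x.1.2 + y.1.2) = (_ - _) + (_ - _)
    rw [LinearMap.map_add₂, map_add, add_sub_add_comm])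
  lie_add x y z := Prod.ext (add_zero _).symm (by
    change B x.1.1 (y.1.2 + z.1.2) - B (y.1.1 + z.1.1) x.1.2 = (_ - _) + (_ - _)
    rw [LinearMap.map_add₂, map_add, add_sub_add_comm])
  lie_self x := Prod.ext rfl (sub_self _)
  leibniz_lie x y z := by
    change heisenbergBracket B x (heisenbergBracket B y z) =
      heisenbergBracket B (heisenbergBracket B x y) z +
        heisenbergBracket B y (heisenbergBracket B x z)
    simp [heisenbergBracket]

namespace HeisenbergGroup

variable {B}

/-- The product of a class-two group with commutator `heisenbergBracket B`. The twist is chosen so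
that the product of `u`, `v` and `z`, taken in this order, is `((u, v), z)`. -/
instance : Mul (HeisenbergGroup B) :=
  ⟨fun x y => ⟨(x.toProd.1 + y.toProd.1,
    x.toProd.2 + y.toProd.2 - B y.toProd.1.1 x.toProd.1.2)⟩⟩

instance : One (HeisenbergGroup B) := ⟨⟨0⟩⟩

instance : Inv (HeisenbergGroup B) :=
  ⟨fun x => ⟨(-x.toProd.1, -x.toProd.2 - B x.toProd.1.1 x.toProd.1.2)⟩⟩

theorem toProd_mul (x y : HeisenbergGroup B) :
    (x * y).toProd = (x.toProd.1 + y.toProd.1,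
      x.toProd.2 + y.toProd.2 - B y.toProd.1.1 x.toProd.1.2) := rfl

theorem toProd_one : (1 : HeisenbergGroup B).toProd = 0 := rfl

theorem toProd_inv (x : HeisenbergGroup B) :
    x⁻¹.toProd = (-x.toProd.1, -x.toProd.2 - B x.toProd.1.1 x.toProd.1.2) := rfl

instance : Group (HeisenbergGroup B) :=
  Group.ofLeftAxioms
    (fun x y z => by
      refine HeisenbergGroup.ext (Prod.ext (add_assoc _ _ _) ?_)
      simp only [toProd_mul, Prod.fst_add, Prod.snd_add, map_add, LinearMap.add_apply]
      abel)
    (fun x => by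
      refine HeisenbergGroup.ext ?_
      simp [toProd_mul, toProd_one])
    (fun x => by
      refine HeisenbergGroup.ext ?_
      refine Prod.ext (neg_add_cancel _) ?_
      simp only [toProd_mul, toProd_inv, toProd_one, Prod.snd_neg, Prod.snd_zero, map_neg]
      abel)

theorem toProd_conj (x y : HeisenbergGroup B) :
    (x * y * x⁻¹).toProd = y.toProd + heisenbergBracket B x.toProd y.toProd := by
  refine Prod.ext ?_ ?_
  · simp [toProd_mul, toProd_inv, heisenbergBracket]
  · simp only [toProd_mul, toProd_inv, heisenbergBracket, Prod.fst_neg, Prod.snd_add, map_add,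
      map_neg, LinearMap.neg_apply]
    abel

theorem mul_mk_zero (g : HeisenbergGroup B) (c : Z) : g * ⟨(0, c)⟩ = ⟨g.toProd + (0, c)⟩ :=
  HeisenbergGroup.ext (by simp [toProd_mul, Prod.ext_iff])

theorem commutator_eq (x y : HeisenbergGroup B) :
    x * y * x⁻¹ * y⁻¹ = ⟨heisenbergBracket B x.toProd y.toProd⟩ := by
  rw [mul_inv_eq_iff_eq_mul]
  refine HeisenbergGroup.ext ?_
  rw [toProd_conj, toProd_mul, add_comm]
  simp [heisenbergBracket, Prod.ext_iff]

theorem mem_center_of_fst_eq_zero {x : HeisenbergGroup B} (h : x.toProd.1 = 0) :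
    x ∈ Subgroup.center (HeisenbergGroup B) := by
  refine Subgroup.mem_center_iff.2 fun y => mul_inv_eq_iff_eq_mul.1 (HeisenbergGroup.ext ?_)
  simp [toProd_conj, heisenbergBracket, h, ← Prod.zero_eq_mk]

/-- The projection modulo the central factor. -/
def fstHom : HeisenbergGroup B →* Multiplicative (U × V) where
  toFun x := Multiplicative.ofAdd x.toProd.1
  map_one' := rfl
  map_mul' _ _ := rfl

theorem ker_fstHom_le_center : (fstHom (B := B)).ker ≤ Subgroup.center (HeisenbergGroup B) :=
  fun _ hx => mem_center_of_fst_eq_zero (Multiplicative.ofAdd.injective hx)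

theorem mk_zpow {x : (U × V) × Z} (hx : B x.1.1 x.1.2 = 0) (n : ℤ) :
    (⟨x⟩ : HeisenbergGroup B) ^ n = ⟨n • x⟩ := by
  let f : Multiplicative ℤ →* HeisenbergGroup B :=
    { toFun := fun n => ⟨n.toAdd • x⟩
      map_one' := HeisenbergGroup.ext (zero_smul ℤ x)
      map_mul' := fun m n => HeisenbergGroup.ext (by
        simp [toProd_mul, hx, add_smul, Prod.ext_iff]) }
  have hf : f (.ofAdd 1) = ⟨x⟩ := HeisenbergGroup.ext (one_smul ℤ x)
  rw [← hf, ← map_zpow, ← ofAdd_zsmul, smul_eq_mul, mul_one]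
  rfl

theorem eq_one_of_isOfFinOrder [IsAddTorsionFree U] [IsAddTorsionFree V] [IsAddTorsionFree Z]
    {g : HeisenbergGroup B} (hg : IsOfFinOrder g) : g = 1 := by
  obtain ⟨n, hn, hgn⟩ := isOfFinOrder_iff_pow_eq_one.1 hg
  have hfst : g.toProd.1 = 0 := by
    have h : fstHom g ^ n = 1 := by rw [← map_pow, hgn, map_one]
    exact (nsmul_eq_zero_iff_right hn.ne').1 (Multiplicative.ofAdd.injective h)
  have hpow := mk_zpow (B := B) (x := g.toProd) (by simp [hfst]) n
  rw [zpow_natCast, hgn, natCast_zsmul] at hpow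
  exact HeisenbergGroup.ext ((nsmul_eq_zero_iff_right hn.ne').1 (congrArg toProd hpow).symm)

theorem not_nilpotencyClass_le_one (hB : B ≠ 0) [Group.IsNilpotent (HeisenbergGroup B)] :
    ¬ Group.nilpotencyClass (HeisenbergGroup B) ≤ 1 := fun hle => by
  have hcomm := (Group.IsNilpotent.nilpotencyClass_le_one_iff.1 hle).is_comm.comm
  refine hB (LinearMap.ext₂ fun u v => ?_)
  have h := commutator_eq (B := B) ⟨((u, 0), 0)⟩ ⟨((0, v), 0)⟩
  rw [hcomm ⟨((u, 0), 0)⟩, mul_inv_cancel_right, mul_inv_cancel] at h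
  simpa [heisenbergBracket, toProd_one] using (congrArg (fun y => y.toProd.2) h).symm

theorem isTorsionFreeClassTwo [IsAddTorsionFree U] [IsAddTorsionFree V] [IsAddTorsionFree Z]
    (hB : B ≠ 0) : IsTorsionFreeClassTwo (HeisenbergGroup B) := by
  have hker := ker_fstHom_le_center (B := B)
  have hnil : Group.IsNilpotent (HeisenbergGroup B) :=
    Subgroup.isNilpotent_of_ker_le_center _ hker
  have hclass : ¬ Group.nilpotencyClass (HeisenbergGroup B) ≤ 1 := not_nilpotencyClass_le_one hB
  have htorsion (g : HeisenbergGroup B) (hg : IsOfFinOrder g) : g = 1 := eq_one_of_isOfFinOrder hg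
  refine ⟨not_finite_iff_infinite.1 fun _ => hclass ?_, fun g hg hfin => hg (htorsion g hfin),
    hnil, le_antisymm ?_ (not_le.1 hclass)⟩
  · refine Group.IsNilpotent.nilpotencyClass_le_one_iff.2 ⟨⟨fun x y => ?_⟩⟩
    rw [htorsion x (isOfFinOrder_of_finite x), one_mul, mul_one]
  · exact (Group.nilpotencyClass_le_of_ker_le_center _ hker).trans
      (Nat.add_le_add_right CommGroup.nilpotencyClass_le_one 1)

theorem prod_ofFn_mk_zpow {d : ℕ} {x : Fin d → (U × V) × Z}
    (hx : ∀ i j, i ≤ j → B (x j).1.1 (x i).1.2 = 0) (n : Fin d → ℤ) :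
    (List.ofFn fun k => (⟨x k⟩ : HeisenbergGroup B) ^ n k).prod = ⟨∑ k, n k • x k⟩ := by
  induction d with
  | zero => simp; rfl
  | succ d ih =>
    rw [List.ofFn_succ, List.prod_cons, ih fun i j hij => hx _ _ (Fin.succ_le_succ_iff.2 hij),
      mk_zpow (hx 0 0 le_rfl), Fin.sum_univ_succ]
    refine HeisenbergGroup.ext (Prod.ext rfl ?_)
    simp [toProd_mul, Prod.fst_sum, Prod.snd_sum, hx]

theorem isAssociatedLieRing_of_basis {d : ℕ} (e : Module.Basis (Fin d) ℤ ((U × V) × Z))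
    (horder : ∀ i j, i ≤ j → B (e j).1.1 (e i).1.2 = 0)
    (hcentral : ∀ z k, e.repr (0, z) k ≠ 0 → (e k).1 = 0) :
    IsAssociatedLieRing d (HeisenbergGroup B) (HeisenbergLie B) := by
  have hprod := prod_ofFn_mk_zpow horder
  have hbij : Function.Bijective
      (fun n : Fin d → ℤ => (List.ofFn fun k => (⟨e k⟩ : HeisenbergGroup B) ^ n k).prod) := by
    simp only [hprod, ← e.equivFun_symm_apply]
    exact ⟨fun m n h => e.equivFun.symm.injective (congrArg toProd h), fun g =>
      ⟨e.equivFun g.toProd, HeisenbergGroup.ext (e.equivFun.symm_apply_apply _)⟩⟩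
  refine ⟨fun k => ⟨e k⟩, e, fun i j => e.repr (heisenbergBracket B (e i) (e j)), ?_, hbij,
    fun i j => ?_, fun i j k hk => mem_center_of_fst_eq_zero (hcentral _ k hk), fun i j => ?_⟩
  · refine top_unique fun g _ => ?_
    obtain ⟨n, rfl⟩ := hbij.2 g
    refine Subgroup.list_prod_mem _ fun y hy => ?_
    obtain ⟨k, rfl⟩ := List.mem_ofFn.1 hy
    exact Subgroup.zpow_mem _ (Subgroup.subset_closure (Set.mem_range_self k)) _
  · rw [commutator_eq, hprod, e.sum_repr]
  · exact (e.sum_repr _).symm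

theorem isAssociatedLieRing {a b c : ℕ} (bU : Module.Basis (Fin a) ℤ U)
    (bV : Module.Basis (Fin b) ℤ V) (bZ : Module.Basis (Fin c) ℤ Z) :
    IsAssociatedLieRing (a + b + c) (HeisenbergGroup B) (HeisenbergLie B) := by
  refine isAssociatedLieRing_of_basis
    ((((bU.prod bV).reindex finSumFinEquiv).prod bZ).reindex finSumFinEquiv) ?_ ?_
  · intro i j hij
    obtain ⟨i, rfl⟩ := finSumFinEquiv.surjective i
    obtain ⟨j, rfl⟩ := finSumFinEquiv.surjective j
    rcases i with i | i <;> rcases j with j | j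
    · obtain ⟨i, rfl⟩ := finSumFinEquiv.surjective i
      obtain ⟨j, rfl⟩ := finSumFinEquiv.surjective j
      rcases i with i | i <;> rcases j with j | j <;> simp
      simp [Fin.le_def] at hij
      omega
    all_goals simp
  · intro z k
    obtain ⟨k, rfl⟩ := finSumFinEquiv.surjective k
    rcases k with k | k <;> simp

end HeisenbergGroup

/-- The subgroup `I` is stable under the brackets with all elements. -/
def IsBracketStable (I : AddSubgroup ((U × V) × Z)) : Prop :=
  ∀ x, ∀ y ∈ I, heisenbergBracket B x y ∈ I

variable {B}

theorem heisenbergBracket_left (y : (U × V) × Z) (v : V) :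
    heisenbergBracket B ((0, -v), 0) y = (0, B y.1.1 v) := by
  simp [heisenbergBracket]

theorem heisenbergBracket_right (y : (U × V) × Z) (u : U) :
    heisenbergBracket B ((u, 0), 0) y = (0, B u y.1.2) := by
  simp [heisenbergBracket]

theorem IsBracketStable.left_mem {I : AddSubgroup ((U × V) × Z)} (hI : IsBracketStable B I)
    {y : (U × V) × Z} (hy : y ∈ I) (v : V) : (0, B y.1.1 v) ∈ I :=
  heisenbergBracket_left y v ▸ hI _ y hy

theorem isBracketStable_iff_map_le_annihilator {I : AddSubgroup ((U × V) × Z)} :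
    IsBracketStable B I ↔ I.map (AddMonoidHom.fst (U × V) Z) ≤
      annihilator B (I.comap (AddMonoidHom.inr (U × V) Z)) := by
  constructor
  · rintro hI _ ⟨y, hy, rfl⟩
    refine mem_annihilator.2 ⟨hI.left_mem hy, fun u => ?_⟩
    change (0, B u y.1.2) ∈ I
    exact heisenbergBracket_right y u ▸ hI _ y hy
  · intro hI x y hy
    obtain ⟨hleft, hright⟩ := mem_annihilator.1 (hI ⟨y, hy, rfl⟩)
    simpa [heisenbergBracket] using I.sub_mem (hright x.1.1) (hleft x.1.2)

/-- The ideals of `p`-power index in the Lie ring are the bracket-stable subgroups. -/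
def lieIdealEquiv (B : U →ₗ[ℤ] V →ₗ[ℤ] Z) (p : ℕ) :
    {I : LieIdeal ℤ (HeisenbergLie B) // ∃ n : ℕ, I.toSubmodule.toAddSubgroup.index = p ^ n} ≃
      {I : AddSubgroup ((U × V) × Z) // HasPIndex p I ∧ IsBracketStable B I} where
  toFun I := ⟨I.1.toSubmodule.toAddSubgroup, I.2,
    fun x _ hy => lie_mem_right ℤ (HeisenbergLie B) I.1 x _ hy⟩
  invFun I := ⟨{ AddSubgroup.toIntSubmodule (M := HeisenbergLie B) I.1 with
    lie_mem := fun {x m} hm => I.2.2 x m hm }, I.2.1⟩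
  left_inv _ := rfl
  right_inv _ := rfl

namespace HeisenbergGroup

theorem mk_add (x y : (U × V) × Z) :
    (⟨x + y⟩ : HeisenbergGroup B) = ⟨x⟩ * ⟨y⟩ * ⟨(0, B y.1.1 x.1.2)⟩ := by
  rw [mul_mk_zero]
  exact HeisenbergGroup.ext (Prod.ext (add_zero _).symm (sub_add_cancel _ _).symm)

theorem mk_neg (x : (U × V) × Z) :
    (⟨-x⟩ : HeisenbergGroup B) = ⟨x⟩⁻¹ * ⟨(0, B x.1.1 x.1.2)⟩ := by
  rw [mul_mk_zero]
  exact HeisenbergGroup.ext (Prod.ext (add_zero _).symm (sub_add_cancel _ _).symm)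

theorem inv_mk_mul_mk (x y : (U × V) × Z) :
    (⟨x⟩⁻¹ * ⟨y⟩ : HeisenbergGroup B) = ⟨-x + y⟩ * ⟨(0, B (-x + y).1.1 x.1.2)⟩ := by
  rw [mul_mk_zero]
  refine HeisenbergGroup.ext (Prod.ext (add_zero _).symm ?_)
  simp only [toProd_mul, toProd_inv, Prod.fst_add, Prod.snd_add, Prod.fst_neg, Prod.snd_neg,
    map_add, map_neg, LinearMap.add_apply, LinearMap.neg_apply]
  abel

section Normal

variable {H : Subgroup (HeisenbergGroup B)}

theorem bracket_mem (hH : H.Normal) (x : (U × V) × Z) {y : (U × V) × Z} (hy : ⟨y⟩ ∈ H) :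
    ⟨heisenbergBracket B x y⟩ ∈ H := by
  rw [← commutator_eq ⟨x⟩ ⟨y⟩]
  exact H.mul_mem (hH.conj_mem _ hy _) (H.inv_mem hy)

theorem left_mem (hH : H.Normal) {y : (U × V) × Z} (hy : ⟨y⟩ ∈ H) (v : V) :
    ⟨(0, B y.1.1 v)⟩ ∈ H :=
  heisenbergBracket_left (B := B) y v ▸ bracket_mem hH _ hy

/-- The set underlying a normal subgroup, as a subgroup for the addition. -/
def toAddSubgroup (hH : H.Normal) : AddSubgroup ((U × V) × Z) where
  carrier := {x | (⟨x⟩ : HeisenbergGroup B) ∈ H}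
  zero_mem' := H.one_mem
  add_mem' {x y} hx hy := by
    rw [Set.mem_ofPred, mk_add]
    exact H.mul_mem (H.mul_mem hx hy) (left_mem hH hy _)
  neg_mem' {x} hx := by
    rw [Set.mem_ofPred, mk_neg]
    exact H.mul_mem (H.inv_mem hx) (left_mem hH hx _)

theorem index_toAddSubgroup (hH : H.Normal) : (toAddSubgroup hH).index = H.index := by
  refine (Nat.card_congr (Quotient.congr ⟨toProd, mk, fun _ => rfl, fun _ => rfl⟩ ?_)).symm
  rintro ⟨x⟩ ⟨y⟩
  change (QuotientGroup.leftRel H) ⟨x⟩ ⟨y⟩ ↔ (QuotientAddGroup.leftRel (toAddSubgroup hH)) x y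
  rw [QuotientGroup.leftRel_apply, QuotientAddGroup.leftRel_apply]
  change _ ↔ ⟨-x + y⟩ ∈ H
  refine ⟨fun h => ?_, fun h => inv_mk_mul_mk x y ▸ H.mul_mem h (left_mem hH h _)⟩
  have hleft : ⟨(0, B (-x + y).1.1 x.1.2)⟩ ∈ H := left_mem hH h x.1.2
  rw [inv_mk_mul_mk] at h
  exact (H.mul_mem_cancel_right hleft).1 h

end Normal

section Lattice

variable {I : AddSubgroup ((U × V) × Z)}

/-- The set underlying a bracket-stable subgroup, as a subgroup for the multiplication. -/
def ofAddSubgroup (hI : IsBracketStable B I) : Subgroup (HeisenbergGroup B) where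
  carrier := {x | x.toProd ∈ I}
  one_mem' := I.zero_mem
  mul_mem' {x y} hx hy := by
    have h := I.sub_mem (I.add_mem hx hy) (hI.left_mem hy x.toProd.1.2)
    rw [Set.mem_ofPred]
    convert h using 1
    exact Prod.ext (sub_zero _).symm rfl
  inv_mem' {x} hx := by
    have h := I.sub_mem (I.neg_mem hx) (hI.left_mem hx x.toProd.1.2)
    rw [Set.mem_ofPred]
    convert h using 1
    exact Prod.ext (sub_zero _).symm rfl

theorem normal_ofAddSubgroup (hI : IsBracketStable B I) : (ofAddSubgroup hI).Normal := by
  refine ⟨fun y hy x => ?_⟩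
  change (x * y * x⁻¹).toProd ∈ I
  rw [toProd_conj]
  exact I.add_mem hy (hI x.toProd _ hy)

end Lattice

/-- The normal subgroups of `p`-power index are the bracket-stable subgroups for the addition. -/
def normalSubgroupEquiv (B : U →ₗ[ℤ] V →ₗ[ℤ] Z) (p : ℕ) :
    {H : Subgroup (HeisenbergGroup B) // H.Normal ∧ ∃ n : ℕ, H.index = p ^ n} ≃
      {I : AddSubgroup ((U × V) × Z) // HasPIndex p I ∧ IsBracketStable B I} where
  toFun H := ⟨toAddSubgroup H.2.1, by rw [HasPIndex, index_toAddSubgroup]; exact H.2.2,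
    fun x _ hy => bracket_mem H.2.1 x hy⟩
  invFun I := ⟨ofAddSubgroup I.2.2, normal_ofAddSubgroup I.2.2,
    by rw [← index_toAddSubgroup (normal_ofAddSubgroup I.2.2)]; exact I.2.1⟩
  left_inv _ := rfl
  right_inv _ := rfl

end HeisenbergGroup

end Heisenberg

/-! ### A pairing whose determinant is the Weierstrass cubic -/

section Cubic

open scoped Matrix

variable {R : Type*} [CommRing R]

/-- A matrix of linear forms in `x = (X, Y, Z)` whose determinant is, up to sign, the Weierstrass
cubic when `a₆ = 0`. -/
def cubicMatrix (W : WeierstrassCurve R) (x : Fin 3 → R) : Matrix (Fin 3) (Fin 3) R :=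
  !![x 0 + W.a₂ * x 2, W.a₄ * x 2, x 1 + W.a₁ * x 0 + W.a₃ * x 2;
     -x 2, x 0, 0;
     0, x 1, x 0]

/-- The determinant of `cubicMatrix`, written out so that it can be differentiated. -/
def cubicForm (W : WeierstrassCurve R) (x : Fin 3 → R) : R :=
  x 0 * (x 0 ^ 2 + W.a₂ * x 0 * x 2 + W.a₄ * x 2 ^ 2) -
    x 1 * x 2 * (x 1 + W.a₁ * x 0 + W.a₃ * x 2)

/-- The bilinear map whose value at `(u, v)` lists the coefficients of the linear form
`u ⬝ᵥ cubicMatrix W x *ᵥ v` in `x`. -/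
def cubicPairing (W : WeierstrassCurve R) :
    (Fin 3 → R) →ₗ[R] (Fin 3 → R) →ₗ[R] (Fin 3 → R) :=
  LinearMap.mk₂ R
    (fun u v => ![u 0 * v 0 + W.a₁ * u 0 * v 2 + u 1 * v 1 + u 2 * v 2,
      u 0 * v 2 + u 2 * v 1,
      W.a₂ * u 0 * v 0 + W.a₄ * u 0 * v 1 + W.a₃ * u 0 * v 2 - u 1 * v 0])
    (fun _ _ _ => by ext i; fin_cases i <;> simp <;> ring)
    (fun _ _ _ => by ext i; fin_cases i <;> simp <;> ring)
    (fun _ _ _ => by ext i; fin_cases i <;> simp <;> ring)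
    (fun _ _ _ => by ext i; fin_cases i <;> simp <;> ring)

theorem cubicPairing_apply (W : WeierstrassCurve R) (u v : Fin 3 → R) :
    cubicPairing W u v = ![u 0 * v 0 + W.a₁ * u 0 * v 2 + u 1 * v 1 + u 2 * v 2,
      u 0 * v 2 + u 2 * v 1,
      W.a₂ * u 0 * v 0 + W.a₄ * u 0 * v 1 + W.a₃ * u 0 * v 2 - u 1 * v 0] := rfl

theorem det_cubicMatrix (W : WeierstrassCurve R) (x : Fin 3 → R) :
    (cubicMatrix W x).det = cubicForm W x := by
  simp only [cubicMatrix, cubicForm, Matrix.det_fin_three, Matrix.of_apply, Matrix.cons_val]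
  ring

theorem equation_iff_cubicForm_eq_zero {W : WeierstrassCurve R} (h6 : W.a₆ = 0) (x : Fin 3 → R) :
    W.toProjective.Equation x ↔ cubicForm W x = 0 := by
  rw [WeierstrassCurve.Projective.equation_iff, cubicForm, h6]
  constructor <;> intro h <;> linear_combination -h

theorem dotProduct_cubicPairing (W : WeierstrassCurve R) (x u v : Fin 3 → R) :
    x ⬝ᵥ cubicPairing W u v = u ⬝ᵥ cubicMatrix W x *ᵥ v := by
  simp only [cubicPairing_apply, cubicMatrix, dotProduct, Matrix.mulVec, Fin.sum_univ_three,
    Matrix.of_apply, Matrix.cons_val]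
  ring

theorem cubicPairing_ne_zero [Nontrivial R] (W : WeierstrassCurve R) : cubicPairing W ≠ 0 :=
  fun h => one_ne_zero (α := R) <| by
    simpa [cubicPairing_apply] using
      congrFun (LinearMap.congr_fun₂ h ![0, 0, 1] ![0, 0, 1]) 0

section Map

variable {S : Type*} [CommRing S] (f : R →+* S) (W : WeierstrassCurve R)

theorem cubicMatrix_map (x : Fin 3 → R) :
    cubicMatrix (W.map f) (f ∘ x) = (cubicMatrix W x).map f := by
  ext i j
  fin_cases i <;> fin_cases j <;> simp [cubicMatrix]

theorem cubicForm_map (x : Fin 3 → R) : cubicForm (W.map f) (f ∘ x) = f (cubicForm W x) := by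
  simp [cubicForm]

theorem cubicPairing_map (u v : Fin 3 → R) :
    cubicPairing (W.map f) (f ∘ u) (f ∘ v) = f ∘ cubicPairing W u v := by
  ext i
  fin_cases i <;> simp [cubicPairing_apply]

end Map

section Field

variable {F : Type*} [Field F] {W : WeierstrassCurve F}

/- The five minors used express, one after the other, that `X = 0`, `Y Z = 0`, and that `a₃` and
`a₄` vanish unless `Z = 0`; with `a₃ = a₄ = a₆ = 0` the cubic is singular at the origin. -/
theorem exists_minor_cubicMatrix_ne_zero (h6 : W.a₆ = 0) (hΔ : W.Δ ≠ 0) {x : Fin 3 → F}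
    (hx : x ≠ 0) :
    ∃ i j : Fin 3, ((cubicMatrix W x).submatrix i.succAbove j.succAbove).det ≠ 0 := by
  by_contra! h
  have hX : x 0 = 0 := by
    simpa [cubicMatrix, Matrix.det_fin_two, Fin.succAbove] using h 0 0
  have hYZ : x 2 = 0 ∨ x 1 = 0 := by
    simpa [cubicMatrix, Matrix.det_fin_two, Fin.succAbove, hX] using h 0 2
  have hY : (x 1 + W.a₃ * x 2) * x 1 = 0 := by
    simpa [cubicMatrix, Matrix.det_fin_two, Fin.succAbove, hX] using h 1 0
  have ha₃ : (x 1 + W.a₃ * x 2) * x 2 = 0 := by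
    simpa [cubicMatrix, Matrix.det_fin_two, Fin.succAbove, hX] using h 2 1
  have ha₄ : W.a₄ * x 2 * x 2 = 0 := by
    simpa [cubicMatrix, Matrix.det_fin_two, Fin.succAbove, hX] using h 2 2
  by_cases hZ : x 2 = 0
  · have hY : x 1 = 0 := by simpa [hZ] using hY
    exact hx (by ext i; fin_cases i <;> simp [hX, hY, hZ])
  · have hY : x 1 = 0 := hYZ.resolve_left hZ
    have ha₃ : W.a₃ = 0 := by simpa [hY, hZ] using ha₃
    have ha₄ : W.a₄ = 0 := by simpa [hZ] using ha₄
    apply hΔ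
    simp [WeierstrassCurve.Δ, WeierstrassCurve.b₂, WeierstrassCurve.b₄, WeierstrassCurve.b₆,
      WeierstrassCurve.b₈, ha₃, ha₄, h6]

theorem mul_eq_mul_of_smul_eq {ι κ : Type*} {y : ι → κ → F} {w : κ → F}
    (h : ∀ v, ∃ c : F, y v = c • w) (v v' : ι) (i j : κ) : y v i * y v' j = y v j * y v' i := by
  obtain ⟨c, hc⟩ := h v
  obtain ⟨c', hc'⟩ := h v'
  simp only [hc, hc', Pi.smul_apply, smul_eq_mul]
  ring

theorem eq_zero_of_cubicPairing_left_eq_smul {u w : Fin 3 → F}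
    (h : ∀ v, ∃ c : F, cubicPairing W u v = c • w) : u = 0 := by
  have hminor := mul_eq_mul_of_smul_eq h
  have h0 : u 0 = 0 := by
    simpa [cubicPairing_apply] using hminor ![1, 0, 0] ![0, 0, 1] 0 1
  have h1 : u 1 = 0 := by
    simpa [cubicPairing_apply, h0] using hminor ![1, 0, 0] ![0, 1, 0] 0 2
  have h2 : u 2 = 0 := by
    simpa [cubicPairing_apply, h0, h1] using hminor ![0, 1, 0] ![0, 0, 1] 0 1
  ext i
  fin_cases i <;> assumption

theorem eq_zero_of_cubicPairing_right_eq_smul {v w : Fin 3 → F}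
    (h : ∀ u, ∃ c : F, cubicPairing W u v = c • w) : v = 0 := by
  have hminor := mul_eq_mul_of_smul_eq h
  have h1 : v 1 = 0 := by
    simpa [cubicPairing_apply] using hminor ![0, 1, 0] ![0, 0, 1] 0 1
  have h2 : v 2 = 0 := by
    simpa [cubicPairing_apply, h1] using hminor ![1, 0, 0] ![0, 0, 1] 0 1
  have h0 : v 0 = 0 := by
    simpa [cubicPairing_apply, h1, h2] using hminor ![1, 0, 0] ![0, 1, 0] 0 2
  ext i
  fin_cases i <;> assumption

end Field

section Annihilator

variable {W : WeierstrassCurve ℤ} {p : ℕ} [hp : Fact p.Prime]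

theorem mem_pMul_top_iff {ι : Type*} {x : ι → ℤ} :
    x ∈ pMul p (⊤ : AddSubgroup (ι → ℤ)) ↔ Int.castRingHom (ZMod p) ∘ x = 0 := by
  constructor
  · rintro ⟨y, -, rfl⟩
    ext i
    simp
  · intro h
    have hdvd (i : ι) : ∃ c, x i = p * c :=
      (ZMod.intCast_zmod_eq_zero_iff_dvd _ _).1 (congrFun h i)
    choose y hy using hdvd
    exact ⟨y, trivial, by ext i; simp [hy]⟩

theorem annihilator_cubicPairing_le_pMul_top {Φ : AddSubgroup (Fin 3 → ℤ)} {k : ℕ} (hk : 2 ≤ k)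
    (h : residueIndex p Φ = p ^ k) : annihilator (cubicPairing W) Φ ≤ pMul p ⊤ := by
  obtain ⟨w, hw⟩ := exists_forall_sub_zsmul_mem_pMul_top (k := k) (by simpa) h
  have hred {z : Fin 3 → ℤ} (hz : z ∈ Φ) : ∃ c : ZMod p,
      Int.castRingHom (ZMod p) ∘ z = c • (Int.castRingHom (ZMod p) ∘ w) := by
    obtain ⟨c, hc⟩ := hw z hz
    refine ⟨c, funext fun i => sub_eq_zero.1 ?_⟩
    simpa using congrFun (mem_pMul_top_iff.1 hc) i
  have hlift := (ZMod.ringHom_surjective (Int.castRingHom (ZMod p))).comp_left (α := Fin 3)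
  rintro ⟨u, v⟩ huv
  obtain ⟨hu, hv⟩ := mem_annihilator.1 huv
  have hu0 : u ∈ pMul p ⊤ := mem_pMul_top_iff.2 <| eq_zero_of_cubicPairing_left_eq_smul
    (W := W.map (Int.castRingHom (ZMod p))) fun v' => by
      obtain ⟨v', rfl⟩ := hlift v'
      exact cubicPairing_map (Int.castRingHom (ZMod p)) W u v' ▸ hred (hu v')
  have hv0 : v ∈ pMul p ⊤ := mem_pMul_top_iff.2 <| eq_zero_of_cubicPairing_right_eq_smul
    (W := W.map (Int.castRingHom (ZMod p))) fun u' => by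
      obtain ⟨u', rfl⟩ := hlift u'
      exact cubicPairing_map (Int.castRingHom (ZMod p)) W u' v ▸ hred (hv u')
  obtain ⟨u', -, rfl⟩ := hu0
  obtain ⟨v', -, rfl⟩ := hv0
  exact ⟨(u', v'), trivial, rfl⟩

theorem indexExp_annihilator_cubicPairing {Φ : AddSubgroup (Fin 3 → ℤ)} {k : ℕ} (hk : 2 ≤ k)
    (h : residueIndex p Φ = p ^ k) (hΦ : HasPIndex p Φ) :
    indexExp p (annihilator (cubicPairing W) Φ) =
      6 + indexExp p (annihilator (cubicPairing W) (pDiv p Φ)) := by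
  rw [indexExp_annihilator_of_le_pMul_top hΦ (annihilator_cubicPairing_le_pMul_top hk h)]
  simp

end Annihilator

end Cubic

/-! ### Kernels of matrices of corank at most one -/

section CorankOne

open scoped Matrix

variable {R : Type*} [CommRing R] {n : ℕ} {M : Matrix (Fin (n + 1)) (Fin (n + 1)) R}
  {i j : Fin (n + 1)}

theorem isUnit_adjugate_apply (h : IsUnit (M.submatrix i.succAbove j.succAbove).det) :
    IsUnit (M.adjugate j i) := by
  rw [Matrix.adjugate_fin_succ_eq_det_submatrix]
  exact (isUnit_one.neg.pow _).mul h

theorem det_mul_apply_eq_zero {v : Fin (n + 1) → R} (hv : M *ᵥ v = 0) : M.det * v j = 0 := by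
  have h : M.adjugate *ᵥ M *ᵥ v = 0 := by rw [hv, Matrix.mulVec_zero]
  rw [Matrix.mulVec_mulVec, Matrix.adjugate_mul, Matrix.smul_mulVec, Matrix.one_mulVec] at h
  exact congrFun h j

theorem eq_zero_of_mulVec_eq_zero_of_apply_eq_zero
    (h : IsUnit (M.submatrix i.succAbove j.succAbove).det) {v : Fin (n + 1) → R}
    (hv : M *ᵥ v = 0) (hj : v j = 0) : v = 0 := by
  have hminor : M.submatrix i.succAbove j.succAbove *ᵥ (v ∘ j.succAbove) = 0 := by
    ext k
    have hk := congrFun hv (i.succAbove k)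
    rw [Matrix.mulVec, dotProduct, Fin.sum_univ_succAbove _ j, hj, mul_zero, zero_add] at hk
    exact hk
  have hzero : v ∘ j.succAbove = 0 :=
    Matrix.mulVec_injective_of_isUnit ((Matrix.isUnit_iff_isUnit_det _).2 h)
      (hminor.trans (Matrix.mulVec_zero _).symm)
  ext k
  rcases Fin.eq_self_or_eq_succAbove j k with rfl | ⟨l, rfl⟩
  · exact hj
  · exact congrFun hzero l

theorem exists_mulVec_eq_zero_apply_eq (h : IsUnit (M.submatrix i.succAbove j.succAbove).det)
    {r : R} (hr : M.det * r = 0) : ∃ v, M *ᵥ v = 0 ∧ v j = r := by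
  obtain ⟨c, hc⟩ := isUnit_adjugate_apply h
  refine ⟨(c⁻¹ * r) • M.adjugate *ᵥ Pi.single i 1, ?_, ?_⟩
  · rw [Matrix.mulVec_smul, Matrix.mulVec_mulVec, Matrix.mul_adjugate, Matrix.smul_mulVec,
      smul_smul, mul_assoc, mul_comm r, hr, mul_zero, zero_smul]
  · rw [Matrix.mulVec_single_one, Pi.smul_apply, Matrix.col_apply, ← hc, smul_eq_mul,
      mul_right_comm, Units.inv_mul, one_mul]

theorem card_ker_mulVec (h : IsUnit (M.submatrix i.succAbove j.succAbove).det) :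
    Nat.card {v // M *ᵥ v = 0} = Nat.card {r : R // M.det * r = 0} := by
  refine Nat.card_congr (Equiv.ofBijective (fun v => ⟨v.1 j, det_mul_apply_eq_zero v.2⟩)
    ⟨fun v w hvw => ?_, fun r => ?_⟩)
  · refine Subtype.ext (sub_eq_zero.1 (eq_zero_of_mulVec_eq_zero_of_apply_eq_zero h ?_ ?_))
    · rw [Matrix.mulVec_sub, v.2, w.2, sub_zero]
    · exact sub_eq_zero.2 (Subtype.ext_iff.1 hvw)
  · obtain ⟨v, hv, hvr⟩ := exists_mulVec_eq_zero_apply_eq h r.2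
    exact ⟨⟨v, hv⟩, Subtype.ext hvr⟩

end CorankOne

theorem card_intCast_mul_eq_zero {N : ℕ} [NeZero N] (d : ℤ) :
    Nat.card {r : ZMod N // (d : ZMod N) * r = 0} = Int.gcd d N := by
  have hrange : (AddMonoidHom.mulLeft (d : ZMod N)).range =
      AddSubgroup.zmultiples (d : ZMod N) := by
    ext x
    rw [AddMonoidHom.mem_range, AddSubgroup.mem_zmultiples_iff, ZMod.intCast_surjective.exists]
    simp [mul_comm]
  have horder : addOrderOf (d : ZMod N) = N / Int.gcd d N := by
    have habs : addOrderOf (d : ZMod N) = addOrderOf (d.natAbs : ZMod N) := by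
      rcases Int.natAbs_eq d with h | h <;> (conv_lhs => rw [h]) <;> simp
    rw [habs, ZMod.addOrderOf_coe _ (NeZero.ne N), Int.gcd_comm, Int.gcd, Int.natAbs_natCast]
  have hdvd : Int.gcd d N ∣ N := Int.natCast_dvd_natCast.1 (Int.gcd_dvd_right d N)
  have hpos : 0 < N / Int.gcd d N :=
    Nat.div_pos_iff.2 ⟨Nat.pos_of_dvd_of_pos hdvd (NeZero.pos N), Nat.le_of_dvd (NeZero.pos N) hdvd⟩
  have hcard := AddSubgroup.card_mul_index (AddMonoidHom.mulLeft (d : ZMod N)).ker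
  rw [AddSubgroup.index_ker, hrange, Nat.card_zmultiples, horder, Nat.card_zmod] at hcard
  exact Nat.eq_of_mul_eq_mul_right hpos (hcard.trans (Nat.mul_div_cancel' hdvd).symm)

/-! ### Lattices with cyclic quotient -/

section CyclicQuotient

variable {A : Type*} [AddCommGroup A]

theorem exists_surjective_zmod_ker_eq {Φ : AddSubgroup A} {z : A}
    (h : Φ ⊔ AddSubgroup.zmultiples z = ⊤) {N : ℕ} (hN : Φ.index = N) :
    ∃ g : A →+ ZMod N, Function.Surjective g ∧ g.ker = Φ := by
  subst hN
  have hcyc : IsAddCyclic (A ⧸ Φ) := by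
    refine ⟨QuotientAddGroup.mk' Φ z, fun y => ?_⟩
    obtain ⟨y, rfl⟩ := QuotientAddGroup.mk'_surjective Φ y
    obtain ⟨f, hf, w, hw, rfl⟩ := AddSubgroup.mem_sup.1 (h ▸ AddSubgroup.mem_top y)
    obtain ⟨k, rfl⟩ := AddSubgroup.mem_zmultiples_iff.1 hw
    refine AddSubgroup.mem_zmultiples_iff.2 ⟨k, ?_⟩
    rw [map_add, show QuotientAddGroup.mk' Φ f = 0 from (QuotientAddGroup.eq_zero_iff f).2 hf,
      zero_add, map_zsmul]
  let e : A ⧸ Φ ≃+ ZMod Φ.index := (zmodAddCyclicAddEquiv hcyc).symm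
  refine ⟨e.toAddMonoidHom.comp (QuotientAddGroup.mk' Φ),
    e.surjective.comp (QuotientAddGroup.mk'_surjective Φ), ?_⟩
  ext y
  rw [AddMonoidHom.mem_ker]
  exact (map_eq_zero_iff e e.injective).trans (QuotientAddGroup.eq_zero_iff y)

theorem ker_eq_ker_iff_exists_unit_mul {N : ℕ} {f g : A →+ ZMod N} (hf : Function.Surjective f)
    (hg : Function.Surjective g) : f.ker = g.ker ↔ ∃ c : (ZMod N)ˣ, ∀ z, g z = c * f z := by
  constructor
  · intro h
    obtain ⟨z, hz⟩ := hf 1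
    have hmul (w : A) : g w = g z * f w := by
      obtain ⟨k, hk⟩ := ZMod.intCast_surjective (f w)
      have hw : w - k • z ∈ g.ker := by
        rw [← h, AddMonoidHom.mem_ker, map_sub, map_zsmul, hz, zsmul_one, hk, sub_self]
      rw [AddMonoidHom.mem_ker, map_sub, map_zsmul, sub_eq_zero] at hw
      rw [hw, ← hk, zsmul_eq_mul, mul_comm]
    obtain ⟨w, hw⟩ := hg 1
    exact ⟨(IsUnit.of_mul_eq_one (f w) (by rw [← hmul, hw])).unit, hmul⟩
  · rintro ⟨c, hc⟩
    ext z
    rw [AddMonoidHom.mem_ker, AddMonoidHom.mem_ker, hc, Units.mul_right_eq_zero]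

theorem exists_sup_zmultiples_eq_top {p : ℕ} [hp : Fact p.Prime] {Φ : AddSubgroup A}
    (hΦ : HasPIndex p Φ) (h : residueIndex p Φ = p) :
    ∃ z, Φ ⊔ AddSubgroup.zmultiples z = ⊤ := by
  have hne : Φ ⊔ pMul p ⊤ ≠ ⊤ := fun htop =>
    hp.out.ne_one (by rw [← h, residueIndex, htop, AddSubgroup.index_top])
  obtain ⟨z, hz⟩ : ∃ z, z ∉ Φ ⊔ pMul p ⊤ := by
    by_contra! hall
    exact hne (top_unique fun z _ => hall z)
  have hle : Φ ⊔ pMul p ⊤ ≤ (Φ ⊔ AddSubgroup.zmultiples z) ⊔ pMul p ⊤ :=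
    sup_le_sup_right le_sup_left _
  have hmul := AddSubgroup.relIndex_mul_index hle
  change _ * residueIndex p (Φ ⊔ AddSubgroup.zmultiples z) = residueIndex p Φ at hmul
  rw [h] at hmul
  have hP : HasPIndex p (Φ ⊔ AddSubgroup.zmultiples z) := by
    obtain ⟨n, hn⟩ := hΦ
    exact .of_dvd (n := n) (hn ▸ AddSubgroup.index_dvd_of_le le_sup_left)
  refine ⟨z, eq_top_of_residueIndex_eq_one hP ?_⟩
  refine ((Nat.dvd_prime hp.out).1 (Dvd.intro_left _ hmul)).resolve_right fun hres => hz ?_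
  rw [hres] at hmul
  exact AddSubgroup.relIndex_eq_one.1 ((Nat.mul_eq_right hp.out.ne_zero).1 hmul)
    (le_sup_left (a := Φ ⊔ _) (le_sup_right (a := Φ) (AddSubgroup.mem_zmultiples z)))

end CyclicQuotient

section CongruenceLattice

variable {ι : Type*}

/-- The vector `x` is nonzero modulo `p`. -/
def IsPrimitiveMod (p : ℕ) (x : ι → ℤ) : Prop := ∃ i, ¬ (p : ℤ) ∣ x i

theorem isPrimitiveMod_iff {p : ℕ} {x : ι → ℤ} :
    IsPrimitiveMod p x ↔ Int.castRingHom (ZMod p) ∘ x ≠ 0 := by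
  rw [Function.ne_iff]
  exact exists_congr fun i => not_congr (ZMod.intCast_zmod_eq_zero_iff_dvd _ _).symm

theorem isUnit_intCast_of_not_dvd {p : ℕ} [hp : Fact p.Prime] {d : ℤ} (h : ¬ (p : ℤ) ∣ d) (a : ℕ) :
    IsUnit (d : ZMod (p ^ a)) := by
  rw [ZMod.coe_int_isUnit_iff_isCoprime, Nat.cast_pow]
  exact ((Nat.prime_iff_prime_int.1 hp.out).coprime_iff_not_dvd.2 h).pow_left

variable [Fintype ι]

/-- The homomorphism `z ↦ x ⬝ᵥ z` modulo `N`. -/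
def congruenceHom (N : ℕ) (x : ι → ℤ) : (ι → ℤ) →+ ZMod N :=
  AddMonoidHom.mk' (fun z => ((x ⬝ᵥ z : ℤ) : ZMod N)) fun z w => by
    rw [dotProduct_add, Int.cast_add]

/-- The lattice of the solutions `z` of the congruence `x ⬝ᵥ z ≡ 0` modulo `N`. -/
def congruenceLattice (N : ℕ) (x : ι → ℤ) : AddSubgroup (ι → ℤ) := (congruenceHom N x).ker

theorem congruenceHom_apply (N : ℕ) (x z : ι → ℤ) : congruenceHom N x z = ((x ⬝ᵥ z : ℤ) : ZMod N) :=
  rfl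

theorem mem_congruenceLattice {N : ℕ} {x z : ι → ℤ} :
    z ∈ congruenceLattice N x ↔ (N : ℤ) ∣ x ⬝ᵥ z :=
  ZMod.intCast_zmod_eq_zero_iff_dvd _ _

theorem congruenceHom_single [DecidableEq ι] (N : ℕ) (x : ι → ℤ) (i : ι) :
    congruenceHom N x (Pi.single i 1) = x i := by
  rw [congruenceHom_apply, dotProduct_single_one]

theorem exists_eq_congruenceHom {N : ℕ} (g : (ι → ℤ) →+ ZMod N) : ∃ x, g = congruenceHom N x := by
  classical
  choose x hx using fun i => ZMod.intCast_surjective (g (Pi.single i 1))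
  refine ⟨x, AddMonoidHom.functions_ext' _ _ _ fun i => AddMonoidHom.ext_int ?_⟩
  simp [hx, congruenceHom_single]

variable {p : ℕ} [hp : Fact p.Prime]

theorem IsPrimitiveMod.congruenceHom_surjective {x : ι → ℤ} (hx : IsPrimitiveMod p x) (a : ℕ) :
    Function.Surjective (congruenceHom (p ^ a) x) := by
  classical
  intro c
  obtain ⟨i, hi⟩ := hx
  obtain ⟨t, ht⟩ := (isUnit_intCast_of_not_dvd hi a).exists_left_inv
  obtain ⟨k, hk⟩ := ZMod.intCast_surjective (c * t)
  exact ⟨k • Pi.single i 1, by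
    rw [map_zsmul, congruenceHom_single, zsmul_eq_mul, hk, mul_assoc, ht, mul_one]⟩

theorem isPrimitiveMod_of_congruenceHom_surjective {x : ι → ℤ} {n : ℕ} (hn : n ≠ 0)
    (h : Function.Surjective (congruenceHom (p ^ n) x)) : IsPrimitiveMod p x := by
  by_contra hx
  have hdvd (i : ι) : (p : ℤ) ∣ x i := by
    by_contra hi
    exact hx ⟨i, hi⟩
  obtain ⟨y, hy⟩ := h 1
  have hone : (p : ℤ) ∣ x ⬝ᵥ y - 1 := by
    refine dvd_trans (Int.natCast_dvd_natCast.2 (dvd_pow_self p hn))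
      ((ZMod.intCast_zmod_eq_zero_iff_dvd _ _).1 ?_)
    rw [Int.cast_sub, Int.cast_one, ← hy, congruenceHom_apply, sub_self]
  have hxy : (p : ℤ) ∣ x ⬝ᵥ y := Finset.dvd_sum fun i _ => (hdvd i).mul_right _
  exact (Nat.prime_iff_prime_int.1 hp.out).not_dvd_one ((dvd_sub_right hxy).1 hone)

theorem index_congruenceLattice {x : ι → ℤ} (hx : IsPrimitiveMod p x) (a : ℕ) :
    (congruenceLattice (p ^ a) x).index = p ^ a := by
  rw [congruenceLattice, AddSubgroup.index_ker,
    AddMonoidHom.range_eq_top.2 (hx.congruenceHom_surjective a), AddSubgroup.card_top,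
    Nat.card_zmod]

theorem pDiv_congruenceLattice (x : ι → ℤ) (a : ℕ) :
    pDiv p (congruenceLattice (p ^ (a + 1)) x) = congruenceLattice (p ^ a) x := by
  ext z
  rw [mem_pDiv, mem_congruenceLattice, mem_congruenceLattice, dotProduct_smul, nsmul_eq_mul,
    pow_succ', Nat.cast_mul]
  exact mul_dvd_mul_iff_left (Int.natCast_ne_zero.2 hp.out.ne_zero)

theorem isLevel_congruenceLattice {x : ι → ℤ} (hx : IsPrimitiveMod p x) (a : ℕ) :
    IsLevel p a (congruenceLattice (p ^ a) x) := by
  induction a with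
  | zero => exact top_unique fun z _ => by simp [mem_congruenceLattice]
  | succ a ih =>
    refine ⟨by rwa [pDiv_congruenceLattice], fun h => ?_⟩
    have hindex := index_congruenceLattice hx (a + 1)
    rw [h, AddSubgroup.index_top] at hindex
    exact (Nat.one_lt_pow a.succ_ne_zero hp.out.one_lt).ne hindex

theorem residueIndex_congruenceLattice {x : ι → ℤ} (hx : IsPrimitiveMod p x) (a : ℕ) :
    residueIndex p (congruenceLattice (p ^ (a + 1)) x) = p := by
  have h := index_eq_residueIndex_mul p (congruenceLattice (p ^ (a + 1)) x)
  rw [pDiv_congruenceLattice, index_congruenceLattice hx, index_congruenceLattice hx] at h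
  exact (Nat.eq_of_mul_eq_mul_right (pow_pos hp.out.pos a) ((pow_succ' p a).symm.trans h)).symm

theorem exists_eq_congruenceLattice {Φ : AddSubgroup (ι → ℤ)} {a : ℕ} (ha : IsLevel p a Φ)
    (h : residueIndex p Φ = p) : ∃ x, IsPrimitiveMod p x ∧ Φ = congruenceLattice (p ^ a) x := by
  obtain ⟨z, hz⟩ := exists_sup_zmultiples_eq_top ha.hasPIndex h
  obtain ⟨n, hn⟩ := ha.hasPIndex
  have hn0 : n ≠ 0 := by
    rintro rfl
    rw [residueIndex, AddSubgroup.index_eq_one.1 hn, top_sup_eq, AddSubgroup.index_top] at h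
    exact hp.out.ne_one h.symm
  obtain ⟨g, hg, hker⟩ := exists_surjective_zmod_ker_eq hz hn
  obtain ⟨x, rfl⟩ := exists_eq_congruenceHom g
  have hx := isPrimitiveMod_of_congruenceHom_surjective hn0 hg
  obtain rfl : congruenceLattice (p ^ n) x = Φ := hker
  obtain rfl := (isLevel_congruenceLattice hx n).unique ha
  exact ⟨x, hx, rfl⟩

theorem congruenceLattice_eq_iff {x y : ι → ℤ} (hx : IsPrimitiveMod p x) (hy : IsPrimitiveMod p y)
    (a : ℕ) : congruenceLattice (p ^ a) x = congruenceLattice (p ^ a) y ↔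
      ∃ c : (ZMod (p ^ a))ˣ, Int.castRingHom (ZMod (p ^ a)) ∘ y =
        c • (Int.castRingHom (ZMod (p ^ a)) ∘ x) := by
  classical
  refine (ker_eq_ker_iff_exists_unit_mul (hx.congruenceHom_surjective a)
    (hy.congruenceHom_surjective a)).trans (exists_congr fun c => ⟨fun h => ?_, fun h z => ?_⟩)
  · ext i
    simpa [congruenceHom_single, Units.smul_def] using h (Pi.single i 1)
  · have hdot (w : ι → ℤ) : congruenceHom (p ^ a) w z =
        (Int.castRingHom (ZMod (p ^ a)) ∘ w) ⬝ᵥ (Int.castRingHom (ZMod (p ^ a)) ∘ z) :=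
      RingHom.map_dotProduct (Int.castRingHom _) _ _
    rw [hdot, hdot, h, smul_dotProduct, Units.smul_def, smul_eq_mul]

end CongruenceLattice

/-! ### Annihilators modulo a lattice with cyclic quotient -/

section CyclicAnnihilator

open scoped Matrix

theorem dvd_iff_forall_dvd_dotProduct {ι : Type*} [Fintype ι] {N : ℤ} {w : ι → ℤ} :
    (∀ i, N ∣ w i) ↔ ∀ u : ι → ℤ, N ∣ u ⬝ᵥ w := by
  classical
  exact ⟨fun h u => Finset.dvd_sum fun i _ => (h i).mul_left _,
    fun h i => by simpa using h (Pi.single i 1)⟩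

theorem index_mul_gcd_det {n N : ℕ} [NeZero N] {M : Matrix (Fin (n + 1)) (Fin (n + 1)) ℤ}
    {i j : Fin (n + 1)}
    (h : IsUnit ((M.submatrix i.succAbove j.succAbove).det : ZMod N))
    {H : AddSubgroup (Fin (n + 1) → ℤ)} (hH : ∀ v, v ∈ H ↔ ∀ i, (N : ℤ) ∣ (M *ᵥ v) i) :
    H.index * Int.gcd M.det N = N ^ (n + 1) := by
  let φ := Int.castRingHom (ZMod N)
  let red : (Fin (n + 1) → ℤ) →+ (Fin (n + 1) → ZMod N) := φ.toAddMonoidHom.compLeft _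
  let m : (Fin (n + 1) → ZMod N) →+ (Fin (n + 1) → ZMod N) := (M.map φ).mulVecLin.toAddMonoidHom
  have hred : Function.Surjective red := ZMod.intCast_surjective.comp_left
  have hker : H = (m.comp red).ker := by
    ext v
    rw [hH, AddMonoidHom.mem_ker, funext_iff]
    refine forall_congr' fun i => ?_
    rw [← ZMod.intCast_zmod_eq_zero_iff_dvd]
    have hmap : φ ((M *ᵥ v) i) = ((M.map φ) *ᵥ (φ ∘ v)) i := RingHom.map_mulVec φ M v i
    exact Eq.congr_left hmap
  have hindex : H.index = Nat.card m.range := by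
    rw [hker, AddSubgroup.index_ker, AddMonoidHom.range_comp, AddMonoidHom.range_eq_top.2 hred,
      AddMonoidHom.range_eq_map]
  have hcard : Nat.card m.ker = Int.gcd M.det N := by
    have hminor : IsUnit ((M.map φ).submatrix i.succAbove j.succAbove).det := by
      have hdet := RingHom.map_det φ (M.submatrix i.succAbove j.succAbove)
      rw [Matrix.submatrix_map]
      exact hdet ▸ h
    have hdet : (M.map φ).det = (M.det : ZMod N) := (RingHom.map_det φ M).symm
    rw [← card_intCast_mul_eq_zero, ← hdet, ← card_ker_mulVec hminor]
    rfl
  have hmul := AddSubgroup.card_mul_index m.ker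
  rw [AddSubgroup.index_ker, hcard, ← hindex] at hmul
  rw [mul_comm, hmul]
  simp

variable {W : WeierstrassCurve ℤ} {p : ℕ} [hp : Fact p.Prime] {x : Fin 3 → ℤ}

theorem exists_not_dvd_minor_cubicMatrix (h6 : W.a₆ = 0) (hΔ : ¬ (p : ℤ) ∣ W.Δ)
    (hx : IsPrimitiveMod p x) :
    ∃ i j : Fin 3, ¬ (p : ℤ) ∣ ((cubicMatrix W x).submatrix i.succAbove j.succAbove).det := by
  let φ := Int.castRingHom (ZMod p)
  have hΔ' : (W.map φ).Δ ≠ 0 := by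
    rw [WeierstrassCurve.map_Δ]
    exact mt (ZMod.intCast_zmod_eq_zero_iff_dvd _ _).1 hΔ
  obtain ⟨i, j, hij⟩ := exists_minor_cubicMatrix_ne_zero (W := W.map φ) (by simp [h6]) hΔ'
    (isPrimitiveMod_iff.1 hx)
  refine ⟨i, j, fun h => hij ?_⟩
  rw [cubicMatrix_map, Matrix.submatrix_map]
  exact (RingHom.map_det φ _).symm.trans ((ZMod.intCast_zmod_eq_zero_iff_dvd _ _).2 h)

theorem index_leftAnnihilator_flip_mul_gcd (h6 : W.a₆ = 0) (hΔ : ¬ (p : ℤ) ∣ W.Δ)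
    (hx : IsPrimitiveMod p x) (a : ℕ) :
    (leftAnnihilator (cubicPairing W).flip (congruenceLattice (p ^ a) x)).index *
      Int.gcd (cubicForm W x) (p ^ a : ℕ) = p ^ (3 * a) := by
  obtain ⟨i, j, hij⟩ := exists_not_dvd_minor_cubicMatrix h6 hΔ hx
  rw [← det_cubicMatrix, mul_comm 3, pow_mul]
  refine index_mul_gcd_det (isUnit_intCast_of_not_dvd hij a) fun v => ?_
  rw [mem_leftAnnihilator, dvd_iff_forall_dvd_dotProduct]
  refine forall_congr' fun u => ?_
  rw [← dotProduct_cubicPairing, mem_congruenceLattice, LinearMap.flip_apply]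

theorem index_leftAnnihilator_mul_gcd (h6 : W.a₆ = 0) (hΔ : ¬ (p : ℤ) ∣ W.Δ)
    (hx : IsPrimitiveMod p x) (a : ℕ) :
    (leftAnnihilator (cubicPairing W) (congruenceLattice (p ^ a) x)).index *
      Int.gcd (cubicForm W x) (p ^ a : ℕ) = p ^ (3 * a) := by
  obtain ⟨i, j, hij⟩ := exists_not_dvd_minor_cubicMatrix h6 hΔ hx
  have hij' : ¬ (p : ℤ) ∣ ((cubicMatrix W x)ᵀ.submatrix j.succAbove i.succAbove).det := by
    rwa [← Matrix.transpose_submatrix, Matrix.det_transpose]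
  rw [← det_cubicMatrix, ← Matrix.det_transpose, mul_comm 3, pow_mul]
  refine index_mul_gcd_det (isUnit_intCast_of_not_dvd hij' a) fun u => ?_
  rw [mem_leftAnnihilator, dvd_iff_forall_dvd_dotProduct]
  refine forall_congr' fun v => ?_
  rw [mem_congruenceLattice, dotProduct_cubicPairing, Matrix.mulVec_transpose, dotProduct_comm v,
    ← Matrix.dotProduct_mulVec]

/-- The exponent of `p` in `d`, truncated at `a`; the truncation makes it depend only on `d`
modulo `p ^ a`. -/
noncomputable def truncVal (p a : ℕ) (d : ℤ) : ℕ := padicValNat p (Int.gcd d (p ^ a : ℕ))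

theorem truncVal_le_and_gcd_eq (a : ℕ) (d : ℤ) :
    truncVal p a d ≤ a ∧ Int.gcd d (p ^ a : ℕ) = p ^ truncVal p a d := by
  have hdvd : Int.gcd d (p ^ a : ℕ) ∣ p ^ a :=
    Int.natCast_dvd_natCast.1 (Int.gcd_dvd_right d _)
  obtain ⟨k, hk, h⟩ := (Nat.dvd_prime_pow hp.out).1 hdvd
  have hval : truncVal p a d = k := by rw [truncVal, h, padicValNat.prime_pow]
  exact hval ▸ ⟨hk, h⟩

theorem truncVal_le (a : ℕ) (d : ℤ) : truncVal p a d ≤ a := (truncVal_le_and_gcd_eq a d).1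

theorem gcd_eq_pow_truncVal (a : ℕ) (d : ℤ) : Int.gcd d (p ^ a : ℕ) = p ^ truncVal p a d :=
  (truncVal_le_and_gcd_eq a d).2

theorem indexExp_annihilator_congruenceLattice (h6 : W.a₆ = 0) (hΔ : ¬ (p : ℤ) ∣ W.Δ)
    (hx : IsPrimitiveMod p x) (a : ℕ) :
    indexExp p (annihilator (cubicPairing W) (congruenceLattice (p ^ a) x)) +
      2 * truncVal p a (cubicForm W x) = 6 * a := by
  have hP : HasPIndex p (annihilator (cubicPairing W) (congruenceLattice (p ^ a) x)) :=
    HasPIndex.annihilator ⟨a, index_congruenceLattice hx a⟩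
  have hl := index_leftAnnihilator_mul_gcd h6 hΔ hx a
  have hr := index_leftAnnihilator_flip_mul_gcd h6 hΔ hx a
  rw [gcd_eq_pow_truncVal] at hl hr
  refine Nat.pow_right_injective hp.out.two_le ?_
  calc p ^ (indexExp p (annihilator (cubicPairing W) (congruenceLattice (p ^ a) x)) +
        2 * truncVal p a (cubicForm W x))
      = (leftAnnihilator (cubicPairing W) (congruenceLattice (p ^ a) x)).index *
          p ^ truncVal p a (cubicForm W x) *
        ((leftAnnihilator (cubicPairing W).flip (congruenceLattice (p ^ a) x)).index *
          p ^ truncVal p a (cubicForm W x)) := by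
        rw [pow_add, ← hP.index_eq, annihilator, AddSubgroup.index_prod]
        ring
    _ = p ^ (6 * a) := by
        rw [hl, hr]
        ring

end CyclicAnnihilator

/-! ### The gradient of the cubic -/

section Gradient

variable {R : Type*} [CommRing R]

/-- The gradient of `cubicForm W`. -/
def cubicGradient (W : WeierstrassCurve R) (x : Fin 3 → R) : Fin 3 → R :=
  ![3 * x 0 ^ 2 + 2 * W.a₂ * x 0 * x 2 + W.a₄ * x 2 ^ 2 - W.a₁ * x 1 * x 2,
    -(2 * x 1 * x 2 + W.a₁ * x 0 * x 2 + W.a₃ * x 2 ^ 2),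
    W.a₂ * x 0 ^ 2 + 2 * W.a₄ * x 0 * x 2 - x 1 ^ 2 - W.a₁ * x 0 * x 1 - 2 * W.a₃ * x 1 * x 2]

theorem exists_cubicForm_add_smul (W : WeierstrassCurve R) (x y : Fin 3 → R) (t : R) :
    ∃ q, cubicForm W (x + t • y) = cubicForm W x + t * (cubicGradient W x ⬝ᵥ y) + t ^ 2 * q := by
  refine ⟨3 * x 0 * y 0 ^ 2 + W.a₂ * (2 * x 0 * y 0 * y 2 + x 2 * y 0 ^ 2) +
    W.a₄ * (x 0 * y 2 ^ 2 + 2 * x 2 * y 0 * y 2) - (2 * x 1 * y 1 * y 2 + x 2 * y 1 ^ 2) -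
    W.a₁ * (x 0 * y 1 * y 2 + x 1 * y 0 * y 2 + x 2 * y 0 * y 1) -
    W.a₃ * (x 1 * y 2 ^ 2 + 2 * x 2 * y 1 * y 2) + t * cubicForm W y, ?_⟩
  simp only [cubicForm, cubicGradient, dotProduct, Fin.sum_univ_three, Pi.add_apply, Pi.smul_apply,
    smul_eq_mul, Matrix.cons_val]
  ring

theorem dvd_cubicForm_add_smul_sub (W : WeierstrassCurve R) (x y : Fin 3 → R) (t : R) :
    t ∣ cubicForm W (x + t • y) - cubicForm W x := by
  obtain ⟨q, hq⟩ := exists_cubicForm_add_smul W x y t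
  exact ⟨cubicGradient W x ⬝ᵥ y + t * q, by rw [hq]; ring⟩

theorem dvd_cubicForm_add_smul_iff (W : WeierstrassCurve R) (x y : Fin 3 → R) (t : R) :
    t ∣ cubicForm W (x + t • y) ↔ t ∣ cubicForm W x :=
  dvd_iff_dvd_of_dvd_sub (dvd_cubicForm_add_smul_sub W x y t)

theorem cubicGradient_map {S : Type*} [CommRing S] (f : R →+* S) (W : WeierstrassCurve R)
    (x : Fin 3 → R) : cubicGradient (W.map f) (f ∘ x) = f ∘ cubicGradient W x := by
  ext i
  fin_cases i <;> simp [cubicGradient, map_ofNat]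

theorem cubicGradient_ne_zero {F : Type*} [Field F] {W : WeierstrassCurve F} (h6 : W.a₆ = 0)
    (hΔ : W.Δ ≠ 0) {x : Fin 3 → F} (hx : x ≠ 0) (h : cubicForm W x = 0) :
    cubicGradient W x ≠ 0 := by
  intro hg
  have g0 := congrFun hg 0
  have g1 := congrFun hg 1
  have g2 := congrFun hg 2
  simp only [cubicGradient, Matrix.cons_val, Pi.zero_apply] at g0 g1 g2
  have heq := (equation_iff_cubicForm_eq_zero h6 x).2 h
  by_cases hz : x 2 = 0
  · have h0 : x 0 = 0 := WeierstrassCurve.Projective.X_eq_zero_of_Z_eq_zero heq hz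
    have h1 : x 1 = 0 := by simpa [h0, hz] using g2
    exact hx (by ext i; fin_cases i <;> simp [h0, h1, hz])
  · have hns : W.toProjective.Nonsingular x := by
      rw [WeierstrassCurve.Projective.nonsingular_of_Z_ne_zero hz]
      rw [WeierstrassCurve.Projective.equation_of_Z_ne_zero hz] at heq
      exact (WeierstrassCurve.Affine.equation_iff_nonsingular_of_Δ_ne_zero hΔ).1 heq
    have ha₆ : W.toProjective.a₆ = 0 := h6
    rcases ((WeierstrassCurve.Projective.nonsingular_iff x).1 hns).2 with h' | h' | h' <;>
      refine h' ?_
    · linear_combination -g0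
    · linear_combination -g1
    · linear_combination -g2 - 3 * x 2 ^ 2 * ha₆

end Gradient

/-! ### Counting vectors modulo prime powers -/

section Digits

/-- The integer representatives between `0` and `N - 1` of a vector modulo `N`. -/
def liftVec {ι : Type*} {N : ℕ} (v : ι → ZMod N) : ι → ℤ := fun i => (v i).val

theorem intCast_comp_liftVec {ι : Type*} {N : ℕ} [NeZero N] (v : ι → ZMod N) :
    Int.castRingHom (ZMod N) ∘ liftVec v = v := by
  ext i
  simp [liftVec]

theorem val_finEquiv {n : ℕ} [NeZero n] (i : Fin n) : (ZMod.finEquiv n i).val = i := by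
  cases n with
  | zero => exact i.elim0
  | succ n => rfl

/-- Residues modulo `N * M` as pairs of digits: the pair `(x, y)` stands for `x + N * y`. -/
def digitEquiv (N M : ℕ) [NeZero N] [NeZero M] : ZMod N × ZMod M ≃ ZMod (N * M) :=
  (Equiv.prodComm _ _).trans <|
    ((ZMod.finEquiv M).symm.toEquiv.prodCongr (ZMod.finEquiv N).symm.toEquiv).trans <|
      finProdFinEquiv.trans <| (finCongr (mul_comm M N)).trans (ZMod.finEquiv (N * M)).toEquiv

theorem val_digitEquiv {N M : ℕ} [NeZero N] [NeZero M] (x : ZMod N) (y : ZMod M) :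
    (digitEquiv N M (x, y)).val = x.val + N * y.val := by
  obtain ⟨i, rfl⟩ := (ZMod.finEquiv N).surjective x
  obtain ⟨j, rfl⟩ := (ZMod.finEquiv M).surjective y
  simp [digitEquiv, val_finEquiv]

theorem sum_liftVec_mul {ι A : Type*} [Fintype ι] [DecidableEq ι] [AddCommMonoid A] (N M : ℕ)
    [NeZero N] [NeZero M] (g : (ι → ℤ) → A) :
    ∑ v : ι → ZMod (N * M), g (liftVec v) =
      ∑ v : ι → ZMod N, ∑ b : ι → ZMod M, g (liftVec v + (N : ℤ) • liftVec b) := by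
  let e : (ι → ZMod N) × (ι → ZMod M) ≃ (ι → ZMod (N * M)) :=
    (Equiv.arrowProdEquivProdArrow ι _ _).symm.trans ((Equiv.refl ι).arrowCongr (digitEquiv N M))
  rw [← Fintype.sum_prod_type', ← e.sum_comp]
  refine Finset.sum_congr rfl fun x _ => congrArg g ?_
  ext i
  simp [e, liftVec, val_digitEquiv]

theorem card_dotProduct_eq_mul {F ι : Type*} [Field F] [Fintype F] [DecidableEq F] [Fintype ι]
    [DecidableEq ι] {g : ι → F} (hg : g ≠ 0) (c : F) :
    (Finset.univ.filter fun b : ι → F => g ⬝ᵥ b = c).card * Fintype.card F =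
      Fintype.card F ^ Fintype.card ι := by
  obtain ⟨i, hi⟩ : ∃ i, g i ≠ 0 := Function.ne_iff.1 hg
  let f : (ι → F) →+ F := AddMonoidHom.mk' (g ⬝ᵥ ·) (dotProduct_add g)
  have hf : Function.Surjective f := fun d => ⟨Pi.single i ((g i)⁻¹ * d), by
    simp [f, dotProduct_single, mul_inv_cancel_left₀ hi]⟩
  obtain ⟨b₀, hb₀⟩ := hf c
  have hfiber : (Finset.univ.filter fun b : ι → F => g ⬝ᵥ b = c).card = Nat.card f.ker := by
    rw [← Fintype.card_subtype, ← Nat.card_eq_fintype_card]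
    refine Nat.card_congr ((Equiv.subRight b₀).subtypeEquiv fun b => ?_)
    rw [AddMonoidHom.mem_ker, Equiv.subRight_apply, map_sub, hb₀, sub_eq_zero]
    rfl
  have hindex := AddSubgroup.card_mul_index f.ker
  rw [AddSubgroup.index_ker, AddMonoidHom.range_eq_top.2 hf] at hindex
  simpa [hfiber] using hindex

end Digits

section PrimitiveVecs

variable {ι : Type*} {p : ℕ}

theorem isPrimitiveMod_add_smul {t : ℤ} (ht : (p : ℤ) ∣ t) (x y : ι → ℤ) :
    IsPrimitiveMod p (x + t • y) ↔ IsPrimitiveMod p x :=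
  exists_congr fun i => not_congr (dvd_add_left (ht.mul_right (y i)))

variable [hp : Fact p.Prime]

theorem isPrimitiveMod_liftVec_iff (b : ι → ZMod p) : IsPrimitiveMod p (liftVec b) ↔ b ≠ 0 := by
  rw [isPrimitiveMod_iff, intCast_comp_liftVec]

variable [Fintype ι] [DecidableEq ι]

open Classical in
variable (ι p) in
/-- The vectors modulo `p ^ a` that do not vanish modulo `p`, for positive `a`. -/
noncomputable def primitiveVecs (a : ℕ) : Finset (ι → ZMod (p ^ a)) :=
  Finset.univ.filter fun v => IsPrimitiveMod p (liftVec v)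

theorem mem_primitiveVecs {a : ℕ} {v : ι → ZMod (p ^ a)} :
    v ∈ primitiveVecs ι p a ↔ IsPrimitiveMod p (liftVec v) := by
  simp [primitiveVecs]

variable {M : Type*} [AddCommMonoid M]

theorem sum_primitiveVecs_succ {a : ℕ} (ha : a ≠ 0) (g : (ι → ℤ) → M) :
    ∑ v ∈ primitiveVecs ι p (a + 1), g (liftVec v) =
      ∑ v ∈ primitiveVecs ι p a, ∑ b : ι → ZMod p, g (liftVec v + (p : ℤ) ^ a • liftVec b) := by
  classical
  have hsum := sum_liftVec_mul (p ^ a) p fun x : ι → ℤ => if IsPrimitiveMod p x then g x else 0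
  rw [primitiveVecs, primitiveVecs, Finset.sum_filter, Finset.sum_filter]
  refine hsum.trans (Finset.sum_congr rfl fun v _ => ?_)
  simp only [Nat.cast_pow, isPrimitiveMod_add_smul (dvd_pow_self (p : ℤ) ha)]
  split_ifs <;> simp

theorem sum_primitiveVecs_one (g : (ι → ℤ) → M) :
    ∑ v ∈ primitiveVecs ι p 1, g (liftVec v) = ∑ b : ι → ZMod p with b ≠ 0, g (liftVec b) := by
  classical
  have key : ∀ (N : ℕ) [NeZero N], p = N →
      ∑ v : ι → ZMod N with IsPrimitiveMod p (liftVec v), g (liftVec v) =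
        ∑ b : ι → ZMod p with b ≠ 0, g (liftVec b) := by
    rintro N _ rfl
    simp only [isPrimitiveMod_liftVec_iff]
  convert key (p ^ 1) (pow_one p).symm
  simp [primitiveVecs]

theorem card_primitiveVecs_one : (primitiveVecs ι p 1).card + 1 = p ^ Fintype.card ι := by
  have hsum := sum_primitiveVecs_one (ι := ι) (p := p) fun _ => 1
  simp only [Finset.sum_const, smul_eq_mul, mul_one] at hsum
  rw [hsum, Finset.filter_ne', Finset.card_erase_add_one (Finset.mem_univ _)]
  simp

end PrimitiveVecs

/-! ### Hensel lifting on the cubic -/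

section TruncVal

variable {p a : ℕ} [hp : Fact p.Prime] {d e : ℤ}

theorem le_truncVal_iff {j : ℕ} : j ≤ truncVal p a d ↔ j ≤ a ∧ (p : ℤ) ^ j ∣ d := by
  rw [← Nat.pow_dvd_pow_iff_le_right hp.out.one_lt, ← gcd_eq_pow_truncVal,
    ← Int.natCast_dvd_natCast, Int.dvd_coe_gcd_iff, and_comm, Int.natCast_dvd_natCast,
    Nat.pow_dvd_pow_iff_le_right hp.out.one_lt, Nat.cast_pow]

theorem truncVal_of_dvd (h : (p : ℤ) ^ a ∣ d) : truncVal p a d = a :=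
  le_antisymm (truncVal_le a d) (le_truncVal_iff.2 ⟨le_rfl, h⟩)

theorem truncVal_succ_of_not_dvd (h : ¬ (p : ℤ) ^ (a + 1) ∣ d) :
    truncVal p (a + 1) d = truncVal p a d := by
  refine eq_of_forall_le_iff fun j => ?_
  rw [le_truncVal_iff, le_truncVal_iff]
  refine and_congr_left fun hj => ⟨fun hle => ?_, Nat.le_succ_of_le⟩
  refine Nat.le_of_lt_succ (lt_of_le_of_ne hle ?_)
  rintro rfl
  exact h hj

theorem truncVal_congr (h : (p : ℤ) ^ a ∣ d - e) : truncVal p a d = truncVal p a e := by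
  refine eq_of_forall_le_iff fun j => ?_
  rw [le_truncVal_iff, le_truncVal_iff]
  exact and_congr_right fun hj => dvd_iff_dvd_of_dvd_sub ((pow_dvd_pow _ hj).trans h)

/-- The weight `T ^ (7 * a - 2 * v)` of an integer with truncated valuation `v ≤ a`. It is
`T ^ w` for the exponent `w` that the lattice of a primitive vector modulo `p ^ a` contributes
when the integer is the value of the cubic there. -/
noncomputable def valueWeight {R : Type*} [CommRing R] (p a : ℕ) (T : R) (d : ℤ) : R :=
  T ^ (7 * a - 2 * truncVal p a d)

variable {R : Type*} [CommRing R] {T : R}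

theorem valueWeight_of_dvd (h : (p : ℤ) ^ a ∣ d) : valueWeight p a T d = T ^ (5 * a) := by
  rw [valueWeight, truncVal_of_dvd h]
  congr 1
  lia

theorem valueWeight_succ_of_not_dvd (h : ¬ (p : ℤ) ^ a ∣ e) (hd : (p : ℤ) ^ a ∣ d - e) :
    valueWeight p (a + 1) T d = T ^ 7 * valueWeight p a T e := by
  have hd' : ¬ (p : ℤ) ^ (a + 1) ∣ d := fun h' =>
    h ((dvd_iff_dvd_of_dvd_sub hd).1 ((pow_dvd_pow _ a.le_succ).trans h'))
  have hle := truncVal_le (p := p) a e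
  rw [valueWeight, valueWeight, truncVal_succ_of_not_dvd hd', truncVal_congr hd, ← pow_add]
  congr 1
  lia

theorem valueWeight_succ_of_dvd (h : (p : ℤ) ^ a ∣ d) : valueWeight p (a + 1) T d =
    T ^ (5 * a) * (T ^ 7 + if (p : ℤ) ^ (a + 1) ∣ d then T ^ 5 - T ^ 7 else 0) := by
  split_ifs with h'
  · rw [valueWeight_of_dvd h']
    ring
  · rw [valueWeight, truncVal_succ_of_not_dvd h', truncVal_of_dvd h, add_zero, ← pow_add]
    congr 1
    lia

end TruncVal

section Hensel

variable {W : WeierstrassCurve ℤ} {p a : ℕ} [hp : Fact p.Prime] {x : Fin 3 → ℤ}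

theorem pow_succ_dvd_cubicForm_add_iff (ha : a ≠ 0) {d : ℤ} (hd : cubicForm W x = (p : ℤ) ^ a * d)
    (y : Fin 3 → ℤ) : (p : ℤ) ^ (a + 1) ∣ cubicForm W (x + (p : ℤ) ^ a • y) ↔
      (p : ℤ) ∣ d + cubicGradient W x ⬝ᵥ y := by
  obtain ⟨q, hq⟩ := exists_cubicForm_add_smul W x y ((p : ℤ) ^ a)
  have hfactor : cubicForm W (x + (p : ℤ) ^ a • y) =
      (p : ℤ) ^ a * (d + cubicGradient W x ⬝ᵥ y + (p : ℤ) ^ a * q) := by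
    rw [hq, hd]
    ring
  rw [hfactor, pow_succ, mul_dvd_mul_iff_left (pow_ne_zero a (mod_cast hp.out.ne_zero))]
  exact dvd_add_left ((dvd_pow_self _ ha).mul_right q)

theorem dvd_cubicForm_iff : (p : ℤ) ∣ cubicForm W x ↔
    cubicForm (W.map (Int.castRingHom (ZMod p))) (Int.castRingHom (ZMod p) ∘ x) = 0 := by
  rw [cubicForm_map, ← ZMod.intCast_zmod_eq_zero_iff_dvd]
  rfl

theorem card_lift_zeros (h6 : W.a₆ = 0) (hΔ : ¬ (p : ℤ) ∣ W.Δ) (hx : IsPrimitiveMod p x)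
    (ha : a ≠ 0) (h : (p : ℤ) ^ a ∣ cubicForm W x) :
    (Finset.univ.filter fun b : Fin 3 → ZMod p =>
      (p : ℤ) ^ (a + 1) ∣ cubicForm W (x + (p : ℤ) ^ a • liftVec b)).card = p ^ 2 := by
  let φ := Int.castRingHom (ZMod p)
  have hΔ' : (W.map φ).Δ ≠ 0 := by
    rw [WeierstrassCurve.map_Δ]
    exact mt (ZMod.intCast_zmod_eq_zero_iff_dvd _ _).1 hΔ
  have hgrad : cubicGradient (W.map φ) (φ ∘ x) ≠ 0 :=
    cubicGradient_ne_zero (by simp [h6]) hΔ' (isPrimitiveMod_iff.1 hx)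
      (dvd_cubicForm_iff.1 ((dvd_pow_self _ ha).trans h))
  obtain ⟨d, hd⟩ := h
  have hdot (b : Fin 3 → ZMod p) : φ (cubicGradient W x ⬝ᵥ liftVec b) =
      cubicGradient (W.map φ) (φ ∘ x) ⬝ᵥ b := by
    rw [RingHom.map_dotProduct, cubicGradient_map, intCast_comp_liftVec]
  have hcard := card_dotProduct_eq_mul hgrad (-(d : ZMod p))
  rw [ZMod.card, Fintype.card_fin, pow_succ p 2] at hcard
  rw [← Nat.eq_of_mul_eq_mul_right hp.out.pos hcard]
  congr 1
  ext b
  rw [Finset.mem_filter_univ, Finset.mem_filter_univ, pow_succ_dvd_cubicForm_add_iff ha hd, ← hdot,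
    ← ZMod.intCast_zmod_eq_zero_iff_dvd, Int.cast_add, add_comm, eq_neg_iff_add_eq_zero]
  rfl

open Classical in
/-- The number of primitive vectors modulo `p ^ a` on the cubic. -/
noncomputable def zeroCount (W : WeierstrassCurve ℤ) (p a : ℕ) [Fact p.Prime] : ℕ :=
  ((primitiveVecs (Fin 3) p a).filter fun v => (p : ℤ) ^ a ∣ cubicForm W (liftVec v)).card

/-- The generating function of the primitive vectors modulo `p ^ a` by the value of the cubic. -/
noncomputable def valueSum {R : Type*} [CommRing R] (W : WeierstrassCurve ℤ) (p a : ℕ)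
    [Fact p.Prime] (T : R) : R :=
  ∑ v ∈ primitiveVecs (Fin 3) p a, valueWeight p a T (cubicForm W (liftVec v))

theorem zeroCount_succ (h6 : W.a₆ = 0) (hΔ : ¬ (p : ℤ) ∣ W.Δ) (ha : a ≠ 0) :
    zeroCount W p (a + 1) = p ^ 2 * zeroCount W p a := by
  classical
  rw [zeroCount, zeroCount, Finset.card_filter, Finset.card_filter, sum_primitiveVecs_succ ha
    fun x => if (p : ℤ) ^ (a + 1) ∣ cubicForm W x then 1 else 0, Finset.mul_sum]
  refine Finset.sum_congr rfl fun v hv => ?_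
  rw [← Finset.card_filter]
  split_ifs with h
  · rw [mul_one]
    convert card_lift_zeros h6 hΔ (mem_primitiveVecs.1 hv) ha h
  · rw [mul_zero, Finset.card_eq_zero, Finset.filter_eq_empty_iff]
    exact fun b _ hb => h ((dvd_cubicForm_add_smul_iff W _ _ _).1
      ((pow_dvd_pow _ a.le_succ).trans hb))

variable {R : Type*} [CommRing R] {T : R}

theorem sum_valueWeight_lift (h6 : W.a₆ = 0) (hΔ : ¬ (p : ℤ) ∣ W.Δ) (hx : IsPrimitiveMod p x)
    (ha : a ≠ 0) (h : (p : ℤ) ^ a ∣ cubicForm W x) :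
    ∑ b : Fin 3 → ZMod p,
        valueWeight p (a + 1) T (cubicForm W (x + (p : ℤ) ^ a • liftVec b)) =
      T ^ (5 * a) * (p ^ 3 * T ^ 7 + p ^ 2 * (T ^ 5 - T ^ 7)) := by
  classical
  have hweight (b : Fin 3 → ZMod p) :=
    valueWeight_succ_of_dvd (T := T) ((dvd_cubicForm_add_smul_iff W x (liftVec b) _).2 h)
  simp only [hweight]
  rw [← Finset.mul_sum, Finset.sum_add_distrib, ← Finset.sum_filter, Finset.sum_const,
    Finset.sum_const, card_lift_zeros h6 hΔ hx ha h]
  simp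

theorem sum_valueWeight_lift_of_not_dvd (h : ¬ (p : ℤ) ^ a ∣ cubicForm W x) :
    ∑ b : Fin 3 → ZMod p,
        valueWeight p (a + 1) T (cubicForm W (x + (p : ℤ) ^ a • liftVec b)) =
      p ^ 3 * T ^ 7 * valueWeight p a T (cubicForm W x) := by
  have hweight (b : Fin 3 → ZMod p) :=
    valueWeight_succ_of_not_dvd (T := T) h (dvd_cubicForm_add_smul_sub W x (liftVec b) _)
  simp only [hweight]
  simp [mul_assoc]

theorem valueSum_succ (h6 : W.a₆ = 0) (hΔ : ¬ (p : ℤ) ∣ W.Δ) (ha : a ≠ 0) :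
    valueSum W p (a + 1) T = p ^ 3 * T ^ 7 * valueSum W p a T +
      p ^ 2 * (T ^ 5 - T ^ 7) * T ^ (5 * a) * zeroCount W p a := by
  classical
  rw [valueSum, sum_primitiveVecs_succ ha fun x => valueWeight p (a + 1) T (cubicForm W x),
    valueSum, zeroCount, Finset.card_filter, Nat.cast_sum, Finset.mul_sum, Finset.mul_sum,
    ← Finset.sum_add_distrib]
  refine Finset.sum_congr rfl fun v hv => ?_
  split_ifs with h
  · rw [sum_valueWeight_lift h6 hΔ (mem_primitiveVecs.1 hv) ha h, valueWeight_of_dvd h]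
    push_cast
    ring
  · rw [sum_valueWeight_lift_of_not_dvd h]
    simp

theorem valueSum_one :
    valueSum W p 1 T = (p ^ 3 - 1) * T ^ 7 + zeroCount W p 1 * (T ^ 5 - T ^ 7) := by
  classical
  have hcard : ((primitiveVecs (Fin 3) p 1).card : R) = p ^ 3 - 1 := by
    rw [eq_sub_iff_add_eq]
    exact_mod_cast congrArg (Nat.cast (R := R)) (card_primitiveVecs_one (ι := Fin 3) (p := p))
  have hweight (v : Fin 3 → ZMod (p ^ 1)) := valueWeight_succ_of_dvd (p := p) (a := 0) (T := T)
    (d := cubicForm W (liftVec v)) (by simp)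
  rw [valueSum, zeroCount]
  simp only [zero_add, mul_zero, pow_zero, one_mul] at hweight
  rw [Finset.sum_congr rfl fun v _ => hweight v, Finset.sum_add_distrib, ← Finset.sum_filter,
    Finset.sum_const, Finset.sum_const, nsmul_eq_mul, nsmul_eq_mul, hcard]

end Hensel

/-! ### Points over the prime field -/

theorem card_nonzero_cubicForm_eq_zero {F : Type*} [Field F] [Finite F] {W : WeierstrassCurve F}
    (h6 : W.a₆ = 0) : Nat.card {v : Fin 3 → F // v ≠ 0 ∧ cubicForm W v = 0} =
      (curvePoints W).ncard * (Nat.card F - 1) := by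
  let e := Projectivization.nonZeroEquivProjectivizationProdUnits F (Fin 3 → F)
  have he (v : {v : Fin 3 → F // v ≠ 0}) :
      cubicForm W v.1 = 0 ↔ e v ∈ curvePoints W ×ˢ (Set.univ : Set Fˣ) := by
    have hmk : (e v).1 = Projectivization.mk F v.1 v.2 := rfl
    obtain ⟨c, hc⟩ := Projectivization.exists_smul_eq_mk_rep F v.1 v.2
    rw [Set.mem_prod, hmk, curvePoints, Set.mem_ofPred, ← hc, ← equation_iff_cubicForm_eq_zero h6]
    simp [WeierstrassCurve.Projective.equation_smul, Units.smul_def]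
  calc Nat.card {v : Fin 3 → F // v ≠ 0 ∧ cubicForm W v = 0}
      = Nat.card (curvePoints W ×ˢ (Set.univ : Set Fˣ) : Set (ℙ F (Fin 3 → F) × Fˣ)) :=
        Nat.card_congr ((Equiv.subtypeSubtypeEquivSubtypeInter _ _).symm.trans
          (e.subtypeEquiv he))
    _ = (curvePoints W).ncard * (Nat.card F - 1) := by
        rw [Nat.card_coe_set_eq, Set.ncard_prod, Set.ncard_univ, Nat.card_units]

theorem zeroCount_one {W : WeierstrassCurve ℤ} {p : ℕ} [Fact p.Prime] (h6 : W.a₆ = 0) :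
    zeroCount W p 1 = (redCurve p W).ncard * (p - 1) := by
  classical
  have h := card_nonzero_cubicForm_eq_zero (W := W.map (Int.castRingHom (ZMod p))) (by simp [h6])
  rw [Nat.card_zmod] at h
  rw [redCurve, ← h, zeroCount, Finset.card_filter,
    sum_primitiveVecs_one fun x => if (p : ℤ) ^ 1 ∣ cubicForm W x then 1 else 0,
    ← Finset.card_filter, Finset.filter_filter, Nat.card_eq_fintype_card, Fintype.card_subtype]
  simp only [pow_one, dvd_cubicForm_iff, intCast_comp_liftVec]

/-! ### Sums over lattices by level and residue index -/

theorem residueIndex_top {A : Type*} [AddCommGroup A] (p : ℕ) :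
    residueIndex p (⊤ : AddSubgroup A) = 1 := by
  rw [residueIndex, top_sup_eq, AddSubgroup.index_top]

section LevelSums

variable {A : Type*} [AddCommGroup A] [Module.Free ℤ A] [Module.Finite ℤ A]

variable (A) in
/-- The lattices of level `n` in `A`. -/
noncomputable def levelFinset (p : ℕ) [Fact p.Prime] (n : ℕ) : Finset (AddSubgroup A) :=
  (finite_setOf_isLevel p n).toFinset

open Classical in
variable (A) in
/-- The lattices of level `n` and residue index `p ^ k` in `A`. -/
noncomputable def levelResidueFinset (p : ℕ) [Fact p.Prime] (n k : ℕ) : Finset (AddSubgroup A) :=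
  {Λ ∈ levelFinset A p n | residueIndex p Λ = p ^ k}

variable {p : ℕ} [hp : Fact p.Prime] {n k : ℕ} {Λ Φ : AddSubgroup A}

theorem mem_levelFinset : Λ ∈ levelFinset A p n ↔ IsLevel p n Λ :=
  (finite_setOf_isLevel p n).mem_toFinset

theorem mem_levelResidueFinset :
    Λ ∈ levelResidueFinset A p n k ↔ IsLevel p n Λ ∧ residueIndex p Λ = p ^ k := by
  rw [levelResidueFinset, Finset.mem_filter, mem_levelFinset]

theorem mem_levelResidueFinset_succ (hk : k ≠ 0) :
    Φ ∈ levelResidueFinset A p (n + 1) k ↔ IsLevel p n (pDiv p Φ) ∧ residueIndex p Φ = p ^ k := by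
  rw [mem_levelResidueFinset]
  refine and_congr_left fun h => ⟨And.left, fun hΦ => ⟨hΦ, ?_⟩⟩
  rintro rfl
  exact (Nat.one_lt_pow hk hp.out.one_lt).ne ((residueIndex_top p).symm.trans h)

theorem levelFinset_zero : levelFinset A p 0 = {⊤} := by
  ext Λ
  rw [mem_levelFinset, Finset.mem_singleton, IsLevel]

theorem levelResidueFinset_zero_zero : levelResidueFinset A p 0 0 = {⊤} := by
  rw [levelResidueFinset, levelFinset_zero, Finset.filter_true_of_mem]
  simp [residueIndex_top]

theorem levelResidueFinset_zero_of_ne (hk : k ≠ 0) : levelResidueFinset A p 0 k = ∅ := by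
  rw [levelResidueFinset, levelFinset_zero, Finset.filter_false_of_mem]
  simpa [residueIndex_top] using (Nat.one_lt_pow hk hp.out.one_lt).ne

theorem levelResidueFinset_succ_zero : levelResidueFinset A p (n + 1) 0 = ∅ := by
  refine Finset.eq_empty_of_forall_notMem fun Λ hΛ => ?_
  obtain ⟨hlevel, hres⟩ := mem_levelResidueFinset.1 hΛ
  exact hlevel.2 (eq_top_of_residueIndex_eq_one hlevel.hasPIndex (hres.trans (pow_zero p)))

section Sums

variable {R : Type*} [CommRing R]

theorem sum_levelFinset_mul (c : ℕ → R) (f : AddSubgroup A → R) :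
    ∑ Λ ∈ levelFinset A p n, c (residueIndex p Λ) * f Λ =
      ∑ k ∈ Finset.range (Module.finrank ℤ A + 1),
        c (p ^ k) * ∑ Λ ∈ levelResidueFinset A p n k, f Λ := by
  classical
  simp only [levelResidueFinset, Finset.sum_filter, Finset.mul_sum]
  rw [Finset.sum_comm]
  refine Finset.sum_congr rfl fun Λ _ => ?_
  obtain ⟨k, hk, h⟩ := exists_residueIndex_eq_pow p Λ
  rw [h, Finset.sum_eq_single_of_mem k (Finset.mem_range.2 (Nat.lt_succ_of_le hk)), if_pos rfl]
  intro l _ hl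
  rw [if_neg fun he => hl (Nat.pow_right_injective hp.out.two_le he).symm, mul_zero]

theorem sum_levelResidueFinset_succ_finrank [Nontrivial A] (f : AddSubgroup A → R) :
    ∑ Φ ∈ levelResidueFinset A p (n + 1) (Module.finrank ℤ A), f (pDiv p Φ) =
      ∑ Λ ∈ levelFinset A p n, f Λ := by
  have : IsAddTorsionFree A := .of_isTorsionFree ℤ A
  have hmem (Φ : AddSubgroup A) : Φ ∈ levelResidueFinset A p (n + 1) (Module.finrank ℤ A) ↔
      IsLevel p n (pDiv p Φ) ∧ Φ ≤ pMul p ⊤ := by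
    rw [mem_levelResidueFinset_succ Module.finrank_pos.ne', le_pMul_top_iff]
  refine Finset.sum_bij' (fun Φ _ => pDiv p Φ) (fun Λ _ => pMul p Λ) ?_ ?_ ?_ ?_ fun _ _ => rfl
  · exact fun Φ hΦ => mem_levelFinset.2 ((hmem Φ).1 hΦ).1
  · intro Λ hΛ
    rw [hmem, pDiv_pMul hp.out.ne_zero]
    exact ⟨mem_levelFinset.1 hΛ, pMul_mono le_top⟩
  · exact fun Φ hΦ => (pMul_pDiv p Φ).trans (inf_eq_left.2 ((hmem Φ).1 hΦ).2)
  · exact fun Λ _ => pDiv_pMul hp.out.ne_zero Λ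

theorem card_filter_pDiv_eq_mul (hk : k ≠ 0) (hA : Module.finrank ℤ A = k + 1)
    (hΛ : IsLevel p n Λ) [DecidablePred fun Φ : AddSubgroup A => pDiv p Φ = Λ] :
    ({Φ ∈ levelResidueFinset A p (n + 1) k | pDiv p Φ = Λ}.card : R) * (p - 1) =
      p ^ (k + 1) - residueIndex p Λ := by
  have hset : {Φ : AddSubgroup A | pDiv p Φ = Λ ∧ residueIndex p Φ = p ^ k} =
      ({Φ ∈ levelResidueFinset A p (n + 1) k | pDiv p Φ = Λ} : Finset _) := by
    ext Φ
    rw [Finset.mem_coe, Finset.mem_filter, mem_levelResidueFinset_succ hk, Set.mem_ofPred]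
    exact ⟨fun h => ⟨⟨h.1 ▸ hΛ, h.2⟩, h.1⟩, fun h => ⟨h.2, h.1.2⟩⟩
  have hcard := ncard_setOf_pDiv_eq_mul hA hΛ.hasPIndex
  rw [hset, Set.ncard_coe_finset] at hcard
  have hle : residueIndex p Λ ≤ p ^ (k + 1) := by
    obtain ⟨j, hj, h⟩ := exists_residueIndex_eq_pow p Λ
    exact h ▸ Nat.pow_le_pow_right hp.out.pos (hA ▸ hj)
  simpa [Nat.cast_sub hp.out.one_le, Nat.cast_sub hle] using congrArg (Nat.cast (R := R)) hcard

theorem sum_levelResidueFinset_succ_mul (hk : k ≠ 0) (hA : Module.finrank ℤ A = k + 1)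
    (f : AddSubgroup A → R) :
    (p - 1) * ∑ Φ ∈ levelResidueFinset A p (n + 1) k, f (pDiv p Φ) =
      ∑ Λ ∈ levelFinset A p n, (p ^ (k + 1) - (residueIndex p Λ : R)) * f Λ := by
  classical
  have hmaps : ∀ Φ ∈ levelResidueFinset A p (n + 1) k, pDiv p Φ ∈ levelFinset A p n :=
    fun Φ hΦ => mem_levelFinset.2 ((mem_levelResidueFinset_succ hk).1 hΦ).1
  rw [← Finset.sum_fiberwise_of_maps_to hmaps, Finset.mul_sum]
  refine Finset.sum_congr rfl fun Λ hΛ => ?_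
  rw [Finset.sum_congr rfl fun Φ hΦ => congrArg f (Finset.mem_filter.1 hΦ).2, Finset.sum_const,
    nsmul_eq_mul, ← card_filter_pDiv_eq_mul hk hA (mem_levelFinset.1 hΛ), ← mul_assoc, mul_comm _
    ((p : R) - 1)]

end Sums

end LevelSums

/-! ### Lattices with cyclic quotient and primitive vectors -/

section CyclicQuotient

variable {ι : Type*} {p a : ℕ} [hp : Fact p.Prime]

theorem isPrimitiveMod_iff_exists_isUnit (ha : a ≠ 0) {x : ι → ℤ} :
    IsPrimitiveMod p x ↔ ∃ i, IsUnit ((Int.castRingHom (ZMod (p ^ a)) ∘ x) i) := by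
  refine exists_congr fun i => ⟨fun h => isUnit_intCast_of_not_dvd h a, fun h hdvd => ?_⟩
  have h1 : IsUnit ((x i : ℤ) : ZMod p) := by
    simpa using h.map (ZMod.castHom (dvd_pow_self p ha) (ZMod p))
  rw [(ZMod.intCast_zmod_eq_zero_iff_dvd _ _).2 hdvd] at h1
  exact not_isUnit_zero h1

theorem card_filter_congruenceLattice_eq [Fintype ι] [DecidableEq ι] (ha : a ≠ 0) {x : ι → ℤ}
    (hx : IsPrimitiveMod p x) [DecidablePred fun v : ι → ZMod (p ^ a) =>
      congruenceLattice (p ^ a) (liftVec v) = congruenceLattice (p ^ a) x] :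
    {v ∈ primitiveVecs ι p a | congruenceLattice (p ^ a) (liftVec v) =
      congruenceLattice (p ^ a) x}.card = Nat.totient (p ^ a) := by
  set y := Int.castRingHom (ZMod (p ^ a)) ∘ x
  obtain ⟨i, hi⟩ := (isPrimitiveMod_iff_exists_isUnit ha).1 hx
  rw [← ZMod.card_units_eq_totient, ← Finset.card_univ, eq_comm]
  refine Finset.card_bij (fun c _ => c • y) (fun c _ => ?_) (fun c _ d _ h => ?_) fun v hv => ?_
  · have hprim : IsPrimitiveMod p (liftVec (c • y)) := by
      rw [isPrimitiveMod_iff_exists_isUnit ha, intCast_comp_liftVec]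
      exact ⟨i, c.isUnit.mul hi⟩
    rw [Finset.mem_filter, mem_primitiveVecs, eq_comm, congruenceLattice_eq_iff hx hprim,
      intCast_comp_liftVec]
    exact ⟨hprim, c, rfl⟩
  · exact Units.ext (hi.mul_right_cancel (congrFun h i))
  · rw [Finset.mem_filter, mem_primitiveVecs] at hv
    obtain ⟨c, hc⟩ := (congruenceLattice_eq_iff hx hv.1 a).1 hv.2.symm
    rw [intCast_comp_liftVec] at hc
    exact ⟨c, Finset.mem_univ c, hc.symm⟩

end CyclicQuotient

/-! ### Summation over all lattices -/

theorem hasSum_of_linear_recursion {x y : ℕ → ℂ} {l Y : ℂ} (hl : ‖l‖ < 1) (hy : HasSum y Y)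
    (h : ∀ n, x (n + 1) = l * x n + y n) : HasSum x ((x 0 + Y) / (1 - l)) := by
  let z : ℕ → ℂ := fun n => Nat.casesOn n (x 0) y
  have hz : HasSum z (x 0 + Y) := by
    simpa [z, add_comm] using (hasSum_nat_add_iff (f := z) (g := Y) 1).1 hy
  have hx (n : ℕ) : x n = ∑ kl ∈ Finset.HasAntidiagonal.antidiagonal n, l ^ kl.1 * z kl.2 := by
    induction n with
    | zero => simp [z]
    | succ n ih =>
      rw [Finset.Nat.sum_antidiagonal_succ, h, ih, Finset.mul_sum, add_comm, pow_zero, one_mul]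
      refine congrArg _ (Finset.sum_congr rfl fun kl _ => ?_)
      rw [pow_succ', mul_assoc]
  have hgeom := hasSum_geometric_of_norm_lt_one hl
  have hprod := (summable_norm_sum_mul_antidiagonal_of_summable_norm hgeom.summable.norm
    hz.summable.norm).of_norm.hasSum
  rw [← tsum_mul_tsum_eq_tsum_sum_antidiagonal_of_summable_norm hgeom.summable.norm
    hz.summable.norm, hgeom.tsum_eq, hz.tsum_eq, ← div_eq_inv_mul] at hprod
  exact hprod.congr_fun hx

section Convergence

variable {p : ℕ} [hp : Fact p.Prime] {T : ℂ} {m k : ℕ}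

theorem norm_pow_mul_pow_lt_one (hT : ‖T‖ < ((p : ℝ) ^ 9)⁻¹) (hk : k ≠ 0) (h : m ≤ 9 * k) :
    ‖(p : ℂ) ^ m * T ^ k‖ < 1 := by
  have hone : (1 : ℝ) ≤ p := by exact_mod_cast hp.out.one_le
  have hlt : (p : ℝ) ^ 9 * ‖T‖ < 1 :=
    (lt_inv_mul_iff₀ (by positivity)).1 (by rwa [mul_one])
  rw [norm_mul, norm_pow, norm_pow, Complex.norm_natCast]
  calc (p : ℝ) ^ m * ‖T‖ ^ k ≤ (p : ℝ) ^ (9 * k) * ‖T‖ ^ k := by gcongr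
    _ = ((p : ℝ) ^ 9 * ‖T‖) ^ k := by rw [pow_mul, mul_pow]
    _ < 1 := pow_lt_one₀ (by positivity) hlt hk

theorem one_sub_pow_mul_pow_ne_zero (hT : ‖T‖ < ((p : ℝ) ^ 9)⁻¹) (hk : k ≠ 0) (h : m ≤ 9 * k) :
    1 - (p : ℂ) ^ m * T ^ k ≠ 0 := by
  intro h0
  have hlt := norm_pow_mul_pow_lt_one hT hk h
  rw [← sub_eq_zero.1 h0, norm_one] at hlt
  exact hlt.false

end Convergence

section LatticeSums

variable (W : WeierstrassCurve ℤ) (p : ℕ) [hp : Fact p.Prime] (T : ℂ)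

/-- The contribution of the lattice `Λ` to the zeta function: `Λ.index ^ 6` lattices in
`ℤ³ × ℤ³ × ℤ³` have a given image in `ℤ³ × ℤ³` and meet the last factor in `Λ`. -/
noncomputable def latticeTerm (Λ : AddSubgroup (Fin 3 → ℤ)) : ℂ :=
  (Λ.index : ℂ) ^ 6 * T ^ (indexExp p Λ + indexExp p (annihilator (cubicPairing W) Λ))

/-- The contribution of the lattices of level `n` and residue index `p ^ k`. -/
noncomputable def partSum (n k : ℕ) : ℂ :=
  ∑ Λ ∈ levelResidueFinset (Fin 3 → ℤ) p n k, latticeTerm W p T Λ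

variable {W p T}

theorem partSum_zero_zero : partSum W p T 0 0 = 1 := by
  have htop : annihilator (cubicPairing W) ⊤ = ⊤ :=
    top_unique fun _ _ => mem_annihilator.2 ⟨fun _ => trivial, fun _ => trivial⟩
  rw [partSum, levelResidueFinset_zero_zero, Finset.sum_singleton, latticeTerm, htop, indexExp_top,
    indexExp_top, AddSubgroup.index_top, Nat.cast_one, one_pow, pow_zero, one_mul]

theorem partSum_zero_of_ne {k : ℕ} (hk : k ≠ 0) : partSum W p T 0 k = 0 := by
  rw [partSum, levelResidueFinset_zero_of_ne hk, Finset.sum_empty]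

theorem partSum_succ_zero (n : ℕ) : partSum W p T (n + 1) 0 = 0 := by
  rw [partSum, levelResidueFinset_succ_zero, Finset.sum_empty]

theorem sum_levelFinset_mul_latticeTerm (c : ℕ → ℂ) (n : ℕ) :
    ∑ Λ ∈ levelFinset (Fin 3 → ℤ) p n, c (residueIndex p Λ) * latticeTerm W p T Λ =
      ∑ k ∈ Finset.range 4, c (p ^ k) * partSum W p T n k := by
  rw [sum_levelFinset_mul, Module.finrank_fin_fun]
  rfl

theorem sum_latticeTerm (n : ℕ) : ∑ Λ ∈ levelFinset (Fin 3 → ℤ) p n, latticeTerm W p T Λ =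
    ∑ k ∈ Finset.range 4, partSum W p T n k := by
  simpa using sum_levelFinset_mul_latticeTerm (W := W) (p := p) (T := T) (fun _ => 1) n

theorem latticeTerm_of_residueIndex {k : ℕ} (hk : 2 ≤ k) {Φ : AddSubgroup (Fin 3 → ℤ)}
    (hΦ : HasPIndex p Φ) (h : residueIndex p Φ = p ^ k) :
    latticeTerm W p T Φ = (p : ℂ) ^ (6 * k) * T ^ (k + 6) * latticeTerm W p T (pDiv p Φ) := by
  rw [latticeTerm, latticeTerm, indexExp_of_residueIndex hΦ.pDiv h,
    indexExp_annihilator_cubicPairing hk h hΦ, index_eq_residueIndex_mul p Φ, h]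
  push_cast
  ring

theorem partSum_succ_eq_mul_sum {k : ℕ} (hk : 2 ≤ k) (n : ℕ) : partSum W p T (n + 1) k =
    (p : ℂ) ^ (6 * k) * T ^ (k + 6) *
      ∑ Φ ∈ levelResidueFinset (Fin 3 → ℤ) p (n + 1) k, latticeTerm W p T (pDiv p Φ) := by
  rw [partSum, Finset.mul_sum]
  refine Finset.sum_congr rfl fun Φ hΦ => ?_
  obtain ⟨hlevel, hres⟩ := mem_levelResidueFinset.1 hΦ
  exact latticeTerm_of_residueIndex hk hlevel.hasPIndex hres

theorem partSum_succ_three (n : ℕ) : partSum W p T (n + 1) 3 =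
    (p : ℂ) ^ 18 * T ^ 9 * ∑ k ∈ Finset.range 4, partSum W p T n k := by
  rw [partSum_succ_eq_mul_sum (by norm_num), ← sum_latticeTerm,
    ← sum_levelResidueFinset_succ_finrank, Module.finrank_fin_fun]

theorem partSum_succ_two (n : ℕ) : partSum W p T (n + 1) 2 = (p : ℂ) ^ 12 * T ^ 8 *
    ((p ^ 2 + p + 1) * partSum W p T n 0 + (p ^ 2 + p) * partSum W p T n 1 +
      p ^ 2 * partSum W p T n 2) := by
  have hp1 : (p : ℂ) - 1 ≠ 0 := sub_ne_zero.2 (by exact_mod_cast hp.out.ne_one)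
  have hsum := sum_levelResidueFinset_succ_mul (n := n) (p := p) two_ne_zero
    (Module.finrank_fin_fun ℤ) (latticeTerm W p T)
  rw [sum_levelFinset_mul_latticeTerm fun r => (p : ℂ) ^ (2 + 1) - r] at hsum
  apply mul_left_cancel₀ hp1
  rw [partSum_succ_eq_mul_sum le_rfl, mul_left_comm, hsum]
  simp only [Finset.sum_range_succ, Finset.sum_range_zero]
  push_cast
  ring

theorem totient_mul_partSum_one (h6 : W.a₆ = 0) (hΔ : ¬ (p : ℤ) ∣ W.Δ) (a : ℕ) :
    (Nat.totient (p ^ (a + 1)) : ℂ) * partSum W p T (a + 1) 1 =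
      (p : ℂ) ^ (6 * (a + 1)) * valueSum W p (a + 1) T := by
  classical
  have hmaps : ∀ v ∈ primitiveVecs (Fin 3) p (a + 1), congruenceLattice (p ^ (a + 1)) (liftVec v) ∈
      levelResidueFinset (Fin 3 → ℤ) p (a + 1) 1 := by
    intro v hv
    rw [mem_primitiveVecs] at hv
    rw [mem_levelResidueFinset, pow_one]
    exact ⟨isLevel_congruenceLattice hv _, residueIndex_congruenceLattice hv a⟩
  rw [valueSum, ← Finset.sum_fiberwise_of_maps_to hmaps, partSum, Finset.mul_sum, Finset.mul_sum]
  refine Finset.sum_congr rfl fun Φ hΦ => ?_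
  rw [mem_levelResidueFinset, pow_one] at hΦ
  obtain ⟨x, hx, rfl⟩ := exists_eq_congruenceLattice hΦ.1 hΦ.2
  have hweight (v) (hv : v ∈ {v ∈ primitiveVecs (Fin 3) p (a + 1) |
      congruenceLattice (p ^ (a + 1)) (liftVec v) = congruenceLattice (p ^ (a + 1)) x}) :
      valueWeight p (a + 1) T (cubicForm W (liftVec v)) = T ^ (a + 1 +
        indexExp p (annihilator (cubicPairing W) (congruenceLattice (p ^ (a + 1)) x))) := by
    rw [Finset.mem_filter, mem_primitiveVecs] at hv
    have hexp := indexExp_annihilator_congruenceLattice h6 hΔ hv.1 (a + 1)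
    rw [hv.2] at hexp
    rw [valueWeight]
    congr 1
    lia
  rw [Finset.sum_congr rfl hweight, Finset.sum_const, nsmul_eq_mul,
    card_filter_congruenceLattice_eq a.succ_ne_zero hx, latticeTerm,
    indexExp_eq (index_congruenceLattice hx (a + 1)), index_congruenceLattice hx]
  push_cast
  ring

end LatticeSums

section LatticeGF

/-- The contribution of the lattices with nontrivial cyclic quotient, where `P = p` and `N` is the
number of points of the reduced curve. -/
noncomputable def cyclicSum (P N T : ℂ) : ℂ :=
  (P ^ 6 * ((P ^ 2 + P + 1) * T ^ 7 + N * (T ^ 5 - T ^ 7)) +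
    P ^ 7 * (T ^ 5 - T ^ 7) * (P ^ 6 * T ^ 5 * N / (1 - P ^ 7 * T ^ 5))) / (1 - P ^ 8 * T ^ 7)

/-- The contribution of the lattices whose reduction is a line, with `P` and `N` as in
`cyclicSum`. -/
noncomputable def lineSum (P N T : ℂ) : ℂ :=
  P ^ 12 * T ^ 8 * (P ^ 2 + P + 1 + (P ^ 2 + P) * cyclicSum P N T) / (1 - P ^ 14 * T ^ 8)

/-- The contribution of all lattices, with `P` and `N` as in `cyclicSum`. -/
noncomputable def latticeSum (P N T : ℂ) : ℂ :=
  (1 + cyclicSum P N T + lineSum P N T) / (1 - P ^ 18 * T ^ 9)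

variable {W : WeierstrassCurve ℤ} {p : ℕ} [hp : Fact p.Prime] {T : ℂ}

theorem hasSum_partSum_zero : HasSum (fun n => partSum W p T n 0) 1 := by
  rw [← partSum_zero_zero (W := W) (p := p) (T := T)]
  refine hasSum_single 0 fun n hn => ?_
  obtain ⟨m, rfl⟩ := Nat.exists_eq_succ_of_ne_zero hn
  exact partSum_succ_zero m

/-- The contribution to `partSum W p T n 1` of the zeros of the cubic modulo `p ^ n`. -/
noncomputable def zeroTerm (W : WeierstrassCurve ℤ) (p : ℕ) [Fact p.Prime] (T : ℂ) (n : ℕ) : ℂ :=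
  (p : ℂ) ^ (6 * n) * T ^ (5 * n) * zeroCount W p n / Nat.totient (p ^ n)

theorem totient_prime_pow_succ_cast (n : ℕ) :
    (Nat.totient (p ^ (n + 1)) : ℂ) = (p : ℂ) ^ n * (p - 1) := by
  rw [Nat.totient_prime_pow_succ hp.out, Nat.cast_mul, Nat.cast_pow,
    Nat.cast_sub hp.out.one_le, Nat.cast_one]

theorem zeroTerm_one (h6 : W.a₆ = 0) :
    zeroTerm W p T 1 = p ^ 6 * T ^ 5 * (redCurve p W).ncard := by
  have hp1 : (p : ℂ) - 1 ≠ 0 := sub_ne_zero.2 (by exact_mod_cast hp.out.ne_one)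
  rw [zeroTerm, totient_prime_pow_succ_cast 0, zeroCount_one h6, Nat.cast_mul,
    Nat.cast_sub hp.out.one_le]
  field_simp
  push_cast
  ring

theorem zeroTerm_succ (h6 : W.a₆ = 0) (hΔ : ¬ (p : ℤ) ∣ W.Δ) (n : ℕ) :
    zeroTerm W p T (n + 2) = p ^ 7 * T ^ 5 * zeroTerm W p T (n + 1) := by
  have hp0 : (p : ℂ) ≠ 0 := by exact_mod_cast hp.out.ne_zero
  have hp1 : (p : ℂ) - 1 ≠ 0 := sub_ne_zero.2 (by exact_mod_cast hp.out.ne_one)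
  rw [zeroTerm, zeroTerm, totient_prime_pow_succ_cast, totient_prime_pow_succ_cast,
    zeroCount_succ h6 hΔ n.succ_ne_zero]
  push_cast
  field_simp
  ring

theorem partSum_succ_one (h6 : W.a₆ = 0) (hΔ : ¬ (p : ℤ) ∣ W.Δ) (n : ℕ) :
    partSum W p T (n + 1) 1 =
      (p : ℂ) ^ (6 * (n + 1)) * valueSum W p (n + 1) T / Nat.totient (p ^ (n + 1)) := by
  rw [← totient_mul_partSum_one h6 hΔ, mul_div_cancel_left₀]
  exact_mod_cast (Nat.totient_pos.2 (pow_pos hp.out.pos _)).ne'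

theorem partSum_one_one (h6 : W.a₆ = 0) (hΔ : ¬ (p : ℤ) ∣ W.Δ) : partSum W p T 1 1 =
    p ^ 6 * ((p ^ 2 + p + 1) * T ^ 7 + (redCurve p W).ncard * (T ^ 5 - T ^ 7)) := by
  have hp1 : (p : ℂ) - 1 ≠ 0 := sub_ne_zero.2 (by exact_mod_cast hp.out.ne_one)
  rw [partSum_succ_one h6 hΔ, totient_prime_pow_succ_cast, valueSum_one, zeroCount_one h6,
    Nat.cast_mul, Nat.cast_sub hp.out.one_le]
  field_simp
  push_cast
  ring

theorem partSum_add_two_one (h6 : W.a₆ = 0) (hΔ : ¬ (p : ℤ) ∣ W.Δ) (n : ℕ) :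
    partSum W p T (n + 2) 1 =
      p ^ 8 * T ^ 7 * partSum W p T (n + 1) 1 +
        p ^ 7 * (T ^ 5 - T ^ 7) * zeroTerm W p T (n + 1) := by
  have hp0 : (p : ℂ) ≠ 0 := by exact_mod_cast hp.out.ne_zero
  have hp1 : (p : ℂ) - 1 ≠ 0 := sub_ne_zero.2 (by exact_mod_cast hp.out.ne_one)
  rw [partSum_succ_one h6 hΔ, partSum_succ_one h6 hΔ, valueSum_succ h6 hΔ n.succ_ne_zero, zeroTerm,
    totient_prime_pow_succ_cast, totient_prime_pow_succ_cast]
  field_simp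
  ring

theorem hasSum_partSum_one (h6 : W.a₆ = 0) (hΔ : ¬ (p : ℤ) ∣ W.Δ) (hT : ‖T‖ < ((p : ℝ) ^ 9)⁻¹) :
    HasSum (fun n => partSum W p T n 1) (cyclicSum p (redCurve p W).ncard T) := by
  have hzero := hasSum_of_linear_recursion (x := fun n => zeroTerm W p T (n + 1))
    (norm_pow_mul_pow_lt_one hT (m := 7) (k := 5) (by norm_num) (by norm_num)) hasSum_zero
    fun n => (zeroTerm_succ h6 hΔ n).trans (add_zero _).symm
  rw [zeroTerm_one h6, add_zero] at hzero
  have hpos := hasSum_of_linear_recursion (x := fun n => partSum W p T (n + 1) 1)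
    (norm_pow_mul_pow_lt_one hT (m := 8) (k := 7) (by norm_num) (by norm_num))
    (hzero.mul_left _) (partSum_add_two_one h6 hΔ)
  rw [partSum_one_one h6 hΔ] at hpos
  simpa [partSum_zero_of_ne, cyclicSum] using
    (hasSum_nat_add_iff (f := fun n => partSum W p T n 1) 1).1 hpos

theorem hasSum_partSum_two (h6 : W.a₆ = 0) (hΔ : ¬ (p : ℤ) ∣ W.Δ) (hT : ‖T‖ < ((p : ℝ) ^ 9)⁻¹) :
    HasSum (fun n => partSum W p T n 2) (lineSum p (redCurve p W).ncard T) := by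
  have hrec := hasSum_of_linear_recursion (x := fun n => partSum W p T n 2)
    (norm_pow_mul_pow_lt_one hT (m := 14) (k := 8) (by norm_num) (by norm_num))
    ((((hasSum_partSum_zero (W := W) (p := p) (T := T)).mul_left ((p : ℂ) ^ 2 + p + 1)).add
      ((hasSum_partSum_one h6 hΔ hT).mul_left ((p : ℂ) ^ 2 + p))).mul_left ((p : ℂ) ^ 12 * T ^ 8))
    fun n => by
      rw [partSum_succ_two]
      ring
  rwa [partSum_zero_of_ne two_ne_zero, zero_add, mul_one] at hrec

theorem hasSum_sum_latticeTerm (h6 : W.a₆ = 0) (hΔ : ¬ (p : ℤ) ∣ W.Δ)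
    (hT : ‖T‖ < ((p : ℝ) ^ 9)⁻¹) :
    HasSum (fun n => ∑ Λ ∈ levelFinset (Fin 3 → ℤ) p n, latticeTerm W p T Λ)
      (latticeSum p (redCurve p W).ncard T) := by
  have hlow := ((hasSum_partSum_zero (W := W) (p := p) (T := T)).add
    (hasSum_partSum_one h6 hΔ hT)).add (hasSum_partSum_two h6 hΔ hT)
  have hthree := hasSum_of_linear_recursion (x := fun n => partSum W p T n 3)
    (norm_pow_mul_pow_lt_one hT (m := 18) (k := 9) (by norm_num) (by norm_num))
    (hlow.mul_left ((p : ℂ) ^ 18 * T ^ 9)) fun n => by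
      simp only [partSum_succ_three, Finset.sum_range_succ, Finset.sum_range_zero]
      ring
  have hne := one_sub_pow_mul_pow_ne_zero hT (m := 18) (k := 9) (by norm_num) (by norm_num)
  convert hlow.add hthree using 1
  · ext n
    simp only [sum_latticeTerm, Finset.sum_range_succ, Finset.sum_range_zero, zero_add]
  · rw [partSum_zero_of_ne three_ne_zero, latticeSum]
    field_simp
    ring

/-- A lattice of `p`-power index together with its level. -/
noncomputable def levelSigmaEquiv (A : Type*) [AddCommGroup A] [Module.Free ℤ A]
    [Module.Finite ℤ A] (p : ℕ) [Fact p.Prime] :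
    (Σ n : ℕ, {Λ // Λ ∈ levelFinset A p n}) ≃ {Λ : AddSubgroup A // HasPIndex p Λ} :=
  Equiv.ofBijective (fun t => ⟨t.2.1, (mem_levelFinset.1 t.2.2).hasPIndex⟩) <| by
    constructor
    · rintro ⟨n, Λ, hΛ⟩ ⟨m, Λ', hΛ'⟩ h
      obtain rfl : Λ = Λ' := congrArg Subtype.val h
      obtain rfl := (mem_levelFinset.1 hΛ).unique (mem_levelFinset.1 hΛ')
      rfl
    · rintro ⟨Λ, hΛ⟩
      obtain ⟨n, hn⟩ := IsLevel.exists_of_hasPIndex hΛ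
      exact ⟨⟨n, Λ, mem_levelFinset.2 hn⟩, rfl⟩

theorem hasGF_latticeTerm (h6 : W.a₆ = 0) (hΔ : ¬ (p : ℤ) ∣ W.Δ) :
    HasGF ((p : ℝ) ^ 9)⁻¹ (fun Λ : {Λ : AddSubgroup (Fin 3 → ℤ) // HasPIndex p Λ} => Λ.1.index ^ 6)
      (fun Λ => indexExp p Λ.1 + indexExp p (annihilator (cubicPairing W) Λ.1))
      (fun T => latticeSum p (redCurve p W).ncard T) := by
  have hlevels : HasGF ((p : ℝ) ^ 9)⁻¹
      (fun t : Σ n : ℕ, {Λ // Λ ∈ levelFinset (Fin 3 → ℤ) p n} => t.2.1.index ^ 6)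
      (fun t => indexExp p t.2.1 + indexExp p (annihilator (cubicPairing W) t.2.1))
      (fun T => latticeSum p (redCurve p W).ncard T) := by
    refine HasGF.sigma (g := fun n T => ∑ Λ ∈ levelFinset (Fin 3 → ℤ) p n, latticeTerm W p T Λ)
      (fun n T _ => ?_) (fun T hT => hasSum_sum_latticeTerm h6 hΔ hT)
    simpa [latticeTerm, Function.comp_def] using
      Finset.hasSum (levelFinset _ p n) (latticeTerm W p T)
  refine (hlevels.equiv (levelSigmaEquiv _ p).symm).congr (fun Λ => ?_) (fun Λ => ?_) fun _ => rfl
  all_goals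
    obtain ⟨t, rfl⟩ := (levelSigmaEquiv _ p).surjective Λ
    rw [Function.comp_apply, Equiv.symm_apply_apply]
    rfl

end LatticeGF

/-! ### The local zeta functions -/

section Zeta

theorem natCast_pow_cpow (p n : ℕ) (s : ℂ) : ((p ^ n : ℕ) : ℂ) ^ s = ((p : ℂ) ^ s) ^ n := by
  induction n with
  | zero => rw [pow_zero, pow_zero, Nat.cast_one, Complex.one_cpow]
  | succ n ih => rw [pow_succ, pow_succ, Nat.cast_mul, Complex.natCast_mul_natCast_cpow, ih]

theorem norm_natCast_cpow_neg_lt {p : ℕ} (hp : 1 < p) {s : ℂ} {n : ℕ} (hs : n < s.re) :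
    ‖(p : ℂ) ^ (-s)‖ < ((p : ℝ) ^ n)⁻¹ := by
  rw [Complex.norm_natCast_cpow_of_pos (zero_lt_one.trans hp), Complex.neg_re,
    ← Real.rpow_natCast, ← Real.rpow_neg p.cast_nonneg]
  exact Real.rpow_lt_rpow_of_exponent_lt (by exact_mod_cast hp) (neg_lt_neg hs)

section Heisenberg

variable {U V Z : Type*} [AddCommGroup U] [AddCommGroup V] [AddCommGroup Z]
variable {B : U →ₗ[ℤ] V →ₗ[ℤ] Z} {p : ℕ} [Fact p.Prime] {r : ℝ} {g : ℂ → ℂ}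

theorem HasGF.hasSum_index_cpow
    (h : HasGF r (fun _ : {I : AddSubgroup ((U × V) × Z) // HasPIndex p I ∧ IsBracketStable B I}
      => 1) (fun I => indexExp p I.1) g) {s : ℂ} (hs : ‖(p : ℂ) ^ (-s)‖ < r) :
    HasSum (fun I : {I : AddSubgroup ((U × V) × Z) // HasPIndex p I ∧ IsBracketStable B I} =>
      (I.1.index : ℂ) ^ (-s)) (g ((p : ℂ) ^ (-s))) :=
  (h _ hs).congr_fun fun I => by
    rw [I.2.1.index_eq, natCast_pow_cpow, Nat.cast_one, one_mul]

theorem HeisenbergLie.hasLieZeta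
    (h : HasGF r (fun _ : {I : AddSubgroup ((U × V) × Z) // HasPIndex p I ∧ IsBracketStable B I}
      => 1) (fun I => indexExp p I.1) g) {s : ℂ} (hs : ‖(p : ℂ) ^ (-s)‖ < r) :
    HasLieZeta p (HeisenbergLie B) s (g ((p : ℂ) ^ (-s))) :=
  ((lieIdealEquiv B p).hasSum_iff.2 (h.hasSum_index_cpow hs)).congr_fun fun _ => rfl

theorem HeisenbergGroup.hasGroupZeta
    (h : HasGF r (fun _ : {I : AddSubgroup ((U × V) × Z) // HasPIndex p I ∧ IsBracketStable B I}
      => 1) (fun I => indexExp p I.1) g) {s : ℂ} (hs : ‖(p : ℂ) ^ (-s)‖ < r) :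
    HasGroupZeta p (HeisenbergGroup B) s (g ((p : ℂ) ^ (-s))) :=
  ((normalSubgroupEquiv B p).hasSum_iff.2 (h.hasSum_index_cpow hs)).congr_fun fun H =>
    congrArg (fun n : ℕ => (n : ℂ) ^ (-s)) (index_toAddSubgroup H.2.1).symm

variable [Module.Free ℤ U] [Module.Finite ℤ U] [Module.Free ℤ V] [Module.Finite ℤ V]

theorem hasGF_isBracketStable (hr : r ≤ ((p : ℝ) ^ Module.finrank ℤ (U × V))⁻¹)
    (hg : HasGF r (fun Λ : {Λ : AddSubgroup Z // HasPIndex p Λ} =>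
      Λ.1.index ^ Module.finrank ℤ (U × V))
      (fun Λ => indexExp p Λ.1 + indexExp p (annihilator B Λ.1)) g) :
    HasGF r (fun _ : {I : AddSubgroup ((U × V) × Z) // HasPIndex p I ∧ IsBracketStable B I} => 1)
      (fun I => indexExp p I.1) fun T =>
        g T * ∏ i ∈ Finset.range (Module.finrank ℤ (U × V)), (1 - (p : ℂ) ^ i * T)⁻¹ :=
  have hfree : HasSubgroupGF p r (U × V) _ := (hasSubgroupGF_of_free p (U × V)).mono hr
  (hfree.hasGF_fibration (annihilator B) (fun _ hΛ => hΛ.annihilator) hg).equiv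
    (Equiv.subtypeEquivRight fun _ => and_congr_right fun _ =>
      isBracketStable_iff_map_le_annihilator)

end Heisenberg

variable {W : WeierstrassCurve ℤ} {p : ℕ} [hp : Fact p.Prime]

/-- The common value of the two local zeta functions, where `P = p`, `N` is the number of points of
the reduced curve and `T = p ^ (-s)`. -/
noncomputable def zetaValue (P N T : ℂ) : ℂ :=
  latticeSum P N T * ∏ i ∈ Finset.range 6, (1 - P ^ i * T)⁻¹

theorem hasGF_cubicPairing (h6 : W.a₆ = 0) (hΔ : ¬ (p : ℤ) ∣ W.Δ) :
    HasGF ((p : ℝ) ^ 9)⁻¹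
      (fun _ : {I : AddSubgroup (((Fin 3 → ℤ) × (Fin 3 → ℤ)) × (Fin 3 → ℤ)) //
        HasPIndex p I ∧ IsBracketStable (cubicPairing W) I} => 1)
      (fun I => indexExp p I.1) (fun T => zetaValue p (redCurve p W).ncard T) := by
  have hrank : Module.finrank ℤ ((Fin 3 → ℤ) × (Fin 3 → ℤ)) = 6 := by
    rw [Module.finrank_prod, Module.finrank_fin_fun]
  have hr : ((p : ℝ) ^ 9)⁻¹ ≤ ((p : ℝ) ^ Module.finrank ℤ ((Fin 3 → ℤ) × (Fin 3 → ℤ)))⁻¹ := by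
    have h1 : (1 : ℝ) ≤ p := by exact_mod_cast hp.out.one_le
    rw [hrank]
    gcongr
    norm_num
  have hg := hasGF_latticeTerm h6 hΔ
  rw [← hrank] at hg
  simpa only [hrank, zetaValue] using hasGF_isBracketStable hr hg

end Zeta

/-! ### The rational functions -/

section RationalFunctions

/-- The common denominator of the rational functions in the zeta function. -/
def zetaDenom {R : Type*} [CommRing R] (x y : R) : R :=
  (1 - x ^ 7 * y ^ 5) * (1 - x ^ 8 * y ^ 7) * (1 - x ^ 14 * y ^ 8) * (1 - x ^ 18 * y ^ 9) *
    ∏ i ∈ Finset.range 6, (1 - x ^ i * y)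

/-- The numerator of the part of the zeta function independent of the curve. -/
def zetaNumConst {R : Type*} [CommRing R] (x y : R) : R :=
  (1 - x ^ 7 * y ^ 5) * ((1 + x ^ 12 * y ^ 8 * (1 + x)) * (1 - x ^ 8 * y ^ 7) +
    x ^ 6 * (x ^ 2 + x + 1) * y ^ 7 * (1 + x ^ 13 * y ^ 8))

/-- The numerator of the coefficient of the number of points. -/
def zetaNumCurve {R : Type*} [CommRing R] (x y : R) : R :=
  x ^ 6 * y ^ 5 * (1 - y ^ 2) * (1 + x ^ 13 * y ^ 8)

theorem zetaDenom_ne_zero {p : ℕ} [Fact p.Prime] {T : ℂ} (hT : ‖T‖ < ((p : ℝ) ^ 9)⁻¹) :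
    zetaDenom (p : ℂ) T ≠ 0 := by
  have hfactor (m k : ℕ) (hk : k ≠ 0) (hm : m ≤ 9 * k) : 1 - (p : ℂ) ^ m * T ^ k ≠ 0 :=
    one_sub_pow_mul_pow_ne_zero hT hk hm
  refine mul_ne_zero (mul_ne_zero (mul_ne_zero (mul_ne_zero ?_ ?_) ?_) ?_)
    (Finset.prod_ne_zero_iff.2 fun i hi => ?_)
  iterate 4 exact hfactor _ _ (by norm_num) (by norm_num)
  have hi : i ≤ 9 * 1 := by linarith [Finset.mem_range.1 hi]
  simpa only [pow_one] using hfactor i 1 one_ne_zero hi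

theorem zetaValue_eq {P N T : ℂ} (h : zetaDenom P T ≠ 0) :
    zetaValue P N T =
      zetaNumConst P T / zetaDenom P T + N * (zetaNumCurve P T / zetaDenom P T) := by
  simp only [zetaDenom, mul_ne_zero_iff] at h
  obtain ⟨⟨⟨⟨h₁, h₂⟩, h₃⟩, h₄⟩, h₅⟩ := h
  rw [zetaValue, Finset.prod_inv_distrib, zetaDenom]
  generalize ∏ i ∈ Finset.range 6, (1 - P ^ i * T) = D at h₅ ⊢
  rw [latticeSum, lineSum, cyclicSum, zetaNumConst, zetaNumCurve]
  field_simp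
  ring

theorem hasValueAt_div (f g : MvPolynomial (Fin 2) ℚ) {u v : ℂ}
    (h : MvPolynomial.aeval ![u, v] g ≠ 0) :
    HasValueAt (algebraMap _ RatFunc₂ f / algebraMap _ RatFunc₂ g) u v
      (MvPolynomial.aeval ![u, v] f / MvPolynomial.aeval ![u, v] g) := by
  have hg : algebraMap _ RatFunc₂ g ≠ 0 :=
    (map_ne_zero_iff _ (IsFractionRing.injective _ RatFunc₂)).2 fun h0 => h (by rw [h0, map_zero])
  exact ⟨f, g, div_mul_cancel₀ _ hg, h, rfl⟩

theorem hasValueAt_zero (u v : ℂ) : HasValueAt 0 u v 0 := by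
  simpa only [map_zero, zero_div] using hasValueAt_div 0 1 (u := u) (v := v) (by simp)

/-- The part of the zeta function independent of the curve, as an element of `ℚ(X, Y)` where `X`
stands for `p` and `Y` for `p ^ (-s)`. -/
noncomputable def constRatFunc : RatFunc₂ :=
  algebraMap (MvPolynomial (Fin 2) ℚ) RatFunc₂
      (zetaNumConst (MvPolynomial.X 0) (MvPolynomial.X 1)) /
    algebraMap (MvPolynomial (Fin 2) ℚ) RatFunc₂
      (zetaDenom (MvPolynomial.X 0) (MvPolynomial.X 1))

/-- The coefficient of the number of points in the zeta function, in the same variables as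
`constRatFunc`. -/
noncomputable def curveRatFunc : RatFunc₂ :=
  algebraMap (MvPolynomial (Fin 2) ℚ) RatFunc₂
      (zetaNumCurve (MvPolynomial.X 0) (MvPolynomial.X 1)) /
    algebraMap (MvPolynomial (Fin 2) ℚ) RatFunc₂
      (zetaDenom (MvPolynomial.X 0) (MvPolynomial.X 1))

theorem aeval_zetaDenom (u v : ℂ) :
    MvPolynomial.aeval ![u, v] (zetaDenom (MvPolynomial.X 0) (MvPolynomial.X 1) :
      MvPolynomial (Fin 2) ℚ) = zetaDenom u v := by
  simp [zetaDenom, map_prod]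

theorem aeval_zetaNumConst (u v : ℂ) :
    MvPolynomial.aeval ![u, v] (zetaNumConst (MvPolynomial.X 0) (MvPolynomial.X 1) :
      MvPolynomial (Fin 2) ℚ) = zetaNumConst u v := by
  simp [zetaNumConst]

theorem aeval_zetaNumCurve (u v : ℂ) :
    MvPolynomial.aeval ![u, v] (zetaNumCurve (MvPolynomial.X 0) (MvPolynomial.X 1) :
      MvPolynomial (Fin 2) ℚ) = zetaNumCurve u v := by
  simp [zetaNumCurve]

theorem hasValueAt_constRatFunc {u v : ℂ} (h : zetaDenom u v ≠ 0) :
    HasValueAt constRatFunc u v (zetaNumConst u v / zetaDenom u v) := by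
  rw [← aeval_zetaDenom] at h ⊢
  rw [← aeval_zetaNumConst]
  exact hasValueAt_div _ _ h

theorem hasValueAt_curveRatFunc {u v : ℂ} (h : zetaDenom u v ≠ 0) :
    HasValueAt curveRatFunc u v (zetaNumCurve u v / zetaDenom u v) := by
  rw [← aeval_zetaDenom] at h ⊢
  rw [← aeval_zetaNumCurve]
  exact hasValueAt_div _ _ h

theorem curveRatFunc_ne_zero : curveRatFunc ≠ 0 := by
  have hinj := IsFractionRing.injective (MvPolynomial (Fin 2) ℚ) RatFunc₂
  refine div_ne_zero ((map_ne_zero_iff _ hinj).2 fun hnum => ?_)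
    ((map_ne_zero_iff _ hinj).2 fun hden => ?_)
  · have hval := aeval_zetaNumCurve 1 2
    rw [hnum, map_zero, zetaNumCurve] at hval
    norm_num at hval
  · have hval := aeval_zetaDenom 0 0
    rw [hden, map_zero, zetaDenom] at hval
    norm_num at hval

end RationalFunctions

/-! ### Integral models -/

section Models

theorem exists_isIntegralModelAt (W : WeierstrassCurve ℚ) {x y : ℚ}
    (hxy : W.toAffine.Equation x y) :
    ∃ W₀ : WeierstrassCurve ℤ, IsIntegralModelAt W x y W₀ ∧ W₀.a₁ = 0 := by
  have hclear (q : ℚ) : ∃ d n : ℤ, (d : ℚ) ≠ 0 ∧ (n : ℚ) = d * q :=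
    ⟨q.den, q.num, by exact_mod_cast q.den_ne_zero, by
      rw [Int.cast_natCast, mul_comm, Rat.mul_den_eq_num]⟩
  obtain ⟨d₂, n₂, h₂, e₂⟩ := hclear (W.a₂ - (-W.a₁ / 2) * W.a₁ + 3 * x - (-W.a₁ / 2) ^ 2)
  obtain ⟨d₃, n₃, h₃, e₃⟩ := hclear (W.a₃ + x * W.a₁ + 2 * y)
  obtain ⟨d₄, n₄, h₄, e₄⟩ := hclear (W.a₄ - (-W.a₁ / 2) * W.a₃ + 2 * x * W.a₂ -
    (y + x * (-W.a₁ / 2)) * W.a₁ + 3 * x ^ 2 - 2 * (-W.a₁ / 2) * y)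
  have heq := (WeierstrassCurve.Affine.equation_iff x y).1 hxy
  refine ⟨⟨0, (d₂ * d₃ * d₄) * (d₃ * d₄ * n₂), (d₂ * d₃ * d₄) ^ 2 * (d₂ * d₄ * n₃),
    (d₂ * d₃ * d₄) ^ 3 * (d₂ * d₃ * n₄), 0⟩,
    ⟨⟨(Units.mk0 (d₂ * d₃ * d₄ : ℚ) (mul_ne_zero (mul_ne_zero h₂ h₃) h₄))⁻¹, x, -W.a₁ / 2, y⟩,
      ?_, rfl, rfl⟩, rfl⟩
  ext
  all_goals
    simp only [WeierstrassCurve.variableChange_def, WeierstrassCurve.map, inv_inv, Units.val_mk0,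
      eq_intCast, Int.cast_mul, Int.cast_pow, Int.cast_zero, e₂, e₃, e₄]
  iterate 4 ring
  linear_combination -(d₂ * d₃ * d₄ : ℚ) ^ 6 * heq

variable {W : WeierstrassCurve ℚ} {x y : ℚ} {W₀ : WeierstrassCurve ℤ}

theorem IsIntegralModelAt.a₆_eq_zero (h : IsIntegralModelAt W x y W₀)
    (hxy : W.toAffine.Equation x y) : W₀.a₆ = 0 := by
  obtain ⟨C, hC, rfl, rfl⟩ := h
  have heq := (WeierstrassCurve.Affine.equation_iff _ _).1 hxy
  have ha₆ := congrArg WeierstrassCurve.a₆ hC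
  simp only [WeierstrassCurve.variableChange_def, WeierstrassCurve.map, eq_intCast] at ha₆
  have hconst : W.a₆ + C.r * W.a₄ + C.r ^ 2 * W.a₂ + C.r ^ 3 - C.t * W.a₃ - C.t ^ 2 -
      C.r * C.t * W.a₁ = 0 := by
    linear_combination -heq
  rw [hconst, mul_zero] at ha₆
  exact_mod_cast ha₆.symm

theorem IsIntegralModelAt.Δ_ne_zero [W.IsElliptic] (h : IsIntegralModelAt W x y W₀) :
    W₀.Δ ≠ 0 := by
  obtain ⟨C, hC, -, -⟩ := h
  have hΔ : (C • W).Δ = W₀.Δ := by rw [hC, WeierstrassCurve.map_Δ, eq_intCast]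
  exact fun h0 => (C • W).isUnit_Δ.ne_zero (by rw [hΔ, h0, Int.cast_zero])

theorem finite_setOf_natCast_dvd {c : ℤ} (hc : c ≠ 0) : {p : ℕ | (p : ℤ) ∣ c}.Finite :=
  (Set.finite_Iic c.natAbs).subset fun _ hp =>
    Nat.le_of_dvd (Int.natAbs_pos.2 hc) (Int.natCast_dvd.1 hp)

theorem finite_not_isGoodPrime (hΔ : W₀.Δ ≠ 0) :
    {p : ℕ | p.Prime ∧ ¬ IsGoodPrime W₀ p}.Finite := by
  have hcoeff : ({c ∈ ({W₀.a₁, W₀.a₂, W₀.a₃, W₀.a₄, W₀.a₆} : Set ℤ) | c ≠ 0}).Finite :=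
    (Set.toFinite _).subset (Set.sep_subset _ _)
  refine ((finite_setOf_natCast_dvd hΔ).union (hcoeff.biUnion fun c hc =>
    finite_setOf_natCast_dvd hc.2)).subset fun p hp => ?_
  by_contra h
  simp only [Set.mem_union, Set.mem_iUnion, not_or, not_exists] at h
  exact hp.2 ⟨h.1, fun c hc hc0 hd => h.2 c ⟨hc, hc0⟩ hd⟩

end Models

theorem exists_isPrimitiveVec_linearIndependent :
    ∃ M₁ M₂ : Fin 3 → ℤ,
      IsPrimitiveVec M₁ ∧ IsPrimitiveVec M₂ ∧ LinearIndependent ℤ ![M₁, M₂] := by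
  refine ⟨![1, 0, 0], ![0, 1, 0], by unfold IsPrimitiveVec; decide,
    by unfold IsPrimitiveVec; decide, LinearIndependent.pair_iff.2 fun a b hab => ⟨?_, ?_⟩⟩
  · simpa using congrFun hab 0
  · simpa using congrFun hab 1

theorem theorem1_general : ∃ P₁ P₂ : RatFunc₂, P₂ ≠ 0 ∧
    ∀ W₀ : WeierstrassCurve ℤ, W₀.a₆ = 0 → ∃ (G : Type) (_ : Group G) (L : Type) (_ : LieRing L),
      IsTorsionFreeClassTwo G ∧ IsAssociatedLieRing 9 G L ∧
      ∀ (p : ℕ) [Fact p.Prime], ¬ (p : ℤ) ∣ W₀.Δ → ∀ s : ℂ, 9 < s.re →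
        ∃ z₁ z₂ : ℂ,
          HasValueAt P₁ p ((p : ℂ) ^ (-s)) z₁ ∧
          HasValueAt P₂ p ((p : ℂ) ^ (-s)) z₂ ∧
          HasGroupZeta p G s (z₁ + (redCurve p W₀).ncard * z₂) ∧
          HasLieZeta p L s (z₁ + (redCurve p W₀).ncard * z₂) := by
  let b := Pi.basisFun ℤ (Fin 3)
  refine ⟨constRatFunc, curveRatFunc, curveRatFunc_ne_zero, fun W₀ h6 =>
    ⟨HeisenbergGroup (cubicPairing W₀), inferInstance, HeisenbergLie (cubicPairing W₀),
      inferInstance, HeisenbergGroup.isTorsionFreeClassTwo (cubicPairing_ne_zero W₀),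
      HeisenbergGroup.isAssociatedLieRing b b b, fun p hp hΔ s hs => ?_⟩⟩
  have hT : ‖(p : ℂ) ^ (-s)‖ < ((p : ℝ) ^ 9)⁻¹ :=
    norm_natCast_cpow_neg_lt hp.out.one_lt (by exact_mod_cast hs)
  have hdenom := zetaDenom_ne_zero hT
  have hGF := hasGF_cubicPairing h6 hΔ
  refine ⟨_, _, hasValueAt_constRatFunc hdenom, hasValueAt_curveRatFunc hdenom, ?_⟩
  rw [← zetaValue_eq hdenom]
  exact ⟨HeisenbergGroup.hasGroupZeta hGF hT, HeisenbergLie.hasLieZeta hGF hT⟩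

theorem theorem1 (W : WeierstrassCurve ℚ) [W.IsElliptic] (x y : ℚ)
    (hxy : W.toAffine.Equation x y) :
    (∃ W₀ : WeierstrassCurve ℤ, IsIntegralModelAt W x y W₀ ∧ W₀.a₁ = 0) ∧
    ∀ W₀ : WeierstrassCurve ℤ, IsIntegralModelAt W x y W₀ →
      {p : ℕ | p.Prime ∧ ¬ IsGoodPrime W₀ p}.Finite ∧
      ∃ (G : Type) (_ : Group G) (L : Type) (_ : LieRing L)
        (M₁ M₂ : Fin 3 → ℤ) (P₁ P₂ P₃ P₄ P₅ : RatFunc₂),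
        IsTorsionFreeClassTwo G ∧ IsAssociatedLieRing 9 G L ∧
        IsPrimitiveVec M₁ ∧ IsPrimitiveVec M₂ ∧ LinearIndependent ℤ ![M₁, M₂] ∧
        P₂ ≠ 0 ∧
        ∀ (p : ℕ) [Fact p.Prime], IsGoodPrime W₀ p → ∀ s : ℂ, 9 < s.re →
          ∃ z₁ z₂ z₃ z₄ z₅ : ℂ,
            HasValueAt P₁ p ((p : ℂ) ^ (-s)) z₁ ∧
            HasValueAt P₂ p ((p : ℂ) ^ (-s)) z₂ ∧
            HasValueAt P₃ p ((p : ℂ) ^ (-s)) z₃ ∧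
            HasValueAt P₄ p ((p : ℂ) ^ (-s)) z₄ ∧
            HasValueAt P₅ p ((p : ℂ) ^ (-s)) z₅ ∧
            HasGroupZeta p G s
              (z₁ + (redCurve p W₀).ncard * z₂
                + (redLine p M₁ ∩ redCurve p W₀).ncard * z₃
                + (redLine p M₂ ∩ redCurve p W₀).ncard * z₄
                + (redLine p M₁ ∩ redLine p M₂ ∩ redCurve p W₀).ncard * z₅) ∧
            HasLieZeta p L s
              (z₁ + (redCurve p W₀).ncard * z₂
                + (redLine p M₁ ∩ redCurve p W₀).ncard * z₃
                + (redLine p M₂ ∩ redCurve p W₀).ncard * z₄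
                + (redLine p M₁ ∩ redLine p M₂ ∩ redCurve p W₀).ncard * z₅) := by
  refine ⟨exists_isIntegralModelAt W hxy, fun W₀ hW₀ =>
    ⟨finite_not_isGoodPrime hW₀.Δ_ne_zero, ?_⟩⟩
  obtain ⟨P₁, P₂, hP₂, hcurves⟩ := theorem1_general
  obtain ⟨G, _, L, _, hG, hGL, hzeta⟩ := hcurves W₀ (hW₀.a₆_eq_zero hxy)
  obtain ⟨M₁, M₂, hM₁, hM₂, hM⟩ := exists_isPrimitiveVec_linearIndependent
  refine ⟨G, _, L, _, M₁, M₂, P₁, P₂, 0, 0, 0, hG, hGL, hM₁, hM₂, hM, hP₂, fun p _ hp s hs => ?_⟩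
  obtain ⟨z₁, z₂, h₁, h₂, hz⟩ := hzeta p hp.1 s hs
  refine ⟨z₁, z₂, 0, 0, 0, h₁, h₂, hasValueAt_zero _ _, hasValueAt_zero _ _,
    hasValueAt_zero _ _, ?_⟩
  simpa only [mul_zero, add_zero] using hz
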